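/- Conventions. Let $(p_j)_{j\in\mathbb Z}$ be non-negative integers, only finitely many of them nonzero, and let $\mathcal W=\bigoplus_{j\neq 0}\mathcal W_j$ be the real $\mathbb Z$-graded vector space with $\dim\mathcal W_j=p_j$ for $j\ne 0$. Graded algebras are direct sums of their homogeneous components, and sheaves of graded algebras are sheaves in each degree. For $V\subseteq\mathbb R^{p_0}$ open, $\mathcal O(V)=C^\infty(V)\otimes\overline{\mathbf S\mathcal W}$ is the graded algebra whose degree $d$ component consists of all formal power series, of total degree $d$, in the supercommuting elements of a homogeneous basis of $\mathcal W$, with coefficients in $C^\infty(V)$. For $U\subseteq\mathbb R^{p_0}$ open, the graded domain $U^{(p_j)}$ is $U$ with the restriction $\mathcal O_U$ of this sheaf. A $\mathbb Z$-graded manifold $M=(|M|,\mathcal O_M)$ of dimension $(p_j)$ is a Hausdorff second-countable space with a sheaf of associative unital supercommutative $\mathbb Z$-graded $\mathbb R$-algebras whose stalks have a unique maximal homogeneous ideal, such that every point has an open neighbourhood $V$ that is trivialising, i.e. has an isomorphism $\phi$ of graded locally ringed spaces (over $\mathbb R$) from $(V,\mathcal O_M|_V)$ to an open subset $\widetilde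 V$ of the graded domain $\mathbb R^{(p_j)}$. Given such $\phi$, write $C^\infty_V$ and $\mathrm{Vec}_V$ for the sheaves of smooth functions and of ordinary smooth vector fields on $V\cong\widetilde V$. A vector field of degree $k$ on an open $V\subseteq |M|$ is a derivation of degree $k$ of the sheaf $\mathcal O_M|_V$: $\mathbb R$-linear maps $X:\mathcal O_M(V')\to\mathcal O_M(V')$, $V'\subseteq V$ open, compatible with restrictions, raising degrees by $k$, with $X(fg)=X(f)g+(-1)^{k|f|}fX(g)$. $\mathrm{Vec}_M(V)$ is the $\mathcal O_M(V)$-module of (finite) sums of vector fields of various degrees on $V$. Theorem. (1) Let $U\subseteq\mathbb R^{p_0}$ be open. The vector fields on $U^{(p_j)}$ form a free sheaf of graded $\mathcal O_U$-modules, and (a), (b) below hold for $U^{(p_j)}$ with $V=U$ and $\phi=\mathrm{id}$. (2) Let $M$ be a $\mathbb Z$-graded manifold of dimension $(p_j)$. Then $\mathrm{Vec}_M$ is a locally free sheaf of graded $\mathcal O_M$-modules. For every open $V\subseteq|M|$ with a trivialisation $\phi:V\to\widetilde V$, $\mathrm{Vec}_M|_V$ is free and: (a) there is an isomorphism of sheaves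 of graded $\mathcal O_M|_V$-modules $$\mathrm{Vec}_M|_V\;\simeq\;\bigl(\mathcal O_M|_V\otimes_{C^\infty_V}\mathrm{Vec}_V\bigr)\oplus\bigl(\mathcal O_M|_V\otimes_{\mathbb R}\mathcal W^*\bigr),$$ under which $f\otimes Y+g\otimes\xi$ corresponds to a vector field mapping $h\in C^\infty_V$ to $f\cdot Y(h)$ and $w\in\mathcal W$ to $\xi(w)\,g$; (b) if $(t_i)_{i\le p_0}$ is a global coordinate system on $\widetilde V$ and $(w_\alpha)_\alpha$ is a basis of homogeneous elements of $\mathcal W$, and $(t_i,w_\alpha)$ also denotes their pullbacks to $V$, there are unique vector fields $\frac{\partial}{\partial t_i}$ of degree $0$ and $\frac{\partial}{\partial w_\alpha}$ of degree $-|w_\alpha|$ on $V$ with $\frac{\partial}{\partial t_i}(t_j)=\delta_{ij}$, $\frac{\partial}{\partial t_i}(w_\beta)=0$, $\frac{\partial}{\partial w_\alpha}(w_\beta)=\delta_{\alpha\beta}$, $\frac{\partial}{\partial w_\alpha}(t_j)=0$ that form a basis of the sheaf of modules $\mathrm{Vec}_M|_V$; and for every open $V'\subseteq V$, every vector field $X\in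 \mathrm{Vec}_M(V')$ is $$X=\sum_i X(t_i)\frac{\partial}{\partial t_i}+\sum_\alpha X(w_\alpha)\frac{\partial}{\partial w_\alpha},$$ and these are the only coefficients in $\mathcal O_M(V')$ with which $X$ is such a combination. -/

import Mathlib

open TopologicalSpace
open scoped Manifold ContDiff DirectSum TensorProduct

namespace GradedGeometry

/-- The index set of a homogeneous basis `w_a` of the graded vector space `W = ⨁_{j ≠ 0} W_j` with
`dim W_j = p j`, totally ordered lexicographically. The dimension `(p_j)` is a sequence of
non-negative integers with finitely many nonzero entries; `p 0` is the dimension of the base. -/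
abbrev Gen (p : ℤ →₀ ℕ) : Type := Σₗ j : ↥(p.support.erase 0), Fin (p j)

/-- The degree of the generator `w_a`; it is never `0`. -/
def Gen.deg {p : ℤ →₀ ℕ} (a : Gen p) : ℤ := (ofLex a).1.1

section Series
variable {p : ℤ →₀ ℕ}

/-- Multi-indices `m` for which the ordered monomial `w^m = ∏_a w_a ^ (m a)` (factors in increasing
order) is nonzero: odd generators occur at most once. -/
def Adm (m : Gen p →₀ ℕ) : Prop := ∀ a, Odd a.deg → m a ≤ 1

/-- The degree of the monomial `w^m`. -/
def wt (m : Gen p →₀ ℕ) : ℤ := ∑ a, (m a : ℤ) * a.deg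

/-- The exponent of the sign in `w^m * w^n = ± w^(m + n)`: every factor `w_b` of `w^n` passes every
factor `w_a` of `w^m` with `b < a`, at the cost of the sign `(-1)^(|a||b|)`. -/
def crossing (m n : Gen p →₀ ℕ) : ℤ :=
  ∑ a, ∑ b, if b < a then ((m a : ℤ) * a.deg) * ((n b : ℤ) * b.deg) else 0

theorem wt_zero : wt (0 : Gen p →₀ ℕ) = 0 := by simp [wt]
theorem wt_add (m n : Gen p →₀ ℕ) : wt (m + n) = wt m + wt n := by
  simp [wt, add_mul, Finset.sum_add_distrib]
theorem crossing_zero_left (n : Gen p →₀ ℕ) : crossing 0 n = 0 := by simp [crossing]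
theorem crossing_zero_right (n : Gen p →₀ ℕ) : crossing n 0 = 0 := by simp [crossing]
theorem crossing_add_left (m m' n : Gen p →₀ ℕ) :
    crossing (m + m') n = crossing m n + crossing m' n := by
  simp only [crossing, ← Finset.sum_add_distrib]
  refine Finset.sum_congr rfl fun a _ => Finset.sum_congr rfl fun b _ => ?_
  split_ifs
  · push_cast [Finsupp.add_apply]; ring
  · simp
theorem crossing_add_right (m n n' : Gen p →₀ ℕ) :
    crossing m (n + n') = crossing m n + crossing m n' := by
  simp only [crossing, ← Finset.sum_add_distrib]
  refine Finset.sum_congr rfl fun a _ => Finset.sum_congr rfl fun b _ => ?_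
  split_ifs
  · push_cast [Finsupp.add_apply]; ring
  · simp

theorem Adm.left {m n : Gen p →₀ ℕ} (h : Adm (m + n)) : Adm m := fun a ha =>
  le_trans (by simp) (h a ha)
theorem Adm.right {m n : Gen p →₀ ℕ} (h : Adm (m + n)) : Adm n := fun a ha =>
  le_trans (by simp) (h a ha)
theorem adm_zero : Adm (0 : Gen p →₀ ℕ) := fun _ _ => by simp

theorem crossing_swap {m n : Gen p →₀ ℕ} (h : Adm (m + n)) :
    (crossing m n).negOnePow = (wt m * wt n).negOnePow * (crossing n m).negOnePow := by
  have key : wt m * wt n = crossing m n + crossing n m + ∑ a, ((m a : ℤ) * a.deg) * ((n a : ℤ) * a.deg) := by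
    have e : crossing n m = ∑ a, ∑ b, if a < b then ((m a : ℤ) * a.deg) * ((n b : ℤ) * b.deg) else 0 := by
      rw [crossing, Finset.sum_comm]
      refine Finset.sum_congr rfl fun a _ => Finset.sum_congr rfl fun b _ => ?_
      split_ifs <;> ring
    rw [e, crossing, wt, wt, Finset.sum_mul_sum, ← Finset.sum_add_distrib, ← Finset.sum_add_distrib]
    refine Finset.sum_congr rfl fun a _ => ?_
    have : ((m a : ℤ) * a.deg) * ((n a : ℤ) * a.deg) =
        ∑ b, if a = b then ((m a : ℤ) * a.deg) * ((n b : ℤ) * b.deg) else 0 := by simp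
    rw [this, ← Finset.sum_add_distrib, ← Finset.sum_add_distrib]
    refine Finset.sum_congr rfl fun b _ => ?_
    rcases lt_trichotomy a b with hab | rfl | hab
    · simp [hab, hab.ne, hab.not_gt]
    · simp
    · simp [hab, hab.ne', hab.not_gt]
  have ev : Even (∑ a, ((m a : ℤ) * a.deg) * ((n a : ℤ) * a.deg)) := by
    refine Finset.even_sum _ fun a _ => ?_
    rcases Int.even_or_odd a.deg with ha | ha
    · exact (ha.mul_left _).mul_right _
    · have := h a ha
      simp only [Finsupp.add_apply] at this
      rcases Nat.eq_zero_or_pos (m a) with h0 | h0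
      · simp [h0]
      · have : n a = 0 := by omega
        simp [this]
  rw [key, Int.negOnePow_add, Int.negOnePow_add, Int.negOnePow_even _ ev, mul_one, mul_assoc,
    Int.units_mul_self, mul_one]

end Series

section SeriesRing
variable (p : ℤ →₀ ℕ) (R : Type*) [CommRing R]

/-- Families of coefficients `f_m` of formal series `∑ f_m w^m`, with finitely many degrees
(an element of a `ℤ`-graded algebra is a finite sum of homogeneous elements). -/
def seriesSubmodule : Submodule R ((Gen p →₀ ℕ) → R) where
  carrier := {f | (∀ m, ¬ Adm m → f m = 0) ∧ ∃ s : Finset ℤ, ∀ m, f m ≠ 0 → wt m ∈ s}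
  zero_mem' := ⟨fun _ _ => rfl, ∅, fun _ h => (h rfl).elim⟩
  add_mem' := by
    rintro f g ⟨hf, s, hs⟩ ⟨hg, t, ht⟩
    refine ⟨fun m hm => by simp [hf m hm, hg m hm], s ∪ t, fun m hm => ?_⟩
    by_contra hc
    rw [Finset.mem_union, not_or] at hc
    exact hm (by simp [not_not.1 (mt (hs m) hc.1), not_not.1 (mt (ht m) hc.2)])
  smul_mem' := by
    rintro c f ⟨hf, s, hs⟩
    exact ⟨fun m hm => by simp [hf m hm], s, fun m hm => hs m fun h0 => hm (by simp [h0])⟩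

/-- The `ℤ`-graded algebra of formal power series, with coefficients in `R`, in the graded commuting
generators `w_a`: every element is uniquely `∑_m f_m w^m`, the sum being over admissible `m`.
In each degree, all formal power series of that degree are allowed. -/
def Series : Type _ := seriesSubmodule p R

namespace Series
variable {p R}

instance : AddCommGroup (Series p R) := inferInstanceAs (AddCommGroup (seriesSubmodule p R))

instance instModule {k : Type*} [CommRing k] [Algebra k R] : Module k (Series p R) :=
  inferInstanceAs (Module k (seriesSubmodule p R))

/-- The coefficient of `w^m`. -/
def coeff (f : Series p R) (m : Gen p →₀ ℕ) : R := f.1 m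

@[ext] theorem ext {f g : Series p R} (h : ∀ m, f.coeff m = g.coeff m) : f = g :=
  Subtype.ext (funext h)

theorem coeff_eq_zero (f : Series p R) {m} (hm : ¬ Adm m) : f.coeff m = 0 := f.2.1 m hm
@[simp] theorem coeff_zero (m) : (0 : Series p R).coeff m = 0 := rfl
@[simp] theorem coeff_add (f g : Series p R) (m) : (f + g).coeff m = f.coeff m + g.coeff m := rfl
@[simp] theorem coeff_neg (f : Series p R) (m) : (-f).coeff m = - f.coeff m := rfl
@[simp] theorem coeff_smul {k : Type*} [CommRing k] [Algebra k R] (c : k) (f : Series p R) (m) :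
    (c • f).coeff m = c • f.coeff m := rfl

def coeffHom (m : Gen p →₀ ℕ) : Series p R →+ R where
  toFun f := f.coeff m
  map_zero' := rfl
  map_add' _ _ := rfl

open Classical in
noncomputable instance : One (Series p R) where
  one := ⟨fun m => if m = 0 then 1 else 0,
    fun m hm => if_neg fun h => hm (by rw [h]; exact adm_zero), {0}, fun m hm => by
      have : m = 0 := by by_contra h; exact hm (if_neg h)
      simp [this, wt_zero]⟩

open Classical in
theorem coeff_one (m : Gen p →₀ ℕ) : (1 : Series p R).coeff m = if m = 0 then 1 else 0 := by
  change (if _ then _ else _) = _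
  congr

open Classical in
noncomputable instance : Mul (Series p R) where
  mul f g := ⟨fun m => if Adm m then ∑ x ∈ Finset.HasAntidiagonal.antidiagonal m,
      (crossing x.1 x.2).negOnePow • (f.coeff x.1 * g.coeff x.2) else 0,
    fun m hm => if_neg hm, by
      obtain ⟨s, hs⟩ := f.2.2
      obtain ⟨t, ht⟩ := g.2.2
      refine ⟨Finset.image₂ (· + ·) s t, fun m hm => ?_⟩
      have hm1 : Adm m := by by_contra h; exact hm (if_neg h)
      simp only [hm1, if_true] at hm
      obtain ⟨x, hx, hne⟩ := Finset.exists_ne_zero_of_sum_ne_zero hm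
      rw [← Finset.HasAntidiagonal.mem_antidiagonal.1 hx, wt_add]
      refine Finset.mem_image₂_of_mem (hs _ fun h => hne ?_) (ht _ fun h => hne ?_)
      · change f.coeff x.1 = 0 at h
        simp [h]
      · change g.coeff x.2 = 0 at h
        simp [h]⟩

theorem coeff_mul (f g : Series p R) {m : Gen p →₀ ℕ} (hm : Adm m) :
    (f * g).coeff m = ∑ x ∈ Finset.HasAntidiagonal.antidiagonal m,
      (crossing x.1 x.2).negOnePow • (f.coeff x.1 * g.coeff x.2) := by
  classical
  change (if _ then _ else _) = _
  rw [if_pos hm]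

theorem ext_adm {f g : Series p R} (h : ∀ m, Adm m → f.coeff m = g.coeff m) : f = g :=
  ext fun m => by
    by_cases hm : Adm m
    · exact h m hm
    · rw [coeff_eq_zero _ hm, coeff_eq_zero _ hm]

protected theorem one_mul (f : Series p R) : 1 * f = f := by
  classical
  refine ext_adm fun m hm => ?_
  rw [coeff_mul _ _ hm, Finset.sum_eq_single (0, m)]
  · simp [coeff_one, crossing_zero_left]
  · rintro ⟨a, b⟩ hab hne
    have : a ≠ 0 := by
      rintro rfl
      simp at hab
      exact hne (by rw [hab])
    simp [coeff_one, this]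
  · simp

protected theorem mul_one (f : Series p R) : f * 1 = f := by
  classical
  refine ext_adm fun m hm => ?_
  rw [coeff_mul _ _ hm, Finset.sum_eq_single (m, 0)]
  · simp [coeff_one, crossing_zero_right]
  · rintro ⟨a, b⟩ hab hne
    have : b ≠ 0 := by
      rintro rfl
      simp at hab
      exact hne (by rw [hab])
    simp [coeff_one, this]
  · simp

protected theorem mul_assoc (f g h : Series p R) : f * g * h = f * (g * h) := by
  classical
  refine ext_adm fun m hm => ?_
  rw [coeff_mul _ _ hm, coeff_mul _ _ hm]
  have e1 : ∀ x ∈ Finset.HasAntidiagonal.antidiagonal m,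
      (crossing x.1 x.2).negOnePow • ((f * g).coeff x.1 * h.coeff x.2) =
      ∑ y ∈ Finset.HasAntidiagonal.antidiagonal x.1, ((crossing x.1 x.2).negOnePow * (crossing y.1 y.2).negOnePow) •
        (f.coeff y.1 * g.coeff y.2 * h.coeff x.2) := by
    intro x hx
    rw [← Finset.HasAntidiagonal.mem_antidiagonal.1 hx] at hm
    rw [coeff_mul _ _ hm.left, Finset.sum_mul, Finset.smul_sum]
    refine Finset.sum_congr rfl fun y _ => ?_
    rw [mul_smul, smul_mul_assoc]
  have e2 : ∀ x ∈ Finset.HasAntidiagonal.antidiagonal m,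
      (crossing x.1 x.2).negOnePow • (f.coeff x.1 * (g * h).coeff x.2) =
      ∑ y ∈ Finset.HasAntidiagonal.antidiagonal x.2, ((crossing x.1 x.2).negOnePow * (crossing y.1 y.2).negOnePow) •
        (f.coeff x.1 * g.coeff y.1 * h.coeff y.2) := by
    intro x hx
    rw [← Finset.HasAntidiagonal.mem_antidiagonal.1 hx] at hm
    rw [coeff_mul _ _ hm.right, Finset.mul_sum, Finset.smul_sum]
    refine Finset.sum_congr rfl fun y _ => ?_
    rw [mul_smul, mul_smul_comm, mul_assoc]
  rw [Finset.sum_congr rfl e1, Finset.sum_congr rfl e2, Finset.sum_sigma', Finset.sum_sigma']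
  refine Finset.sum_nbij' (fun x => ⟨(x.2.1, x.2.2 + x.1.2), (x.2.2, x.1.2)⟩)
    (fun x => ⟨(x.1.1 + x.2.1, x.2.2), (x.1.1, x.2.1)⟩) ?_ ?_ ?_ ?_ ?_
  · rintro ⟨⟨i, j⟩, ⟨k, l⟩⟩ hx
    simp only [Finset.mem_sigma, Finset.HasAntidiagonal.mem_antidiagonal] at hx ⊢
    rw [← hx.1, ← hx.2]; simp [add_assoc]
  · rintro ⟨⟨i, j⟩, ⟨k, l⟩⟩ hx
    simp only [Finset.mem_sigma, Finset.HasAntidiagonal.mem_antidiagonal] at hx ⊢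
    rw [← hx.1, ← hx.2]; simp [add_assoc]
  · rintro ⟨⟨i, j⟩, ⟨k, l⟩⟩ hx
    simp only [Finset.mem_sigma, Finset.HasAntidiagonal.mem_antidiagonal] at hx
    obtain ⟨rfl, rfl⟩ := hx
    rfl
  · rintro ⟨⟨i, j⟩, ⟨k, l⟩⟩ hx
    simp only [Finset.mem_sigma, Finset.HasAntidiagonal.mem_antidiagonal] at hx
    obtain ⟨rfl, rfl⟩ := hx
    rfl
  · rintro ⟨⟨i, j⟩, ⟨k, l⟩⟩ hx
    simp only [Finset.mem_sigma, Finset.HasAntidiagonal.mem_antidiagonal] at hx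
    obtain ⟨rfl, rfl⟩ := hx
    simp only [← Int.negOnePow_add, crossing_add_left, crossing_add_right]
    congr 2
    ring

protected theorem mul_add (f g h : Series p R) : f * (g + h) = f * g + f * h := by
  refine ext_adm fun m hm => ?_
  rw [coeff_add, coeff_mul _ _ hm, coeff_mul _ _ hm, coeff_mul _ _ hm, ← Finset.sum_add_distrib]
  exact Finset.sum_congr rfl fun x _ => by rw [coeff_add, mul_add, smul_add]

protected theorem add_mul (f g h : Series p R) : (f + g) * h = f * h + g * h := by
  refine ext_adm fun m hm => ?_
  rw [coeff_add, coeff_mul _ _ hm, coeff_mul _ _ hm, coeff_mul _ _ hm, ← Finset.sum_add_distrib]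
  exact Finset.sum_congr rfl fun x _ => by rw [coeff_add, add_mul, smul_add]

noncomputable instance : Ring (Series p R) where
  __ := (inferInstance : AddCommGroup (Series p R))
  mul_assoc := Series.mul_assoc
  one_mul := Series.one_mul
  mul_one := Series.mul_one
  left_distrib := Series.mul_add
  right_distrib := Series.add_mul
  zero_mul f := by
    refine ext_adm fun m hm => ?_
    simp [coeff_mul _ _ hm]
  mul_zero f := by
    refine ext_adm fun m hm => ?_
    simp [coeff_mul _ _ hm]

noncomputable instance instAlgebra {k : Type*} [CommRing k] [Algebra k R] :
    Algebra k (Series p R) :=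
  Algebra.ofModule
    (fun c f g => by
      refine ext_adm fun m hm => ?_
      rw [coeff_smul, coeff_mul _ _ hm, coeff_mul _ _ hm, Finset.smul_sum]
      exact Finset.sum_congr rfl fun x _ => by
        rw [coeff_smul, smul_mul_assoc, smul_comm])
    (fun c f g => by
      refine ext_adm fun m hm => ?_
      rw [coeff_smul, coeff_mul _ _ hm, coeff_mul _ _ hm, Finset.smul_sum]
      exact Finset.sum_congr rfl fun x _ => by
        rw [coeff_smul, mul_smul_comm, smul_comm])

variable (p R) in
/-- The series all of whose monomials have degree `d`. -/
def homogeneous (k : Type*) [CommRing k] [Algebra k R] (d : ℤ) : Submodule k (Series p R) where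
  carrier := {f | ∀ m, f.coeff m ≠ 0 → wt m = d}
  zero_mem' := fun _ h => (h rfl).elim
  add_mem' := by
    intro f g hf hg m hm
    by_contra hc
    exact hm (by simp [not_not.1 (mt (hf m) hc), not_not.1 (mt (hg m) hc)])
  smul_mem' := fun c f hf m hm => hf m fun h0 => hm (by simp [h0])

section
variable {k : Type*} [CommRing k] [Algebra k R]

theorem mem_homogeneous {d : ℤ} {f : Series p R} :
    f ∈ homogeneous p R k d ↔ ∀ m, f.coeff m ≠ 0 → wt m = d := Iff.rfl

instance homogeneous_gradedMonoid : SetLike.GradedMonoid (homogeneous p R k) where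
  one_mem := fun m hm => by
    classical
    rw [coeff_one] at hm
    have : m = 0 := by by_contra h; exact hm (if_neg h)
    simp [this, wt_zero]
  mul_mem := by
    intro i j f g hf hg m hm
    have hm1 : Adm m := by by_contra h; exact hm (coeff_eq_zero _ h)
    rw [coeff_mul _ _ hm1] at hm
    obtain ⟨x, hx, hne⟩ := Finset.exists_ne_zero_of_sum_ne_zero hm
    rw [← Finset.HasAntidiagonal.mem_antidiagonal.1 hx, wt_add, hf x.1 fun h => hne (by simp [h]),
      hg x.2 fun h => hne (by simp [h])]

open Classical in
/-- The homogeneous component of degree `d`. -/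
def component (d : ℤ) : Series p R →ₗ[k] Series p R where
  toFun f := ⟨fun m => if wt m = d then f.coeff m else 0, fun m hm => by
    simp [coeff_eq_zero f hm], {d}, fun m hm => by
      by_contra h
      exact hm (if_neg (by simpa using h))⟩
  map_add' f g := ext fun m => by
    change (if wt m = d then (f + g).coeff m else 0) =
      (if wt m = d then f.coeff m else 0) + (if wt m = d then g.coeff m else 0)
    split_ifs <;> simp
  map_smul' c f := ext fun m => by
    change (if wt m = d then (c • f).coeff m else 0) =
      c • (if wt m = d then f.coeff m else 0)
    split_ifs <;> simp

open Classical in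
theorem coeff_component (d : ℤ) (f : Series p R) (m) :
    (component (k := k) d f).coeff m = if wt m = d then f.coeff m else 0 := by
  change (if _ then _ else _) = _
  congr

theorem homogeneous_isInternal : DirectSum.IsInternal (homogeneous p R k) := by
  classical
  rw [DirectSum.isInternal_submodule_iff_iSupIndep_and_iSup_eq_top]
  constructor
  · rw [iSupIndep_def]
    intro d
    rw [Submodule.disjoint_def]
    intro f hf hf'
    have hle : (⨆ j, ⨆ (_ : j ≠ d), homogeneous p R k j) ≤ LinearMap.ker (component (k := k) d) := by
      refine iSup₂_le fun j hj g hg => ?_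
      refine ext fun m => ?_
      rw [coeff_component]
      split_ifs with h
      · by_contra hne
        exact hj ((hg m hne).symm.trans h)
      · rfl
    have h0 : component (k := k) d f = 0 := hle hf'
    refine ext fun m => ?_
    by_contra hne
    have := congrArg (fun g => g.coeff m) h0
    simp only [coeff_component, hf m hne, if_true] at this
    exact hne this
  · rw [eq_top_iff]
    intro f _
    obtain ⟨s, hs⟩ := f.2.2
    have : f = ∑ d ∈ s, component (k := k) d f := by
      refine ext fun m => ?_
      have e : (∑ d ∈ s, component (k := k) d f).coeff m =
          ∑ d ∈ s, (component (k := k) d f).coeff m := by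
        exact map_sum (coeffHom m) _ _
      rw [e]
      simp only [coeff_component, Finset.sum_ite_eq]
      split_ifs with h
      · rfl
      · exact not_not.1 (mt (hs m) h)
    rw [this]
    refine Submodule.sum_mem _ fun d _ => Submodule.mem_iSup_of_mem d fun m hm => ?_
    rw [coeff_component] at hm
    by_contra h
    exact hm (if_neg h)

theorem homogeneous_supercomm {i j : ℤ} {f g : Series p R} (hf : f ∈ homogeneous p R k i)
    (hg : g ∈ homogeneous p R k j) : f * g = (i * j).negOnePow • (g * f) := by
  refine ext_adm fun m hm => ?_
  have e : ((i * j).negOnePow • (g * f)).coeff m = (i * j).negOnePow • (g * f).coeff m := rfl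
  rw [e, coeff_mul _ _ hm, coeff_mul _ _ hm, Finset.smul_sum]
  refine Finset.sum_nbij' Prod.swap Prod.swap (fun x hx => ?_) (fun x hx => ?_)
    (fun _ _ => rfl) (fun _ _ => rfl) fun x hx => ?_
  · simpa [add_comm] using hx
  · simpa [add_comm] using hx
  rw [← Finset.HasAntidiagonal.mem_antidiagonal.1 hx] at hm
  by_cases h1 : f.coeff x.1 = 0
  · simp [h1]
  by_cases h2 : g.coeff x.2 = 0
  · simp [h2]
  rw [Prod.fst_swap, Prod.snd_swap, crossing_swap hm, hf _ h1, hg _ h2,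
    mul_smul, mul_comm (f.coeff x.1)]

end

section map
variable {k : Type*} [CommRing k] [Algebra k R] {S : Type*} [CommRing S] [Algebra k S]

/-- Applying an algebra homomorphism to all coefficients. -/
noncomputable def map (φ : R →ₐ[k] S) : Series p R →ₐ[k] Series p S :=
  AlgHom.ofLinearMap
    { toFun := fun f => ⟨fun m => φ (f.coeff m), fun m hm => by simp [coeff_eq_zero f hm], by
        obtain ⟨s, hs⟩ := f.2.2
        exact ⟨s, fun m hm => hs m fun h => hm (by simp [coeff, h])⟩⟩
      map_add' := fun f g => ext fun m => map_add φ _ _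
      map_smul' := fun c f => ext fun m => map_smul φ c _ }
    (by
      classical
      refine ext fun m => ?_
      change φ (coeff 1 m) = _
      rw [coeff_one, coeff_one]
      split_ifs <;> simp)
    (fun f g => by
      refine ext_adm fun m hm => ?_
      change φ (coeff (f * g) m) = _
      rw [coeff_mul _ _ hm, coeff_mul _ _ hm, map_sum]
      refine Finset.sum_congr rfl fun x _ => ?_
      change φ _ = _ • (φ _ * φ _)
      rw [Units.smul_def, Units.smul_def, map_zsmul, map_mul])

@[simp] theorem coeff_map (φ : R →ₐ[k] S) (f : Series p R) (m) :
    (map φ f).coeff m = φ (f.coeff m) := rfl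

end map

open Classical in
/-- The generator `w_a`. -/
noncomputable def gen (a : Gen p) : Series p R :=
  ⟨fun m => if m = Finsupp.single a 1 then 1 else 0, fun m hm => if_neg fun h => hm (by
      subst h
      intro b _
      rw [Finsupp.single_apply]
      split_ifs <;> simp), {a.deg}, fun m hm => by
    have : m = Finsupp.single a 1 := by by_contra h; exact hm (if_neg h)
    subst this
    simp [wt, Finsupp.single_apply]⟩

end Series
end SeriesRing

section Presheaf

universe u v

/-- A presheaf of associative unital supercommutative `ℤ`-graded `ℝ`-algebras
`O(V) = ⨁_d O(V)_d`. The restriction morphisms preserve the degree. -/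
structure GradedPresheaf (X : Type v) [TopologicalSpace X] where
  obj : Opens X → Type u
  [ring : ∀ V, Ring (obj V)]
  [algebra : ∀ V, Algebra ℝ (obj V)]
  deg : ∀ V, ℤ → Submodule ℝ (obj V)
  gradedMonoid : ∀ V, SetLike.GradedMonoid (deg V)
  isInternal : ∀ V, DirectSum.IsInternal (deg V)
  supercomm : ∀ {V i j} {f g : obj V}, f ∈ deg V i → g ∈ deg V j →
    f * g = (i * j).negOnePow • (g * f)
  res : ∀ {V U : Opens X}, V ≤ U → obj U →ₐ[ℝ] obj V
  res_mem : ∀ {V U : Opens X} (h : V ≤ U) {d f}, f ∈ deg U d → res h f ∈ deg V d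
  res_self : ∀ {V : Opens X} (f : obj V), res le_rfl f = f
  res_res : ∀ {W V U : Opens X} (h : W ≤ V) (h' : V ≤ U) (f : obj U),
    res h (res h' f) = res (h.trans h') f

attribute [instance] GradedPresheaf.ring GradedPresheaf.algebra

namespace GradedPresheaf

variable {X : Type v} [TopologicalSpace X] (O : GradedPresheaf.{u} X)

/-- The sheaf condition in the category of graded algebras: compatible homogeneous sections of the
same degree glue uniquely to a section of that degree. -/
def IsSheaf : Prop :=
  ∀ (ι : Type v) (V : ι → Opens X) (d : ℤ) (f : ∀ i, O.obj (V i)),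
    (∀ i, f i ∈ O.deg (V i) d) →
    (∀ i j, O.res (inf_le_left : V i ⊓ V j ≤ V i) (f i) =
      O.res (inf_le_right : V i ⊓ V j ≤ V j) (f j)) →
    ∃! s : O.obj (⨆ i, V i), s ∈ O.deg _ d ∧ ∀ i, O.res (le_iSup V i) s = f i

instance directedSystem (x : X) :
    DirectedSystem (fun V : (OpenNhdsOf x)ᵒᵈ => O.obj (OrderDual.ofDual V).toOpens)
      (fun V W h => O.res (V := (OrderDual.ofDual W).toOpens)
        (U := (OrderDual.ofDual V).toOpens) h) where
  map_self _ f := O.res_self f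
  map_map _ _ _ _ _ f := O.res_res _ _ f

/-- The stalk at `x`: the direct limit of `O(V)` over the open neighbourhoods `V` of `x`. -/
abbrev Stalk (x : X) : Type _ :=
  DirectLimit (fun V : (OpenNhdsOf x)ᵒᵈ => O.obj (OrderDual.ofDual V).toOpens)
    (fun V W h => O.res (V := (OrderDual.ofDual W).toOpens)
      (U := (OrderDual.ofDual V).toOpens) h)

noncomputable instance (x : X) : Ring (O.Stalk x) := inferInstance

/-- The germ of a section. -/
def germ {x : X} (V : OpenNhdsOf x) (f : O.obj V.toOpens) : O.Stalk x :=
  ⟦⟨OrderDual.toDual V, f⟩⟧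

/-- The germs of degree `d`. -/
def stalkDeg (x : X) (d : ℤ) : Set (O.Stalk x) :=
  {g | ∃ V : OpenNhdsOf x, ∃ f ∈ O.deg V.toOpens d, g = O.germ V f}

end GradedPresheaf

/-- An ideal generated by homogeneous elements. (In a supercommutative ring a left ideal generated by
homogeneous elements is two-sided.) -/
def IsHomogeneousIdeal {A : Type*} [Ring A] (𝒜 : ℤ → Set A) (I : Ideal A) : Prop :=
  I = Ideal.span {a | a ∈ I ∧ ∃ d, a ∈ 𝒜 d}

def IsMaximalHomogeneousIdeal {A : Type*} [Ring A] (𝒜 : ℤ → Set A) (I : Ideal A) : Prop :=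
  IsHomogeneousIdeal 𝒜 I ∧ I ≠ ⊤ ∧ ∀ J, IsHomogeneousIdeal 𝒜 J → I ≤ J → J = I ∨ J = ⊤

/-- A graded ring with a unique maximal homogeneous ideal. -/
def IsLocalGradedRing {A : Type*} [Ring A] (𝒜 : ℤ → Set A) : Prop :=
  ∃! I : Ideal A, IsMaximalHomogeneousIdeal 𝒜 I

namespace GradedPresheaf

variable {X : Type v} [TopologicalSpace X] (O : GradedPresheaf.{u} X)

/-- Graded locally ringed spaces. -/
structure IsGradedLocallyRinged : Prop where
  isSheaf : O.IsSheaf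
  isLocal : ∀ x, IsLocalGradedRing (O.stalkDeg x)

/-- Graded derivations of degree `k` of `O(V)`. -/
structure IsDerivation {V : Opens X} (k : ℤ) (D : Module.End ℝ (O.obj V)) : Prop where
  map_deg : ∀ {m f}, f ∈ O.deg V m → D f ∈ O.deg V (m + k)
  leibniz : ∀ {m f}, f ∈ O.deg V m → ∀ g,
    D (f * g) = D f * g + (k * m).negOnePow • (f * D g)

/-- Families of linear maps `O(V') → O(V')`, for all open `V' ⊆ V`. -/
def Family (V : Opens X) : Type _ := ∀ V' : {V' : Opens X // V' ≤ V}, Module.End ℝ (O.obj V')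

noncomputable instance (V : Opens X) : AddCommGroup (O.Family V) :=
  inferInstanceAs (AddCommGroup (∀ V' : {V' : Opens X // V' ≤ V}, Module.End ℝ (O.obj V')))

noncomputable instance (V : Opens X) : Module ℝ (O.Family V) :=
  inferInstanceAs (Module ℝ (∀ V' : {V' : Opens X // V' ≤ V}, Module.End ℝ (O.obj V')))

/-- `(f D)_{V'} = f|_{V'} D_{V'}`. -/
noncomputable instance instModuleFamily (V : Opens X) : Module (O.obj V) (O.Family V) where
  smul f D := fun V' => O.res V'.2 f • D V'
  one_smul D := funext fun V' => by
    change O.res V'.2 1 • D V' = D V'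
    rw [map_one, one_smul]
  mul_smul f g D := funext fun V' => by
    change O.res V'.2 (f * g) • D V' = O.res V'.2 f • O.res V'.2 g • D V'
    rw [map_mul, mul_smul]
  smul_zero f := funext fun V' => smul_zero (O.res V'.2 f)
  smul_add f D D' := funext fun V' => smul_add (O.res V'.2 f) (D V') (D' V')
  add_smul f g D := funext fun V' => by
    change O.res V'.2 (f + g) • D V' = O.res V'.2 f • D V' + O.res V'.2 g • D V'
    rw [map_add, add_smul]
  zero_smul D := funext fun V' => by
    change O.res V'.2 0 • D V' = 0
    rw [map_zero, zero_smul]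

/-- Vector fields of degree `k` on `V`: derivations of degree `k` of the sheaf `O|_V`, that is,
families of derivations `D_{V'}` of `O(V')`, `V' ⊆ V`, compatible with the restrictions. -/
def vecDeg (V : Opens X) (k : ℤ) : Submodule ℝ (O.Family V) where
  carrier := {D | (∀ V', O.IsDerivation k (D V')) ∧
    ∀ (V' V'' : {V' : Opens X // V' ≤ V}) (h : V''.1 ≤ V'.1) (f : O.obj V'.1),
      O.res h (D V' f) = D V'' (O.res h f)}
  zero_mem' := ⟨fun V' => ⟨fun _ => Submodule.zero_mem _, fun _ g => by
    change (0 : O.obj V'.1) = 0 * g + _ • (_ * 0)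
    simp⟩, fun V' V'' h f => map_zero _⟩
  add_mem' := by
    rintro D D' ⟨h1, h2⟩ ⟨h1', h2'⟩
    refine ⟨fun V' => ⟨fun hf => Submodule.add_mem _ ((h1 V').map_deg hf) ((h1' V').map_deg hf),
      fun {m f} hf g => ?_⟩, fun V' V'' h f => ?_⟩
    · change D V' (f * g) + D' V' (f * g) =
        (D V' f + D' V' f) * g + _ • (f * (D V' g + D' V' g))
      rw [(h1 V').leibniz hf, (h1' V').leibniz hf, add_mul, mul_add, smul_add]
      abel
    · change O.res h (D V' f + D' V' f) = D V'' _ + D' V'' _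
      rw [map_add, h2, h2']
  smul_mem' := by
    rintro c D ⟨h1, h2⟩
    refine ⟨fun V' => ⟨fun hf => Submodule.smul_mem _ _ ((h1 V').map_deg hf),
      fun {m f} hf g => ?_⟩, fun V' V'' h f => ?_⟩
    · change c • D V' (f * g) = (c • D V' f) * g + _ • (f * (c • D V' g))
      rw [(h1 V').leibniz hf, smul_add, smul_mul_assoc, mul_smul_comm, smul_comm c]
    · change O.res h (c • D V' f) = c • D V'' _
      rw [map_smul, h2]

theorem smul_mem_vecDeg {V : Opens X} {d k : ℤ} {f : O.obj V} {D : O.Family V}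
    (hf : f ∈ O.deg V d) (hD : D ∈ O.vecDeg V k) : f • D ∈ O.vecDeg V (d + k) := by
  refine ⟨fun V' => ⟨fun {m g} hg => ?_, fun {m g} hg h => ?_⟩, fun V' V'' h g => ?_⟩
  · have := (O.gradedMonoid V'.1).mul_mem (O.res_mem V'.2 hf) ((hD.1 V').map_deg hg)
    rw [show m + (d + k) = d + (m + k) by ring]
    exact this
  · change O.res V'.2 f * D V' (g * h) =
      O.res V'.2 f * D V' g * h + _ • (g * (O.res V'.2 f * D V' h))
    rw [(hD.1 V').leibniz hg, mul_add, mul_smul_comm, ← mul_assoc, ← mul_assoc, ← mul_assoc,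
      O.supercomm (O.res_mem V'.2 hf) hg, add_mul, Int.negOnePow_add, mul_comm (d * m).negOnePow,
      mul_smul, smul_mul_assoc]
  · change O.res h (O.res V'.2 f * D V' g) = O.res V''.2 f * D V'' (O.res h g)
    rw [map_mul, hD.2, O.res_res]

/-- The `O(V)`-module of vector fields on `V`: the sums of vector fields of degree `k ∈ ℤ`. It is the
module of sections over `V` of the graded tangent bundle. -/
def Vec (V : Opens X) : Submodule (O.obj V) (O.Family V) where
  carrier := {D | D ∈ ⨆ k, O.vecDeg V k}
  zero_mem' := Submodule.zero_mem (⨆ k, O.vecDeg V k)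
  add_mem' := Submodule.add_mem (⨆ k, O.vecDeg V k)
  smul_mem' := by
    intro f D hD
    have hf : f ∈ ⨆ d, O.deg V d := by
      rw [(O.isInternal V).submodule_iSup_eq_top]; trivial
    refine Submodule.iSup_induction (motive := fun f => f • D ∈ ⨆ k, O.vecDeg V k) _ hf ?_ ?_ ?_
    · intro d f hf
      refine Submodule.iSup_induction (motive := fun D => f • D ∈ ⨆ k, O.vecDeg V k) _ hD ?_ ?_ ?_
      · exact fun k D hD => Submodule.mem_iSup_of_mem (d + k) (O.smul_mem_vecDeg hf hD)
      · rw [smul_zero]; exact Submodule.zero_mem _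
      · intro D D' h h'
        rw [smul_add]; exact Submodule.add_mem _ h h'
    · rw [zero_smul]; exact Submodule.zero_mem _
    · intro f g h h'
      rw [add_smul]; exact Submodule.add_mem _ h h'

variable {O}

/-- The value `D(f)` of a vector field `D` on `V` on a section `f ∈ O(V)`. -/
def app {V : Opens X} (D : O.Vec V) (f : O.obj V) : O.obj V := D.1 ⟨V, le_rfl⟩ f

/-- The vector field `D` is graded of degree `k`. -/
def IsGraded {V : Opens X} (D : O.Vec V) (k : ℤ) : Prop := D.1 ∈ O.vecDeg V k

/-- Restriction of a family to a smaller open set. -/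
noncomputable def Family.res {V U : Opens X} (h : V ≤ U) : O.Family U →ₗ[ℝ] O.Family V where
  toFun D := fun V' => D ⟨V'.1, V'.2.trans h⟩
  map_add' _ _ := rfl
  map_smul' _ _ := rfl

theorem Family.res_mem_vecDeg {V U : Opens X} (h : V ≤ U) {k : ℤ} {D : O.Family U}
    (hD : D ∈ O.vecDeg U k) : Family.res h D ∈ O.vecDeg V k :=
  ⟨fun V' => hD.1 ⟨V'.1, V'.2.trans h⟩,
    fun V' V'' hV f => hD.2 ⟨V'.1, V'.2.trans h⟩ ⟨V''.1, V''.2.trans h⟩ hV f⟩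

/-- Restriction of vector fields. -/
noncomputable def vecRes {V U : Opens X} (h : V ≤ U) (D : O.Vec U) : O.Vec V :=
  ⟨Family.res h D.1, by
    have : (⨆ k, O.vecDeg U k) ≤ (⨆ k, O.vecDeg V k).comap (Family.res h) :=
      iSup_le fun k D hD => Submodule.mem_iSup_of_mem k (Family.res_mem_vecDeg h hD)
    exact this D.2⟩

variable (O)

/-- The vector fields form a sheaf of graded `O`-modules: `Vec(V)` is the direct sum of its
homogeneous parts `Vec(V)_k`, the action of `O` is compatible with degrees and restrictions, and
compatible homogeneous vector fields of the same degree glue uniquely. -/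
structure VecIsSheaf : Prop where
  indep : ∀ V, iSupIndep (O.vecDeg V)
  smul_graded : ∀ {V : Opens X} {d k : ℤ} {f : O.obj V} {D : O.Vec V},
    f ∈ O.deg V d → IsGraded D k → IsGraded (f • D) (d + k)
  res_smul : ∀ {V U : Opens X} (h : V ≤ U) (f : O.obj U) (D : O.Vec U),
    vecRes h (f • D) = O.res h f • vecRes h D
  glue : ∀ (ι : Type v) (V : ι → Opens X) (k : ℤ) (D : ∀ i, O.Vec (V i)),
    (∀ i, IsGraded (D i) k) →
    (∀ i j, vecRes (inf_le_left : V i ⊓ V j ≤ V i) (D i) =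
      vecRes (inf_le_right : V i ⊓ V j ≤ V j) (D j)) →
    ∃! S : O.Vec (⨆ i, V i), IsGraded S k ∧ ∀ i, vecRes (le_iSup V i) S = D i

variable {O} in
/-- A homogeneous basis of the sheaf of modules `Vec|_V`: the restrictions of the `F a` to any open
`V' ⊆ V` are a basis of the `O(V')`-module `Vec(V')`. -/
structure IsFrame {V : Opens X} {κ : Type*} (F : κ → O.Vec V) : Prop where
  graded : ∀ a, ∃ k, IsGraded (F a) k
  linearIndependent : ∀ (V' : Opens X) (h : V' ≤ V),
    LinearIndependent (O.obj V') fun a => vecRes h (F a)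
  span_eq_top : ∀ (V' : Opens X) (h : V' ≤ V),
    Submodule.span (O.obj V') (Set.range fun a => vecRes h (F a)) = ⊤

/-- `Vec|_V` is a free sheaf of `O|_V`-modules, of finite rank. -/
def VecIsFreeOn (V : Opens X) : Prop :=
  ∃ (n : ℕ) (F : Fin n → O.Vec V), IsFrame F

/-- `Vec` is a locally free sheaf of `O`-modules. -/
def VecIsLocallyFree : Prop := ∀ x : X, ∃ V : Opens X, x ∈ V ∧ O.VecIsFreeOn V

end GradedPresheaf
end Presheaf

section Domain

variable (p : ℤ →₀ ℕ)

/-- The base `ℝ^{p_0}`. -/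
abbrev Base : Type := EuclideanSpace ℝ (Fin (p 0))

/-- Smooth functions on an open `V ⊆ ℝ^{p_0}`. -/
abbrev Smooth (V : Opens (Base p)) : Type :=
  ContMDiffMap 𝓘(ℝ, Base p) 𝓘(ℝ, ℝ) V ℝ ∞

/-- Smooth vector fields on an open `V ⊆ ℝ^{p_0}`: smooth maps to `ℝ^{p_0}`, the tangent space at
every point. -/
abbrev VField (V : Opens (Base p)) : Type :=
  ContMDiffMap 𝓘(ℝ, Base p) 𝓘(ℝ, Base p) V (Base p) ∞

variable {p}

noncomputable def Smooth.res {V U : Opens (Base p)} (h : V ≤ U) : Smooth p U →ₐ[ℝ] Smooth p V :=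
  { ContMDiffMap.restrictRingHom 𝓘(ℝ, Base p) 𝓘(ℝ, ℝ) ℝ (n := ∞) h with
    commutes' := fun _ => rfl }

noncomputable def VField.res {V U : Opens (Base p)} (h : V ≤ U) (Y : VField p U) : VField p V :=
  ⟨fun x => Y (Set.inclusion h x), Y.2.comp (contMDiff_inclusion h)⟩

variable (p)

/-- The structure sheaf of the graded domain with base `ℝ^{p_0}`: over `V`, formal power series in the
generators `w_a` with coefficients in the smooth functions on `V`. The structure sheaf of a graded
domain over an open `U ⊆ ℝ^{p_0}` is its restriction to `U`. -/
noncomputable def model : GradedPresheaf.{0} (Base p) where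
  obj V := Series p (Smooth p V)
  deg V := Series.homogeneous p (Smooth p V) ℝ
  gradedMonoid _ := inferInstance
  isInternal _ := Series.homogeneous_isInternal
  supercomm := Series.homogeneous_supercomm
  res h := Series.map (Smooth.res h)
  res_mem h d f hf m hm := hf m fun h0 => hm (by rw [Series.coeff_map, h0, map_zero])
  res_self _ := rfl
  res_res _ _ _ := rfl

/-- The graded vector space `W`, with its standard homogeneous basis. -/
abbrev GenSpace : Type := Gen p → ℝ

/-- The component `W_d`. -/
def GenSpace.deg (d : ℤ) : Submodule ℝ (GenSpace p) where
  carrier := {v | ∀ a, v a ≠ 0 → a.deg = d}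
  zero_mem' := fun _ h => (h rfl).elim
  add_mem' := by
    intro f g hf hg m hm
    by_contra hc
    exact hm (by simp [not_not.1 (mt (hf m) hc), not_not.1 (mt (hg m) hc)])
  smul_mem' := fun c f hf m hm => hf m fun h0 => hm (by simp [h0])

/-- The component `(W^*)_d = (W_{-d})^*` of the dual graded vector space. -/
def dualDeg (d : ℤ) : Submodule ℝ (Module.Dual ℝ (GenSpace p)) where
  carrier := {ξ | ∀ j, j ≠ -d → ∀ v ∈ GenSpace.deg p j, ξ v = 0}
  zero_mem' := fun _ _ _ _ => rfl
  add_mem' := fun h h' j hj v hv => by rw [LinearMap.add_apply, h j hj v hv, h' j hj v hv, add_zero]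
  smul_mem' := fun c ξ h j hj v hv => by rw [LinearMap.smul_apply, h j hj v hv, smul_zero]

variable {p}

/-- The inclusion of smooth functions in the sections over `V`. -/
noncomputable def ofSmooth (V : Opens (Base p)) (h : Smooth p V) : (model p).obj V :=
  algebraMap (Smooth p V) (Series p (Smooth p V)) h

/-- The inclusion of `W` in the sections over `V`. -/
noncomputable def ofGen (V : Opens (Base p)) (v : GenSpace p) : (model p).obj V :=
  ∑ a, v a • (Series.gen a : Series p (Smooth p V))

end Domain

section Trivialization

universe u v

/-- The open subset of `X` that corresponds to `V` under `e`. -/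
def preimage {p : ℤ →₀ ℕ} {X : Type v} [TopologicalSpace X]
    (e : OpenPartialHomeomorph X (Base p)) (V : Opens (Base p)) : Opens X :=
  ⟨e.source ∩ e ⁻¹' V, e.isOpen_inter_preimage V.2⟩

/-- The open subset `e(source)` of `ℝ^{p_0}`. -/
def image {p : ℤ →₀ ℕ} {X : Type v} [TopologicalSpace X]
    (e : OpenPartialHomeomorph X (Base p)) : Opens (Base p) :=
  ⟨e.target, e.open_target⟩

theorem preimage_mono {p : ℤ →₀ ℕ} {X : Type v} [TopologicalSpace X]
    (e : OpenPartialHomeomorph X (Base p)) {V U : Opens (Base p)} (h : V ≤ U) :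
    preimage e V ≤ preimage e U := fun _ hx => ⟨hx.1, h hx.2⟩

/-- An isomorphism `φ` of graded locally ringed spaces between `(V, O|_V)`, for an open `V ⊆ X`, and an
open subset `Ṽ` of the graded domain `ℝ^{(p_j)}`: a homeomorphism `e : V → Ṽ` and degree preserving
isomorphisms `φ^* : O_Ṽ(V') → O(e⁻¹(V'))` for the open `V' ⊆ Ṽ`, compatible with restrictions.
(An isomorphism of the stalks respects the unique maximal homogeneous ideals automatically.) -/
structure Trivialization (p : ℤ →₀ ℕ) {X : Type v} [TopologicalSpace X]
    (O : GradedPresheaf.{u} X) where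
  e : OpenPartialHomeomorph X (Base p)
  pullback : ∀ V : {V : Opens (Base p) // V ≤ image e},
    (model p).obj V.1 →ₐ[ℝ] O.obj (preimage e V.1)
  bijective : ∀ V, Function.Bijective (pullback V)
  map_deg : ∀ V {d} {f : (model p).obj V.1}, f ∈ (model p).deg V.1 d →
    pullback V f ∈ O.deg (preimage e V.1) d
  res_pullback : ∀ (V U : {V : Opens (Base p) // V ≤ image e}) (h : V.1 ≤ U.1)
    (f : (model p).obj U.1),
    O.res (preimage_mono e h) (pullback U f) = pullback V ((model p).res h f)

theorem preimage_ofSet_le {p : ℤ →₀ ℕ} (U V : Opens (Base p)) :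
    preimage (OpenPartialHomeomorph.ofSet (U : Set (Base p)) U.isOpen) V ≤ V :=
  fun _ hx => hx.2

theorem le_preimage_ofSet {p : ℤ →₀ ℕ} (U V : Opens (Base p)) (h : V ≤ U) :
    V ≤ preimage (OpenPartialHomeomorph.ofSet (U : Set (Base p)) U.isOpen) V :=
  fun _ hx => ⟨h hx, hx⟩

/-- The identity of the graded domain over `U`. -/
noncomputable def Trivialization.ofOpen (p : ℤ →₀ ℕ) (U : Opens (Base p)) :
    Trivialization p (model p) where
  e := OpenPartialHomeomorph.ofSet (U : Set (Base p)) U.isOpen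
  pullback V := (model p).res (preimage_ofSet_le U V.1)
  bijective V := by
    refine Function.bijective_iff_has_inverse.2
      ⟨(model p).res (le_preimage_ofSet U V.1 V.2), fun f => ?_, fun f => ?_⟩
    · rw [(model p).res_res]; exact (model p).res_self f
    · rw [(model p).res_res]; exact (model p).res_self f
  map_deg V _ _ hf := (model p).res_mem (preimage_ofSet_le U V.1) hf
  res_pullback V W h f := by rw [(model p).res_res, (model p).res_res]

/-- `(X, O)` is a graded manifold of dimension `(p_j)`. -/
structure IsGradedManifold (p : ℤ →₀ ℕ) {X : Type v} [TopologicalSpace X]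
    (O : GradedPresheaf.{u} X) : Prop where
  t2 : T2Space X
  secondCountable : SecondCountableTopology X
  locallyRinged : O.IsGradedLocallyRinged
  locallyTrivial : ∀ x : X, ∃ φ : Trivialization p O, x ∈ φ.e.source

namespace Trivialization

variable {p : ℤ →₀ ℕ} {X : Type v} [TopologicalSpace X] {O : GradedPresheaf.{u} X}
  (φ : Trivialization p O)

/-- The open subsets of `Ṽ`; they are also those of `V`, through `e`. -/
abbrev Target : Type := {V : Opens (Base p) // V ≤ image φ.e}

/-- The pullback of a smooth function. -/
noncomputable def smooth (V : φ.Target) (h : Smooth p V.1) : O.obj (preimage φ.e V.1) :=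
  φ.pullback V (ofSmooth V.1 h)

/-- The pullback of an element of `W`. -/
noncomputable def gen (V : φ.Target) (v : GenSpace p) : O.obj (preimage φ.e V.1) :=
  φ.pullback V (ofGen V.1 v)

/-- The sections of `O` over the open subset of `V` that corresponds to `V'`, as an algebra over the
smooth functions on `V'`, through `φ^*`. -/
def Sec (V : φ.Target) : Type u := O.obj (preimage φ.e V.1)

noncomputable instance (V : φ.Target) : Ring (φ.Sec V) :=
  inferInstanceAs (Ring (O.obj (preimage φ.e V.1)))

noncomputable instance (V : φ.Target) : Algebra ℝ (φ.Sec V) :=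
  inferInstanceAs (Algebra ℝ (O.obj (preimage φ.e V.1)))

noncomputable instance (V : φ.Target) : Module (φ.Sec V) (O.Vec (preimage φ.e V.1)) :=
  inferInstanceAs (Module (O.obj (preimage φ.e V.1)) (O.Vec (preimage φ.e V.1)))

noncomputable instance (V : φ.Target) : Algebra (Smooth p V.1) (φ.Sec V) :=
  RingHom.toAlgebra'
    ((φ.pullback V).toRingHom.comp (algebraMap (Smooth p V.1) (Series p (Smooth p V.1))))
    (fun c f => by
      obtain ⟨g, rfl⟩ := (φ.bijective V).2 f
      change φ.pullback V (ofSmooth V.1 c) * φ.pullback V g =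
        φ.pullback V g * φ.pullback V (ofSmooth V.1 c)
      rw [← map_mul, ← map_mul]
      congr 1
      exact Algebra.commutes (A := Series p (Smooth p V.1)) c g)

open GradedPresheaf

/-- The module `(O ⊗_{C^∞} Vec_V) ⊕ (O ⊗_ℝ W^*)` of sections over `V'`. -/
abbrev VecModel (V : φ.Target) : Type _ :=
  (φ.Sec V ⊗[Smooth p V.1] VField p V.1) × (φ.Sec V ⊗[ℝ] Module.Dual ℝ (GenSpace p))

noncomputable def Sec.res {V U : φ.Target} (h : V.1 ≤ U.1) (f : φ.Sec U) : φ.Sec V :=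
  O.res (preimage_mono φ.e h) f

/-- The maps `Φ V'` form an isomorphism `(O ⊗_{C^∞} Vec_V) ⊕ (O ⊗_ℝ W^*) ≃ Vec|_V` of sheaves of
graded `O|_V`-modules, under which `f ⊗ Y + g ⊗ ξ` acts on smooth functions `h` by
`h ↦ f (dh(Y))` and on `W` by `v ↦ ξ(v) g`. -/
structure IsVecSplitting
    (Φ : ∀ V : φ.Target, φ.VecModel V ≃ₗ[φ.Sec V] O.Vec (preimage φ.e V.1)) : Prop where
  natural : ∀ (V U : φ.Target) (h : V.1 ≤ U.1) (f g : φ.Sec U) (Y : VField p U.1)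
    (ξ : Module.Dual ℝ (GenSpace p)),
    vecRes (preimage_mono φ.e h) (Φ U (f ⊗ₜ Y, g ⊗ₜ ξ)) =
      Φ V (Sec.res φ h f ⊗ₜ VField.res h Y, Sec.res φ h g ⊗ₜ ξ)
  graded_left : ∀ (V : φ.Target) (d : ℤ) (f : φ.Sec V), f ∈ O.deg (preimage φ.e V.1) d →
    ∀ Y, IsGraded (Φ V (f ⊗ₜ Y, 0)) d
  graded_right : ∀ (V : φ.Target) (d k : ℤ) (g : φ.Sec V), g ∈ O.deg (preimage φ.e V.1) d →
    ∀ ξ ∈ dualDeg p k, IsGraded (Φ V (0, g ⊗ₜ ξ)) (d + k)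
  apply_smooth : ∀ (V : φ.Target) (f g : O.obj (preimage φ.e V.1)) (Y : VField p V.1)
    (ξ : Module.Dual ℝ (GenSpace p)) (h h' : Smooth p V.1),
    (∀ x, h' x = mfderiv 𝓘(ℝ, Base p) 𝓘(ℝ, ℝ) h x (Y x)) →
    app (Φ V ((show φ.Sec V from f) ⊗ₜ Y, (show φ.Sec V from g) ⊗ₜ ξ)) (φ.smooth V h) =
      f * φ.smooth V h'
  apply_gen : ∀ (V : φ.Target) (f g : O.obj (preimage φ.e V.1)) (Y : VField p V.1)
    (ξ : Module.Dual ℝ (GenSpace p)) (v : GenSpace p),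
    app (Φ V ((show φ.Sec V from f) ⊗ₜ Y, (show φ.Sec V from g) ⊗ₜ ξ)) (φ.gen V v) = ξ v • g

/-- Existence of the isomorphism of sheaves of graded modules over the trivialising open set. -/
def HasVecSplitting : Prop :=
  ∃ Φ : ∀ V : φ.Target, φ.VecModel V ≃ₗ[φ.Sec V] O.Vec (preimage φ.e V.1), φ.IsVecSplitting Φ

/-- `Ṽ` itself. -/
def top : φ.Target := ⟨image φ.e, le_rfl⟩

/-- The trivialising open set `V`, see `coe_domain`. -/
def domain : Opens X := preimage φ.e φ.top.1

theorem coe_domain : (φ.domain : Set X) = φ.e.source :=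
  Set.inter_eq_left.2 fun _ hx => φ.e.map_source hx

end Trivialization

/-- `t` is a global coordinate system on `U`: a diffeomorphism onto an open subset of `ℝ^{p_0}`. -/
def IsCoordinateSystem {p : ℤ →₀ ℕ} (U : Opens (Base p)) (t : Fin (p 0) → Smooth p U) : Prop :=
  ∃ c : OpenPartialHomeomorph (Base p) (Base p), c ∈ contDiffGroupoid ∞ 𝓘(ℝ, Base p) ∧
    c.source = U ∧ ∀ (i : Fin (p 0)) (x : U), t i x = c x i

/-- `w` is a basis of `W` of homogeneous elements, `w_α` having degree `d α`. -/
def IsGradedBasis {p : ℤ →₀ ℕ} {κ : Type*} (w : Module.Basis κ ℝ (GenSpace p)) (d : κ → ℤ) :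
    Prop := ∀ α, w α ∈ GenSpace.deg p (d α)

namespace Trivialization

open GradedPresheaf

variable {p : ℤ →₀ ℕ} {X : Type v} [TopologicalSpace X] {O : GradedPresheaf.{u} X}
  (φ : Trivialization p O)

/-- `dt i` and `dw α` are the vector fields `∂/∂t_i` and `∂/∂w_α` of the local coordinate system
`(t_i, w_α)`; they are a basis of the sheaf of vector fields, and over every open subset of the
trivialising open set the vector field `D` is uniquely
`∑_i D(t_i) ∂/∂t_i + ∑_α D(w_α) ∂/∂w_α`. -/
structure IsCoordinateFrame {κ : Type*} [Fintype κ] [DecidableEq κ]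
    (t : Fin (p 0) → O.obj φ.domain) (w : κ → O.obj φ.domain) (d : κ → ℤ)
    (dt : Fin (p 0) → O.Vec φ.domain) (dw : κ → O.Vec φ.domain) : Prop where
  graded_dt : ∀ i, IsGraded (dt i) 0
  graded_dw : ∀ α, IsGraded (dw α) (-d α)
  dt_t : ∀ i j, app (dt i) (t j) = if i = j then 1 else 0
  dt_w : ∀ i β, app (dt i) (w β) = 0
  dw_w : ∀ α β, app (dw α) (w β) = if α = β then 1 else 0
  dw_t : ∀ α j, app (dw α) (t j) = 0
  isFrame : IsFrame (Sum.elim dt dw)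
  splitting : ∀ (V : Opens X) (h : V ≤ φ.domain) (D : O.Vec V)
    (f : Fin (p 0) → O.obj V) (g : κ → O.obj V),
    D = ∑ i, f i • vecRes h (dt i) + ∑ α, g α • vecRes h (dw α) ↔
      (∀ i, f i = app D (O.res h (t i))) ∧ ∀ α, g α = app D (O.res h (w α))

/-- Every local coordinate system `(t_i, w_α)` obtained from `φ` by pullback of a global coordinate
system on `Ṽ` has a unique family of coordinate vector fields `∂/∂t_i` (of degree `0`) and
`∂/∂w_α` (of degree `-|w_α|`), and these split all vector fields. -/
def HasCoordinateSplitting : Prop :=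
  ∀ t : Fin (p 0) → Smooth p (image φ.e), IsCoordinateSystem (image φ.e) t →
  ∀ (κ : Type) [Fintype κ] [DecidableEq κ] (w : Module.Basis κ ℝ (GenSpace p)) (d : κ → ℤ),
    IsGradedBasis w d →
  ∃! D : (Fin (p 0) → O.Vec φ.domain) × (κ → O.Vec φ.domain),
    φ.IsCoordinateFrame (fun i => φ.smooth φ.top (t i)) (fun α => φ.gen φ.top (w α)) d D.1 D.2

end Trivialization

end Trivialization
end GradedGeometry

open GradedGeometry

/-!
# Vector fields on `ℤ`-graded manifolds

A vector field on a graded domain is determined by its values on the coordinates `x_i` and `w_a`,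
and these values can be prescribed freely. Everything else is a formal consequence.

*Coordinates separate vector fields.* It suffices to treat homogeneous fields, since the homogeneous
components of a field that kills a homogeneous section kill it separately. Let `D` be homogeneous
and zero on all coordinates. A smooth function `h` is, near a point `x`, of the form
`h(x) + ∑ (x_i - x_i(x)) g_i` by Hadamard's lemma, so that every coefficient of
`D h = ∑ (x_i - x_i(x)) D g_i` vanishes at `x`; hence `D h = 0` (`apply_ofSmooth_eq_zero`). A
general section is a formal power series and need not be a polynomial in the coordinates, and `D` is
not assumed to be continuous. But each series is its constant term plus a finite sum `∑ w_a f_a`,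
because there are finitely many generators; as `D (w_a f_a) = ± w_a D f_a`, the operator `D` raises
the order of vanishing by every finite amount, and so it is zero (`Series.eq_zero_of_gen_mul`,
`eq_zero_of_apply_coord`).

*Dual fields exist.* Differentiating all coefficients gives `∂/∂x_i` (`Series.mapDerivation`), and
`∂/∂w_a` is given by an explicit formula on coefficients (`Series.pderiv`). Its Leibniz rule with
signs is again an application of `Series.eq_zero_of_gen_mul`.

*Frames.* Vector fields dual to a separating family of sections form a basis over every smaller open
set, since `D` and `∑ D(z_a) ∂/∂z_a` agree on all `z_a` (`IsDualFrame.eq_sum_iff`,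
`IsDualFrame.isFrame`). A trivialisation `φ` carries the fields on the domain to the manifold, and
the fields on open subsets of the manifold back to the domain, by conjugation
(`Trivialization.ofModel`, `Trivialization.toModel`), whence a dual frame on the trivialising set
(`Trivialization.isDualFrame_std`).

*Other coordinates.* For a coordinate system `t` and a homogeneous basis `w` the frame is
transformed by the inverse Jacobian matrix of `t` and the inverse base change matrix of `w`
(`Trivialization.isDualFrame_coord`). Homogeneity of the base change makes the new fields
homogeneous of the expected degrees.

*Splitting.* Both sides of the isomorphism in question have bases indexed by the `x_i` and the
`w_a`; matching them gives `Trivialization.vecEquiv`, whose formula on pure tensors shows that it is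
compatible with restriction, grading and the action on sections.

*Glueing.* Homogeneous fields on the members of an open cover are glued value by value, with the
sheaf property of the structure sheaf in each degree (`GradedPresheaf.exists_vec_glue`). The sheaf
property of the graded domain itself is that of smooth functions, applied to the coefficients
(`model_isSheaf`).
-/

namespace GradedGeometry

/-! ### Formal power series in supercommuting variables -/

section SeriesCalculus

namespace Series

variable {p : ℤ →₀ ℕ} {R : Type*} [CommRing R]

theorem coeff_sum {ι : Type*} (s : Finset ι) (f : ι → Series p R) (m : Gen p →₀ ℕ) :
    (∑ i ∈ s, f i).coeff m = ∑ i ∈ s, (f i).coeff m :=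
  map_sum (coeffHom m) _ _

theorem coeff_units_smul (u : ℤˣ) (f : Series p R) (m : Gen p →₀ ℕ) :
    (u • f).coeff m = u • f.coeff m := rfl

open Classical in
theorem coeff_algebraMap (r : R) (m : Gen p →₀ ℕ) :
    (algebraMap R (Series p R) r).coeff m = if m = 0 then r else 0 := by
  rw [Algebra.algebraMap_eq_smul_one, coeff_smul, coeff_one]
  split_ifs <;> simp

theorem coeff_algebraMap_mul (r : R) (f : Series p R) (m : Gen p →₀ ℕ) :
    (algebraMap R (Series p R) r * f).coeff m = r * f.coeff m := by
  rw [← Algebra.smul_def, coeff_smul, smul_eq_mul]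

open Classical in
theorem coeff_gen (a : Gen p) (m : Gen p →₀ ℕ) :
    (gen a : Series p R).coeff m = if m = Finsupp.single a 1 then 1 else 0 := by
  change (if _ then _ else _) = _
  congr

/-- Multiplication by `w_a` shifts the coefficients, with the sign that sorts `w_a` into place. -/
theorem coeff_gen_mul_add (a : Gen p) (f : Series p R) {n : Gen p →₀ ℕ}
    (h : Adm (Finsupp.single a 1 + n)) :
    (gen a * f).coeff (Finsupp.single a 1 + n) =
      (crossing (Finsupp.single a 1) n).negOnePow • f.coeff n := by
  classical
  rw [coeff_mul _ _ h, Finset.sum_eq_single (Finsupp.single a 1, n)]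
  · simp [coeff_gen]
  · rintro ⟨x, y⟩ hxy hne
    have : x ≠ Finsupp.single a 1 := by
      rintro rfl
      rw [Finset.HasAntidiagonal.mem_antidiagonal] at hxy
      exact hne (Prod.ext rfl (add_left_cancel hxy))
    simp [coeff_gen, this]
  · simp

theorem coeff_gen_mul_of_eq_zero (a : Gen p) (f : Series p R) {m : Gen p →₀ ℕ} (h : m a = 0) :
    (gen a * f).coeff m = 0 := by
  classical
  by_cases hm : Adm m
  · rw [coeff_mul _ _ hm]
    refine Finset.sum_eq_zero fun x hx => ?_
    have : x.1 ≠ Finsupp.single a 1 := by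
      intro hx1
      rw [Finset.HasAntidiagonal.mem_antidiagonal] at hx
      rw [← hx, hx1] at h
      simp at h
    simp [coeff_gen, this]
  · exact coeff_eq_zero _ hm

theorem exists_eq_single_add {m : Gen p →₀ ℕ} {a : Gen p} (h : m a ≠ 0) :
    ∃ n, m = Finsupp.single a 1 + n :=
  ⟨m - Finsupp.single a 1, (add_tsub_cancel_of_le (by
    rw [Finsupp.single_le_iff]; exact Nat.one_le_iff_ne_zero.2 h)).symm⟩

/-- Multiplication by a generator raises the order of vanishing by one. -/
theorem coeff_gen_mul_eq_zero_of_degree_le (a : Gen p) {f : Series p R} {N : ℕ}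
    (hf : ∀ n : Gen p →₀ ℕ, n.degree < N → f.coeff n = 0) {m : Gen p →₀ ℕ}
    (hm : m.degree < N + 1) : (gen a * f).coeff m = 0 := by
  by_cases hma : m a = 0
  · exact coeff_gen_mul_of_eq_zero a f hma
  obtain ⟨n, rfl⟩ := exists_eq_single_add hma
  by_cases h : Adm (Finsupp.single a 1 + n)
  · rw [coeff_gen_mul_add a f h, hf n, smul_zero]
    rw [map_add, Finsupp.degree_single] at hm
    omega
  · exact coeff_eq_zero _ h

theorem wt_single (a : Gen p) : wt (Finsupp.single a 1) = a.deg := by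
  classical
  simp [wt, Finsupp.single_apply]

theorem gen_mem_homogeneous (k : Type*) [CommRing k] [Algebra k R] (a : Gen p) :
    (gen a : Series p R) ∈ homogeneous p R k a.deg := by
  classical
  intro m hm
  rw [coeff_gen] at hm
  have : m = Finsupp.single a 1 := by by_contra h; exact hm (if_neg h)
  rw [this, wt_single]

theorem algebraMap_mem_homogeneous (k : Type*) [CommRing k] [Algebra k R] (r : R) :
    algebraMap R (Series p R) r ∈ homogeneous p R k 0 := by
  classical
  intro m hm
  rw [coeff_algebraMap] at hm
  have : m = 0 := by by_contra h; exact hm (if_neg h)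
  rw [this, wt_zero]

/-- The quotient of a series by `w_a`, taken over the monomials in which `w_a` is the first
generator to occur. -/
noncomputable def leadQuot (a : Gen p) (f : Series p R) : Series p R :=
  open Classical in
  ⟨fun n => if ∀ b < a, n b = 0 then f.coeff (Finsupp.single a 1 + n) else 0, fun n hn => by
    simp [coeff_eq_zero f fun h => hn h.right], by
    obtain ⟨s, hs⟩ := f.2.2
    refine ⟨s.image (fun d => d - a.deg), fun n hn => ?_⟩
    have h1 : f.coeff (Finsupp.single a 1 + n) ≠ 0 := fun h => hn (by simp [h])
    refine Finset.mem_image.2 ⟨_, hs _ h1, ?_⟩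
    rw [wt_add, wt_single]
    ring⟩

open Classical in
theorem coeff_leadQuot (a : Gen p) (f : Series p R) (n : Gen p →₀ ℕ) :
    (leadQuot a f).coeff n =
      if ∀ b < a, n b = 0 then f.coeff (Finsupp.single a 1 + n) else 0 := by
  change (if _ then _ else _) = _
  congr

theorem crossing_single_eq_zero {a : Gen p} {n : Gen p →₀ ℕ} (h : ∀ b < a, n b = 0) :
    crossing (Finsupp.single a 1) n = 0 := by
  classical
  refine Finset.sum_eq_zero fun c _ => Finset.sum_eq_zero fun b _ => ?_
  split_ifs with hb
  · by_cases hc : a = c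
    · subst hc
      simp [h b hb]
    · simp [hc]
  · rfl

open Classical in
theorem coeff_gen_mul_leadQuot (a : Gen p) (f : Series p R) (m : Gen p →₀ ℕ) :
    (gen a * leadQuot a f).coeff m =
      if m a ≠ 0 ∧ ∀ b < a, m b = 0 then f.coeff m else 0 := by
  by_cases hm : Adm m
  swap
  · rw [coeff_eq_zero _ hm, coeff_eq_zero _ hm, ite_self]
  by_cases hma : m a = 0
  · rw [coeff_gen_mul_of_eq_zero a _ hma, if_neg fun h => h.1 hma]
  obtain ⟨n, rfl⟩ := exists_eq_single_add hma
  rw [coeff_gen_mul_add _ _ hm, coeff_leadQuot]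
  have e : (∀ b < a, n b = 0) ↔ ∀ b < a, (Finsupp.single a 1 + n : Gen p →₀ ℕ) b = 0 := by
    refine forall₂_congr fun b hb => ?_
    simp [hb.ne']
  by_cases h : ∀ b < a, n b = 0
  · rw [if_pos h, if_pos ⟨hma, e.1 h⟩, crossing_single_eq_zero h]
    simp
  · rw [if_neg h, if_neg fun h' => h (e.2 h'.2), smul_zero]

/-- A series is its constant term plus a combination of the generators: sort the other monomials by
the first generator that occurs. -/
theorem eq_algebraMap_add_sum (f : Series p R) :
    f = algebraMap R (Series p R) (f.coeff 0) + ∑ a, gen a * leadQuot a f := by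
  classical
  refine ext fun m => ?_
  rw [coeff_add, coeff_sum, coeff_algebraMap]
  simp only [coeff_gen_mul_leadQuot]
  by_cases hm : m = 0
  · subst hm
    simp
  · rw [if_neg hm, zero_add]
    have hs : m.support.Nonempty := Finsupp.support_nonempty_iff.2 hm
    have h0 : m (m.support.min' hs) ≠ 0 := Finsupp.mem_support_iff.1 (m.support.min'_mem hs)
    have hmin : ∀ b < m.support.min' hs, m b = 0 := fun b hb => by
      by_contra hne
      exact absurd (m.support.min'_le b (Finsupp.mem_support_iff.2 hne)) (not_le.2 hb)
    rw [Finset.sum_eq_single (m.support.min' hs)]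
    · rw [if_pos ⟨h0, hmin⟩]
    · rintro a - ha
      refine if_neg fun h => ?_
      rcases lt_trichotomy a (m.support.min' hs) with hlt | heq | hgt
      · exact h.1 (hmin a hlt)
      · exact ha heq
      · exact h0 (h.2 _ hgt)
    · simp

/-- The principle of induction on the order of a series: an additive map that vanishes on constants
and commutes with multiplication by generators up to sign is zero, because by
`eq_algebraMap_add_sum` it raises the order of vanishing indefinitely. -/
theorem eq_zero_of_gen_mul (L : Series p R →+ Series p R)
    (h0 : ∀ r, L (algebraMap R (Series p R) r) = 0) (u : Gen p → ℤˣ)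
    (hL : ∀ a f, L (gen a * f) = u a • (gen a * L f)) : L = 0 := by
  have key : ∀ (N : ℕ) (f : Series p R) (m : Gen p →₀ ℕ), m.degree < N → (L f).coeff m = 0 := by
    intro N
    induction N with
    | zero => intro f m hm; omega
    | succ N ih =>
      intro f m hm
      rw [eq_algebraMap_add_sum f, map_add, h0, zero_add, map_sum, coeff_sum]
      refine Finset.sum_eq_zero fun a _ => ?_
      rw [hL, coeff_units_smul, coeff_gen_mul_eq_zero_of_degree_le a (ih _) hm, smul_zero]
  exact AddMonoidHom.ext fun f => ext fun m => key (m.degree + 1) f m (Nat.lt_succ_self _)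

section pderiv

/-- The derivative with respect to the generator `w_a`: the monomial `w_a w^n` has derivative
`(n_a + 1) w^n`, and moving `w_a` to its place in the ordered monomial costs the sign
`(-1)^crossing`. -/
noncomputable def pderiv {k : Type*} [CommRing k] [Algebra k R] (a : Gen p) :
    Series p R →ₗ[k] Series p R where
  toFun f := ⟨fun n => ((n a : R) + 1) * ((crossing (Finsupp.single a 1) n).negOnePow •
      f.coeff (Finsupp.single a 1 + n)), fun n hn => by
    simp [coeff_eq_zero f fun h => hn h.right], by
    obtain ⟨s, hs⟩ := f.2.2
    refine ⟨s.image (fun d => d - a.deg), fun n hn => ?_⟩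
    have h1 : f.coeff (Finsupp.single a 1 + n) ≠ 0 := fun h => hn (by simp [h])
    refine Finset.mem_image.2 ⟨_, hs _ h1, ?_⟩
    rw [wt_add, wt_single]
    ring⟩
  map_add' f g := ext fun n => by
    change _ * (_ • coeff (f + g) _) = _ * (_ • coeff f _) + _ * (_ • coeff g _)
    rw [coeff_add, smul_add, mul_add]
  map_smul' c f := ext fun n => by
    change _ * (_ • coeff (c • f) _) = c • (_ * (_ • coeff f _))
    rw [coeff_smul, smul_comm, mul_smul_comm]

variable {k : Type*} [CommRing k] [Algebra k R]

theorem coeff_pderiv (a : Gen p) (f : Series p R) (n : Gen p →₀ ℕ) :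
    (pderiv (k := k) a f).coeff n = ((n a : R) + 1) *
      ((crossing (Finsupp.single a 1) n).negOnePow • f.coeff (Finsupp.single a 1 + n)) := rfl

theorem pderiv_mem_homogeneous (a : Gen p) {d : ℤ} {f : Series p R}
    (hf : f ∈ homogeneous p R k d) : pderiv (k := k) a f ∈ homogeneous p R k (d + -a.deg) := by
  intro n hn
  rw [coeff_pderiv] at hn
  have h1 : f.coeff (Finsupp.single a 1 + n) ≠ 0 := fun h => hn (by rw [h, smul_zero, mul_zero])
  have := hf _ h1
  rw [wt_add, wt_single] at this
  omega

theorem pderiv_algebraMap_mul (a : Gen p) (r : R) (f : Series p R) :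
    pderiv (k := k) a (algebraMap R (Series p R) r * f) =
      algebraMap R (Series p R) r * pderiv (k := k) a f := by
  refine ext fun n => ?_
  rw [coeff_pderiv, coeff_algebraMap_mul, coeff_algebraMap_mul, coeff_pderiv]
  simp only [Units.smul_def, zsmul_eq_mul]
  ring

theorem pderiv_algebraMap (a : Gen p) (r : R) :
    pderiv (k := k) a (algebraMap R (Series p R) r) = 0 := by
  classical
  refine ext fun n => ?_
  rw [coeff_pderiv, coeff_algebraMap, if_neg, smul_zero, mul_zero, coeff_zero]
  intro h
  have := DFunLike.congr_fun h a
  simp at this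

theorem crossing_single_single (a b : Gen p) :
    crossing (Finsupp.single a 1) (Finsupp.single b 1) = if b < a then a.deg * b.deg else 0 := by
  classical
  rw [crossing, Finset.sum_eq_single a, Finset.sum_eq_single b]
  · simp
  · intro c _ hc
    simp [Ne.symm hc]
  · simp
  · intro c _ hc
    simp [Ne.symm hc]
  · simp

open Classical in
/-- The Leibniz rule for `∂/∂w_a` when the first factor is a generator. -/
theorem pderiv_gen_mul (a b : Gen p) (f : Series p R) :
    pderiv (k := k) a (gen b * f) =
      (if a = b then f else 0) + (a.deg * b.deg).negOnePow • (gen b * pderiv (k := k) a f) := by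
  refine ext_adm fun n hn => ?_
  rw [coeff_pderiv, coeff_add, coeff_units_smul]
  by_cases hab : a = b
  · subst hab
    rw [if_pos rfl]
    by_cases hna : n a = 0
    · -- the monomial does not contain `w_a`, so `w_a w^n` is admissible
      have hadm : Adm (Finsupp.single a 1 + n) := fun c hc => by
        by_cases hca : a = c
        · subst hca; simp [hna]
        · simpa [Finsupp.single_apply, hca] using hn c hc
      rw [coeff_gen_mul_of_eq_zero a _ hna, coeff_gen_mul_add a f hadm, hna, smul_smul,
        Int.units_mul_self]
      simp
    · obtain ⟨m, rfl⟩ := exists_eq_single_add hna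
      rw [coeff_gen_mul_add a _ hn, coeff_pderiv]
      have hc : crossing (Finsupp.single a 1) (Finsupp.single a 1 + m) =
          crossing (Finsupp.single a 1) m := by
        rw [crossing_add_right, crossing_single_single]; simp
      rcases Int.even_or_odd a.deg with ha | ha
      · have hadm : Adm (Finsupp.single a 1 + (Finsupp.single a 1 + m)) := fun c hc => by
          by_cases hca : a = c
          · subst hca; exact absurd ha (Int.not_even_iff_odd.2 hc)
          · simpa [Finsupp.single_apply, hca] using hn c hc
        rw [coeff_gen_mul_add a f hadm, hc, smul_smul, Int.units_mul_self, one_smul,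
          Int.negOnePow_even _ (ha.mul_right _), one_smul, mul_smul_comm, smul_smul,
          Int.units_mul_self, one_smul]
        simp only [Finsupp.add_apply, Finsupp.single_eq_same]
        push_cast
        ring
      · -- an odd generator squares to zero: the two terms on the right cancel
        have hnadm : ¬ Adm (Finsupp.single a 1 + (Finsupp.single a 1 + m)) := fun h => by
          have := h a ha
          simp at this
        have hm0 : m a = 0 := by
          have := hn a ha
          simpa using this
        rw [coeff_eq_zero _ hnadm, smul_zero, mul_zero, hm0, Int.negOnePow_odd _ (ha.mul ha),
          Nat.cast_zero, zero_add, one_mul, smul_smul, smul_smul, mul_assoc,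
          Int.units_mul_self, mul_one]
        simp
  · rw [if_neg hab, coeff_zero, zero_add]
    by_cases hnb : n b = 0
    · rw [coeff_gen_mul_of_eq_zero b _ hnb, coeff_gen_mul_of_eq_zero b, smul_zero, smul_zero,
        mul_zero]
      simp [hab, hnb]
    · obtain ⟨m, rfl⟩ := exists_eq_single_add hnb
      have e : Finsupp.single a 1 + (Finsupp.single b 1 + m) =
          Finsupp.single b 1 + (Finsupp.single a 1 + m) := by abel
      rw [coeff_gen_mul_add b _ hn, coeff_pderiv, e]
      by_cases hadm : Adm (Finsupp.single b 1 + (Finsupp.single a 1 + m))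
      · rw [coeff_gen_mul_add b _ hadm]
        have hs : (crossing (Finsupp.single a 1) (Finsupp.single b 1 + m)).negOnePow *
              (crossing (Finsupp.single b 1) (Finsupp.single a 1 + m)).negOnePow =
            (a.deg * b.deg).negOnePow * ((crossing (Finsupp.single b 1) m).negOnePow *
              (crossing (Finsupp.single a 1) m).negOnePow) := by
          rw [crossing_add_right, crossing_add_right, crossing_single_single,
            crossing_single_single]
          simp only [← Int.negOnePow_add]
          rcases lt_or_gt_of_ne hab with h | h
          · rw [if_neg h.not_gt, if_pos h, mul_comm b.deg]
            congr 1; ring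
          · rw [if_pos h, if_neg h.not_gt]
            congr 1; ring
        rw [smul_smul, hs, mul_smul, mul_smul, mul_smul_comm, mul_smul_comm]
        simp [Ne.symm hab]
      · rw [coeff_eq_zero _ hadm]
        have h : ¬ Adm (Finsupp.single a 1 + m) := fun h => hadm fun c hc => by
          by_cases hca : a = c
          · subst hca
            simpa [Ne.symm hab] using h a hc
          · simpa [Finsupp.single_apply, hca] using hn c hc
        rw [coeff_eq_zero _ h]
        simp

/-- The automorphism `w^m ↦ (-1)^(e |w^m|) w^m`: the sign with which an operator of degree `e`
passes a series. -/
noncomputable def twist (e : ℤ) : Series p R →+ Series p R where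
  toFun f := ⟨fun m => (e * wt m).negOnePow • f.coeff m, fun m hm => by
    simp [coeff_eq_zero f hm], by
    obtain ⟨s, hs⟩ := f.2.2
    exact ⟨s, fun m hm => hs m fun h => hm (by simp [coeff, h])⟩⟩
  map_zero' := ext fun m => smul_zero _
  map_add' f g := ext fun m => smul_add _ _ _

theorem coeff_twist (e : ℤ) (f : Series p R) (m : Gen p →₀ ℕ) :
    (twist e f).coeff m = (e * wt m).negOnePow • f.coeff m := rfl

theorem twist_of_mem {e d : ℤ} {f : Series p R} (hf : f ∈ homogeneous p R k d) :
    twist e f = (e * d).negOnePow • f := by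
  refine ext fun m => ?_
  rw [coeff_twist, coeff_units_smul]
  by_cases h : f.coeff m = 0
  · rw [h, smul_zero, smul_zero]
  · rw [hf m h]

theorem twist_gen_mul (e : ℤ) (a : Gen p) (f : Series p R) :
    twist e (gen a * f) = (e * a.deg).negOnePow • (gen a * twist e f) := by
  refine ext_adm fun m hm => ?_
  rw [coeff_twist, coeff_units_smul]
  by_cases hma : m a = 0
  · rw [coeff_gen_mul_of_eq_zero a _ hma, coeff_gen_mul_of_eq_zero a _ hma, smul_zero, smul_zero]
  · obtain ⟨n, rfl⟩ := exists_eq_single_add hma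
    rw [coeff_gen_mul_add a _ hm, coeff_gen_mul_add a _ hm, coeff_twist, wt_add, wt_single, mul_add,
      Int.negOnePow_add, mul_smul, smul_comm (e * wt n).negOnePow]

/-- The Leibniz rule for `∂/∂w_a`. Its failure is additive in the first factor, vanishes on
constants and commutes with generators, so `eq_zero_of_gen_mul` applies. -/
theorem pderiv_mul (a : Gen p) (f g : Series p R) :
    pderiv (k := k) a (f * g) =
      pderiv (k := k) a f * g + twist a.deg f * pderiv (k := k) a g := by
  classical
  let L : Series p R →+ Series p R :=
    (pderiv (k := k) a).toAddMonoidHom.comp (AddMonoidHom.mulRight g) -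
      (AddMonoidHom.mulRight g).comp (pderiv (k := k) a).toAddMonoidHom -
      (AddMonoidHom.mulRight (pderiv (k := k) a g)).comp (twist a.deg)
  have hLf : ∀ f, L f = pderiv (k := k) a (f * g) - pderiv (k := k) a f * g -
      twist a.deg f * pderiv (k := k) a g := fun _ => rfl
  have hL : L = 0 := by
    refine eq_zero_of_gen_mul L (fun r => ?_) (fun b => (a.deg * b.deg).negOnePow) fun b f => ?_
    · rw [hLf, pderiv_algebraMap_mul, pderiv_algebraMap,
        twist_of_mem (algebraMap_mem_homogeneous k r)]
      simp
    · rw [hLf, hLf, mul_assoc, pderiv_gen_mul, pderiv_gen_mul, twist_gen_mul]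
      simp only [mul_sub, smul_sub, add_mul, smul_mul_assoc, mul_assoc, ite_mul, zero_mul]
      abel
  have := hLf f
  rw [hL, AddMonoidHom.zero_apply, sub_sub, eq_comm, sub_eq_zero] at this
  exact this

theorem pderiv_gen (a b : Gen p) :
    pderiv (k := k) a (gen b : Series p R) = if a = b then 1 else 0 := by
  classical
  have h := pderiv_gen_mul (k := k) a b (1 : Series p R)
  rw [mul_one] at h
  have h1 : pderiv (k := k) a (1 : Series p R) = 0 := by
    rw [← map_one (algebraMap R (Series p R)), pderiv_algebraMap]
  rw [h, h1, mul_zero, smul_zero, add_zero]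

end pderiv

section mapDerivation

variable {k : Type*} [CommRing k] [Algebra k R]

/-- A derivation of the coefficients, applied to all coefficients. -/
noncomputable def mapDerivation (δ : Derivation k R R) : Series p R →ₗ[k] Series p R where
  toFun f := ⟨fun m => δ (f.coeff m), fun m hm => by simp [coeff_eq_zero f hm], by
    obtain ⟨s, hs⟩ := f.2.2
    exact ⟨s, fun m hm => hs m fun h => hm (by simp [coeff, h])⟩⟩
  map_add' f g := ext fun m => map_add δ _ _
  map_smul' c f := ext fun m => δ.map_smul c _

@[simp] theorem coeff_mapDerivation (δ : Derivation k R R) (f : Series p R) (m : Gen p →₀ ℕ) :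
    (mapDerivation δ f).coeff m = δ (f.coeff m) := rfl

theorem mapDerivation_mul (δ : Derivation k R R) (f g : Series p R) :
    mapDerivation δ (f * g) = mapDerivation δ f * g + f * mapDerivation δ g := by
  refine ext_adm fun m hm => ?_
  rw [coeff_mapDerivation, coeff_add, coeff_mul _ _ hm, coeff_mul _ _ hm, coeff_mul _ _ hm, map_sum,
    ← Finset.sum_add_distrib]
  refine Finset.sum_congr rfl fun x _ => ?_
  rw [← smul_add, Units.smul_def, Units.smul_def, map_zsmul, Derivation.leibniz,
    coeff_mapDerivation, coeff_mapDerivation, smul_eq_mul, smul_eq_mul, add_comm,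
    mul_comm (g.coeff x.2)]

theorem mapDerivation_mem_homogeneous (δ : Derivation k R R) {d : ℤ} {f : Series p R}
    (hf : f ∈ homogeneous p R k d) : mapDerivation δ f ∈ homogeneous p R k d :=
  fun m hm => hf m fun h => hm (by rw [coeff_mapDerivation, h, map_zero])

theorem mapDerivation_algebraMap (δ : Derivation k R R) (r : R) :
    mapDerivation δ (algebraMap R (Series p R) r) = algebraMap R (Series p R) (δ r) := by
  classical
  refine ext fun m => ?_
  rw [coeff_mapDerivation, coeff_algebraMap, coeff_algebraMap]
  split_ifs <;> simp

theorem mapDerivation_gen (δ : Derivation k R R) (a : Gen p) :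
    mapDerivation δ (gen a : Series p R) = 0 := by
  classical
  refine ext fun m => ?_
  rw [coeff_mapDerivation, coeff_gen]
  split_ifs <;> simp

end mapDerivation

section map

variable {k : Type*} [CommRing k] [Algebra k R] {S : Type*} [CommRing S] [Algebra k S]

theorem map_algebraMap (φ : R →ₐ[k] S) (r : R) :
    map φ (algebraMap R (Series p R) r) = algebraMap S (Series p S) (φ r) := by
  classical
  refine ext fun m => ?_
  rw [coeff_map, coeff_algebraMap, coeff_algebraMap]
  split_ifs <;> simp

theorem map_gen (φ : R →ₐ[k] S) (a : Gen p) :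
    map φ (gen a : Series p R) = gen a := by
  classical
  refine ext fun m => ?_
  rw [coeff_map, coeff_gen, coeff_gen]
  split_ifs <;> simp

theorem map_pderiv (φ : R →ₐ[k] S) (a : Gen p) (f : Series p R) :
    map φ (pderiv (k := k) a f) = pderiv (k := k) a (map φ f) := by
  refine ext fun m => ?_
  rw [coeff_map, coeff_pderiv, coeff_pderiv, coeff_map, map_mul, map_add, map_natCast, map_one,
    Units.smul_def, Units.smul_def, map_zsmul]

end map

end Series
end SeriesCalculus

/-! ### Smooth functions on open subsets of Euclidean space -/

section ZeroExtension

section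

variable {E F : Type*} [TopologicalSpace E] [Zero F]

open Classical in
/-- The extension by zero of a function on an open set. -/
noncomputable def zeroExt (V : Opens E) (f : V → F) : E → F :=
  fun y => if hy : y ∈ V then f ⟨y, hy⟩ else 0

theorem zeroExt_coe (V : Opens E) (f : V → F) (x : V) : zeroExt V f x = f x := by
  simp [zeroExt]

theorem zeroExt_of_mem (V : Opens E) (f : V → F) {x : E} (hx : x ∈ V) :
    zeroExt V f x = f ⟨x, hx⟩ := by
  simp [zeroExt, hx]

theorem zeroExt_eventuallyEq (V : Opens E) (f : V → F) {g : E → F} {x : E} (hx : x ∈ V)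
    (h : ∀ y : V, f y = g y) : zeroExt V f =ᶠ[nhds x] g := by
  filter_upwards [V.2.mem_nhds hx] with y hy
  rw [zeroExt_of_mem V f hy, h]

theorem zeroExt_inclusion_eventuallyEq {V U : Opens E} (h : V ≤ U) (f : U → F) {x : E}
    (hx : x ∈ V) : zeroExt V (fun y => f (Set.inclusion h y)) =ᶠ[nhds x] zeroExt U f :=
  zeroExt_eventuallyEq V _ hx fun y => (zeroExt_of_mem U f (h y.2)).symm

end

variable {E : Type*} [NormedAddCommGroup E] [NormedSpace ℝ E]
  {F : Type*} [NormedAddCommGroup F] [NormedSpace ℝ F]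

/-- Smoothness of a function on an open subset, as a manifold, is smoothness of its extension by
zero at the points of the subset. -/
theorem contMDiff_iff_zeroExt (V : Opens E) (f : V → F) :
    ContMDiff 𝓘(ℝ, E) 𝓘(ℝ, F) ∞ f ↔ ∀ x : V, ContDiffAt ℝ ∞ (zeroExt V f) x := by
  have e : f = fun x : V => zeroExt V f x := funext fun x => (zeroExt_coe V f x).symm
  refine forall_congr' fun x => ?_
  rw [← contMDiffAt_iff_contDiffAt, ← contMDiffAt_subtype_iff, ← e]

theorem mfderiv_eq_fderiv_zeroExt (V : Opens E) {f : V → F}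
    (hf : ContMDiff 𝓘(ℝ, E) 𝓘(ℝ, F) ∞ f) (x : V) (v : E) :
    (mfderiv 𝓘(ℝ, E) 𝓘(ℝ, F) f x : E →L[ℝ] F) v = fderiv ℝ (zeroExt V f) x v := by
  have hd : MDifferentiableAt 𝓘(ℝ, E) 𝓘(ℝ, F) f x := (hf x).mdifferentiableAt (by simp)
  have e : writtenInExtChartAt 𝓘(ℝ, E) 𝓘(ℝ, F) x f =ᶠ[nhds (x : E)] zeroExt V f := by
    filter_upwards [chart_target_mem_nhds E x] with y hy
    have hy' : ((chartAt E x).symm y : E) = y :=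
      (OpenPartialHomeomorph.subtypeRestr_symm_eqOn (chartAt E (x : E)) (U := V) ⟨x⟩ hy).symm
    change f ((chartAt E x).symm y) = zeroExt V f y
    rw [← zeroExt_coe V f, hy']
  have h1 : mfderiv 𝓘(ℝ, E) 𝓘(ℝ, F) f x = fderivWithin ℝ
      (writtenInExtChartAt 𝓘(ℝ, E) 𝓘(ℝ, F) x f) (Set.range 𝓘(ℝ, E))
      (extChartAt 𝓘(ℝ, E) x x) := if_pos hd
  rw [h1]
  simp only [modelWithCornersSelf_coe, Set.range_id, fderivWithin_univ]
  exact congrArg (fun T : E →L[ℝ] F => T v) (e.fderiv_eq)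

end ZeroExtension

section Parametric

open MeasureTheory

variable {E : Type} [NormedAddCommGroup E] [NormedSpace ℝ E] [FiniteDimensional ℝ E]

/-- Differentiation under the integral sign. -/
theorem hasFDerivAt_parametric_integral {F : Type} [NormedAddCommGroup F] [NormedSpace ℝ F]
    {G : E → ℝ → F} (hG : ContDiff ℝ 1 (Function.uncurry G)) (x : E) :
    HasFDerivAt (fun y => ∫ s in (0 : ℝ)..1, G y s)
      (∫ s in (0 : ℝ)..1, (fderiv ℝ (Function.uncurry G) (x, s)).comp
        (ContinuousLinearMap.inl ℝ E ℝ)) x := by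
  have hc : Continuous fun q : E × ℝ => (fderiv ℝ (Function.uncurry G) q).comp
      (ContinuousLinearMap.inl ℝ E ℝ) :=
    (hG.continuous_fderiv (by simp)).clm_comp continuous_const
  obtain ⟨C, hC⟩ := ((isCompact_closedBall x 1).prod
    (isCompact_Icc (a := (0 : ℝ)) (b := 1))).exists_bound_of_continuousOn hc.continuousOn
  refine intervalIntegral.hasFDerivAt_integral_of_dominated_of_fderiv_le
    (F := G) (bound := fun _ => C)
    (F' := fun y s => (fderiv ℝ (Function.uncurry G) (y, s)).comp (ContinuousLinearMap.inl ℝ E ℝ))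
    (Metric.closedBall_mem_nhds x one_pos) ?_ ?_ ?_ ?_ ?_ ?_
  · exact Filter.Eventually.of_forall fun y =>
      (hG.continuous.comp (Continuous.prodMk_right y)).aestronglyMeasurable
  · exact (hG.continuous.comp (Continuous.prodMk_right x)).intervalIntegrable _ _
  · exact (hc.comp (Continuous.prodMk_right x)).aestronglyMeasurable
  · refine Filter.Eventually.of_forall fun s hs y hy => hC (y, s) ⟨hy, ?_⟩
    rw [Set.uIoc_of_le zero_le_one] at hs
    exact ⟨hs.1.le, hs.2⟩
  · exact intervalIntegrable_const
  · refine Filter.Eventually.of_forall fun s _ y _ => ?_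
    have h1 := (hG.differentiable (by simp) (y, s)).hasFDerivAt
    exact HasFDerivAt.comp (g := Function.uncurry G) (f := fun y => (y, s)) y h1
      (hasFDerivAt_prodMk_left y s)

theorem contDiff_parametric_integral (n : ℕ) : ∀ {F : Type} [NormedAddCommGroup F]
    [NormedSpace ℝ F] {G : E → ℝ → F}, ContDiff ℝ n (Function.uncurry G) →
    ContDiff ℝ n fun y => ∫ s in (0 : ℝ)..1, G y s := by
  induction n with
  | zero =>
    intro F _ _ G hG
    exact contDiff_zero.2
      (intervalIntegral.continuous_parametric_intervalIntegral_of_continuous' hG.continuous 0 1)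
  | succ n ih =>
    intro F _ _ G hG
    have hG1 : ContDiff ℝ 1 (Function.uncurry G) := hG.of_le (by norm_cast; omega)
    push_cast at hG ⊢
    refine contDiff_succ_iff_fderiv.2
      ⟨fun x => (hasFDerivAt_parametric_integral hG1 x).differentiableAt, by simp, ?_⟩
    rw [show fderiv ℝ (fun y => ∫ s in (0 : ℝ)..1, G y s) = _ from
      funext fun x => (hasFDerivAt_parametric_integral hG1 x).fderiv]
    refine ih ?_
    exact (hG.fderiv_right le_rfl).clm_comp contDiff_const

/-- Hadamard's lemma, with `g_i(y)` the integral of `∂f/∂x_i` along the segment from `x` to `y`. -/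
theorem exists_contDiff_eq_add_sum {n : ℕ} {f : EuclideanSpace ℝ (Fin n) → ℝ} (hf : ContDiff ℝ ∞ f)
    (x : EuclideanSpace ℝ (Fin n)) :
    ∃ g : Fin n → EuclideanSpace ℝ (Fin n) → ℝ, (∀ i, ContDiff ℝ ∞ (g i)) ∧
      ∀ y, f y = f x + ∑ i, (y i - x i) * g i y := by
  let γ : EuclideanSpace ℝ (Fin n) → ℝ → EuclideanSpace ℝ (Fin n) := fun y s => x + s • (y - x)
  have hγ : ContDiff ℝ ∞ (Function.uncurry γ) := by
    change ContDiff ℝ ∞ fun q : EuclideanSpace ℝ (Fin n) × ℝ => x + q.2 • (q.1 - x)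
    fun_prop
  have hG : ∀ i, ContDiff ℝ ∞ (Function.uncurry fun y s => fderiv ℝ f (γ y s)
      (EuclideanSpace.single i 1)) := fun i =>
    ((hf.fderiv_right le_rfl).comp hγ).clm_apply contDiff_const
  refine ⟨fun i y => ∫ s in (0 : ℝ)..1, fderiv ℝ f (γ y s) (EuclideanSpace.single i 1),
    fun i => ?_, fun y => ?_⟩
  · exact contDiff_infty.2 fun m =>
      contDiff_parametric_integral m ((hG i).of_le (by exact_mod_cast le_top))
  · have hd : ∀ s, HasDerivAt (fun s => f (γ y s)) (fderiv ℝ f (γ y s) (y - x)) s := by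
      intro s
      have h1 : HasDerivAt (γ y) (y - x) s := by
        have := ((hasDerivAt_id s).smul_const (y - x)).const_add x
        rwa [one_smul] at this
      exact ((hf.differentiable (by simp) _).hasFDerivAt).comp_hasDerivAt s h1
    have hcont : ∀ v : EuclideanSpace ℝ (Fin n), Continuous fun s => fderiv ℝ f (γ y s) v := by
      intro v
      exact (((hf.continuous_fderiv (by simp)).comp
        (hγ.continuous.comp (Continuous.prodMk_right y)))).clm_apply continuous_const
    have h := intervalIntegral.integral_eq_sub_of_hasDerivAt (a := 0) (b := 1)
      (fun s _ => hd s) ((hcont _).intervalIntegrable _ _)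
    have e : ∀ s, fderiv ℝ f (γ y s) (y - x) =
        ∑ i, (y i - x i) * fderiv ℝ f (γ y s) (EuclideanSpace.single i 1) := by
      intro s
      conv_lhs => rw [← (EuclideanSpace.basisFun (Fin n) ℝ).sum_repr (y - x)]
      simp
    simp only [e] at h
    rw [intervalIntegral.integral_finsetSum fun i _ =>
      ((hcont _).intervalIntegrable _ _).const_mul _] at h
    simp only [intervalIntegral.integral_const_mul] at h
    rw [h]
    simp [γ]

end Parametric

section SmoothFunctions

variable {p : ℤ →₀ ℕ}

namespace Smooth

variable {V U : Opens (Base p)}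

theorem contDiffAt_zeroExt (h : Smooth p V) {x : Base p} (hx : x ∈ V) :
    ContDiffAt ℝ ∞ (zeroExt V h) x :=
  (contMDiff_iff_zeroExt V h).1 h.2 ⟨x, hx⟩

theorem differentiableAt_zeroExt (h : Smooth p V) {x : Base p} (hx : x ∈ V) :
    DifferentiableAt ℝ (zeroExt V h) x :=
  (h.contDiffAt_zeroExt hx).differentiableAt (by simp)

/-- The smooth function on `V` with the same values as a function that is smooth at the points of
`V`. -/
def ofContDiffAt (V : Opens (Base p)) (g : Base p → ℝ) (hg : ∀ x ∈ V, ContDiffAt ℝ ∞ g x) :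
    Smooth p V :=
  ⟨fun x : V => g x, (contMDiff_iff_zeroExt V _).2 fun x =>
    (hg x x.2).congr_of_eventuallyEq (zeroExt_eventuallyEq V _ x.2 fun _ => rfl)⟩

@[simp] theorem res_apply (h : V ≤ U) (f : Smooth p U) (x : V) :
    Smooth.res h f x = f (Set.inclusion h x) := rfl

/-- The derivative of smooth functions in the direction of a constant vector field. -/
noncomputable def dir (V : Opens (Base p)) (v : Base p) : Derivation ℝ (Smooth p V) (Smooth p V) :=
  Derivation.mk'
    { toFun := fun h => ofContDiffAt V (fun x => fderiv ℝ (zeroExt V h) x v)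
        fun x hx => ((contDiffAt_zeroExt h hx).fderiv_right (m := ∞) le_rfl).clm_apply
          contDiffAt_const
      map_add' := fun f g => by
        ext x
        have e : zeroExt V (f + g : Smooth p V) =ᶠ[nhds (x : Base p)] zeroExt V f + zeroExt V g :=
          zeroExt_eventuallyEq V _ x.2 fun y => by simp [zeroExt_coe]
        change fderiv ℝ (zeroExt V (f + g : Smooth p V)) x v =
          fderiv ℝ (zeroExt V f) x v + fderiv ℝ (zeroExt V g) x v
        rw [e.fderiv_eq,
          fderiv_add (f.differentiableAt_zeroExt x.2) (g.differentiableAt_zeroExt x.2)]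
        rfl
      map_smul' := fun c f => by
        ext x
        have e : zeroExt V (c • f : Smooth p V) =ᶠ[nhds (x : Base p)] c • zeroExt V f :=
          zeroExt_eventuallyEq V _ x.2 fun y => by simp [zeroExt_coe]
        change fderiv ℝ (zeroExt V (c • f : Smooth p V)) x v = c * fderiv ℝ (zeroExt V f) x v
        rw [e.fderiv_eq, fderiv_const_smul (f.differentiableAt_zeroExt x.2)]
        rfl }
    fun f g => by
      ext x
      have e : zeroExt V (f * g : Smooth p V) =ᶠ[nhds (x : Base p)] zeroExt V f * zeroExt V g :=
        zeroExt_eventuallyEq V _ x.2 fun y => by simp [zeroExt_coe]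
      change fderiv ℝ (zeroExt V (f * g : Smooth p V)) x v =
        f x * fderiv ℝ (zeroExt V g) x v + g x * fderiv ℝ (zeroExt V f) x v
      rw [e.fderiv_eq, fderiv_mul (f.differentiableAt_zeroExt x.2) (g.differentiableAt_zeroExt x.2)]
      simp [zeroExt_coe]

theorem dir_apply (v : Base p) (h : Smooth p V) (x : V) :
    dir V v h x = fderiv ℝ (zeroExt V h) x v := rfl

theorem res_dir (h : V ≤ U) (v : Base p) (f : Smooth p U) :
    Smooth.res h (dir U v f) = dir V v (Smooth.res h f) := by
  ext x
  rw [res_apply, dir_apply, dir_apply]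
  exact congrArg (fun T : Base p →L[ℝ] ℝ => T v)
    (zeroExt_inclusion_eventuallyEq h f x.2).fderiv_eq.symm

/-- The standard coordinate functions. -/
noncomputable def coord (V : Opens (Base p)) (i : Fin (p 0)) : Smooth p V :=
  ofContDiffAt V (fun x => x i) fun _ _ =>
    ((EuclideanSpace.proj i : Base p →L[ℝ] ℝ).contDiff).contDiffAt

theorem dir_coord (i j : Fin (p 0)) :
    dir V (EuclideanSpace.single i 1) (coord V j) = if i = j then 1 else 0 := by
  ext x
  have e : zeroExt V (coord V j) =ᶠ[nhds (x : Base p)]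
      (EuclideanSpace.proj j : Base p →L[ℝ] ℝ) :=
    zeroExt_eventuallyEq V _ x.2 fun y => rfl
  rw [dir_apply, e.fderiv_eq, ContinuousLinearMap.fderiv]
  by_cases h : i = j
  · simp [h]
  · simp [h, Ne.symm h]

/-- Near every point, a smooth function is the restriction of one that is smooth everywhere. -/
theorem exists_contDiff_eq (h : Smooth p V) {x : Base p} (hx : x ∈ V) :
    ∃ (B : Opens (Base p)) (_ : x ∈ B) (hB : B ≤ V) (f : Base p → ℝ), ContDiff ℝ ∞ f ∧
      ∀ y : B, Smooth.res hB h y = f y := by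
  obtain ⟨ε, hε, hεV⟩ := Metric.isOpen_iff.1 V.2 x hx
  let ρ : ContDiffBump x := ⟨ε / 3, ε / 2, by positivity, by linarith⟩
  refine ⟨⟨Metric.ball x (ε / 3), Metric.isOpen_ball⟩, Metric.mem_ball_self (by positivity),
    fun y hy => hεV (Metric.ball_subset_ball (by linarith) hy), fun y => ρ y * zeroExt V h y,
    contDiff_iff_contDiffAt.2 fun y => ?_, fun y => ?_⟩
  · by_cases hy : y ∈ Metric.ball x ε
    · exact ρ.contDiff.contDiffAt.mul (h.contDiffAt_zeroExt (hεV hy))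
    · -- away from the support of the bump function the product vanishes
      have : (fun y => ρ y * zeroExt V h y) =ᶠ[nhds y] fun _ => 0 := by
        have hy' : y ∈ (Metric.closedBall x (ε / 2))ᶜ := fun hc =>
          hy (Metric.closedBall_subset_ball (by linarith) hc)
        filter_upwards [Metric.isClosed_closedBall.isOpen_compl.mem_nhds hy'] with z hz
        rw [Set.mem_compl_iff, Metric.mem_closedBall, not_le] at hz
        rw [ρ.zero_of_le_dist hz.le, zero_mul]
      exact contDiffAt_const.congr_of_eventuallyEq this
  · have : ρ y = 1 := ρ.one_of_mem_closedBall (Metric.ball_subset_closedBall y.2)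
    refine (zeroExt_of_mem V h _).symm.trans ?_
    exact (by rw [this, one_mul] : zeroExt V h y = ρ y * zeroExt V h y)

/-- Compatible smooth functions glue. -/
theorem exists_glue {ι : Type*} (V : ι → Opens (Base p)) (f : ∀ i, Smooth p (V i))
    (hf : ∀ i j, Smooth.res (inf_le_left : V i ⊓ V j ≤ V i) (f i) =
      Smooth.res (inf_le_right : V i ⊓ V j ≤ V j) (f j)) :
    ∃ g : Smooth p (⨆ i, V i), ∀ i, Smooth.res (le_iSup V i) g = f i := by
  have hmem : ∀ x : (⨆ i, V i : Opens (Base p)), ∃ i, (x : Base p) ∈ V i := fun x =>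
    Opens.mem_iSup.1 x.2
  choose c hc using hmem
  have key : ∀ (i) (x : (⨆ i, V i : Opens (Base p))) (hx : (x : Base p) ∈ V i),
      f (c x) ⟨x, hc x⟩ = f i ⟨x, hx⟩ := fun i x hx =>
    DFunLike.congr_fun (hf (c x) i) ⟨x, hc x, hx⟩
  refine ⟨⟨fun x => f (c x) ⟨x, hc x⟩, (contMDiff_iff_zeroExt _ _).2 fun x => ?_⟩,
    fun i => ?_⟩
  · refine ((f (c x)).contDiffAt_zeroExt (hc x)).congr_of_eventuallyEq ?_
    filter_upwards [(V (c x)).2.mem_nhds (hc x)] with y hy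
    rw [zeroExt_of_mem _ _ (Opens.mem_iSup.2 ⟨_, hy⟩), zeroExt_of_mem _ _ hy]
    exact key _ _ hy
  · ext x
    exact key i ⟨x, _⟩ x.2

theorem eq_of_res {ι : Type*} (V : ι → Opens (Base p)) {f g : Smooth p (⨆ i, V i)}
    (h : ∀ i, Smooth.res (le_iSup V i) f = Smooth.res (le_iSup V i) g) : f = g := by
  ext x
  obtain ⟨i, hi⟩ := Opens.mem_iSup.1 x.2
  exact DFunLike.congr_fun (h i) ⟨x, hi⟩

end Smooth
end SmoothFunctions

/-! ### The graded domain and its vector fields -/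

section Model

variable {p : ℤ →₀ ℕ}

/-- Glueing takes place coefficient by coefficient. The glued family of coefficients is homogeneous
of the given degree because a coefficient that vanishes on every member of the cover is zero. -/
theorem model_isSheaf (p : ℤ →₀ ℕ) : (model p).IsSheaf := by
  intro ι V d f hf hcomp
  have hg : ∀ m : Gen p →₀ ℕ, ∃ g : Smooth p (⨆ i, V i), ∀ i,
      Smooth.res (le_iSup V i) g = Series.coeff (R := Smooth p (V i)) (f i) m := fun m =>
    Smooth.exists_glue V _ fun i j =>
      congrArg (fun s : Series p (Smooth p (V i ⊓ V j)) => s.coeff m) (hcomp i j)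
  choose g hg using hg
  have hzero : ∀ m, (∀ i, Series.coeff (R := Smooth p (V i)) (f i) m = 0) → g m = 0 :=
    fun m hm => Smooth.eq_of_res V fun i => ((hg m i).trans (hm i)).trans (map_zero _).symm
  have hwt : ∀ m, g m ≠ 0 → wt m = d := fun m hm => by
    by_contra hne
    exact hm (hzero m fun i => by
      by_contra h0
      exact hne (hf i m h0))
  let s : Series p (Smooth p (⨆ i, V i)) :=
    ⟨g, fun m hm => hzero m fun i => Series.coeff_eq_zero (R := Smooth p (V i)) (f i) hm, {d},
      fun m hm => Finset.mem_singleton.2 (hwt m hm)⟩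
  refine ⟨s, ⟨hwt, fun i => Series.ext (R := Smooth p (V i)) fun m => hg m i⟩, ?_⟩
  rintro s' ⟨-, hs'⟩
  refine Series.ext (R := Smooth p (⨆ i, V i)) fun m => Smooth.eq_of_res V fun i => ?_
  rw [show Smooth.res (le_iSup V i) (s.coeff m) = _ from hg m i, ← hs' i]
  rfl

variable {U V W : Opens (Base p)}

theorem model_res_ofSmooth (h : V ≤ U) (f : Smooth p U) :
    (model p).res h (ofSmooth U f) = ofSmooth V (Smooth.res h f) :=
  Series.map_algebraMap _ _

/-- The generator `w_a` as a section of the structure sheaf of the graded domain. -/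
noncomputable def modelGen (V : Opens (Base p)) (a : Gen p) : (model p).obj V :=
  (Series.gen a : Series p (Smooth p V))

theorem ofGen_eq_sum (v : GenSpace p) : ofGen V v = ∑ a, v a • modelGen V a := rfl

/-- The coefficient of `w^m` as an additive map on sections. -/
noncomputable def modelCoeff (V : Opens (Base p)) (m : Gen p →₀ ℕ) :
    (model p).obj V →+ Smooth p V :=
  (Series.coeffHom m : Series p (Smooth p V) →+ Smooth p V)

theorem modelCoeff_ofSmooth_mul (f : Smooth p V) (g : (model p).obj V) (m : Gen p →₀ ℕ) :
    modelCoeff V m (ofSmooth V f * g) = f * modelCoeff V m g :=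
  Series.coeff_algebraMap_mul (R := Smooth p V) f g m

theorem model_ext {f g : (model p).obj V} (h : ∀ m, modelCoeff V m f = modelCoeff V m g) : f = g :=
  Series.ext (R := Smooth p V) h

theorem model_res_gen (h : V ≤ U) (a : Gen p) :
    (model p).res h (modelGen U a) = modelGen V a :=
  Series.map_gen _ _

theorem ofSmooth_mem (f : Smooth p V) : ofSmooth V f ∈ (model p).deg V 0 :=
  Series.algebraMap_mem_homogeneous ℝ f

theorem modelGen_mem (a : Gen p) : modelGen V a ∈ (model p).deg V a.deg :=
  Series.gen_mem_homogeneous ℝ a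

theorem ofSmooth_add (f g : Smooth p V) : ofSmooth V (f + g) = ofSmooth V f + ofSmooth V g :=
  map_add _ _ _

theorem ofSmooth_mul (f g : Smooth p V) : ofSmooth V (f * g) = ofSmooth V f * ofSmooth V g :=
  map_mul _ _ _

theorem ofSmooth_sum {ι : Type*} (s : Finset ι) (f : ι → Smooth p V) :
    ofSmooth V (∑ i ∈ s, f i) = ∑ i ∈ s, ofSmooth V (f i) :=
  map_sum (algebraMap (Smooth p V) (Series p (Smooth p V))) _ _

theorem ofSmooth_algebraMap (c : ℝ) :
    ofSmooth V (algebraMap ℝ (Smooth p V) c) = algebraMap ℝ ((model p).obj V) c :=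
  Series.ext (R := Smooth p V) fun m => by
    classical
    have h1 : Series.coeff (R := Smooth p V) (ofSmooth V (algebraMap ℝ (Smooth p V) c)) m = _ :=
      Series.coeff_algebraMap _ m
    have h2 : Series.coeff (R := Smooth p V) (algebraMap ℝ ((model p).obj V) c) m =
        c • (1 : Series p (Smooth p V)).coeff m := by
      rw [Algebra.algebraMap_eq_smul_one]; rfl
    rw [h1, h2, Series.coeff_one, Algebra.algebraMap_eq_smul_one]
    split_ifs <;> simp

namespace GradedPresheaf.IsDerivation

variable {X : Type*} [TopologicalSpace X] {O : GradedPresheaf X} {Z : Opens X} {k : ℤ}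
  {D : Module.End ℝ (O.obj Z)}

theorem map_one (hD : O.IsDerivation k D) : D 1 = 0 := by
  have h := hD.leibniz (O.gradedMonoid Z).one_mem 1
  simpa using h

theorem map_algebraMap (hD : O.IsDerivation k D) (c : ℝ) : D (algebraMap ℝ _ c) = 0 := by
  rw [Algebra.algebraMap_eq_smul_one, map_smul, hD.map_one, smul_zero]

/-- Over sections of degree `0` a derivation obeys the Leibniz rule without sign, whatever its
degree. -/
theorem leibniz_zero (hD : O.IsDerivation k D) {f : O.obj Z} (hf : f ∈ O.deg Z 0) (g : O.obj Z) :
    D (f * g) = D f * g + f * D g := by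
  rw [hD.leibniz hf]
  simp

end GradedPresheaf.IsDerivation

/-- A vector field that kills the coordinate functions kills every smooth function: by Hadamard's
lemma its value on `h` is, near `x`, a combination of values on coordinate functions and of
functions `t_i - t_i(x)`, so all its coefficients vanish at `x`. -/
theorem apply_ofSmooth_eq_zero {k : ℤ} {E : (model p).Family U} (hE : E ∈ (model p).vecDeg U k)
    (hx : ∀ i, E ⟨U, le_rfl⟩ (ofSmooth U (Smooth.coord U i)) = 0)
    (V : {V : Opens (Base p) // V ≤ U}) (h : Smooth p V.1) : E V (ofSmooth V.1 h) = 0 := by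
  refine model_ext fun m => ?_
  ext x
  obtain ⟨B, hxB, hBV, f, hf, hfB⟩ := h.exists_contDiff_eq x.2
  obtain ⟨g, hg, hfg⟩ := exists_contDiff_eq_add_sum hf (x : Base p)
  let G : Fin (p 0) → Smooth p B := fun i =>
    Smooth.ofContDiffAt B (g i) fun y _ => (hg i).contDiffAt
  let T : Fin (p 0) → Smooth p B := fun i =>
    Smooth.coord B i - algebraMap ℝ (Smooth p B) ((x : Base p) i)
  let B' : {V : Opens (Base p) // V ≤ U} := ⟨B, hBV.trans V.2⟩
  have e1 : Smooth.res hBV h = algebraMap ℝ (Smooth p B) (f x) + ∑ i, T i * G i := by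
    ext y
    have e2 : (∑ i, T i * G i) y = ∑ i, (T i * G i) y :=
      map_sum (ContMDiffMap.evalRingHom (I := 𝓘(ℝ, Base p)) (n := ∞) (R := ℝ) y) _ _
    rw [hfB, hfg]
    change f x + _ = f x + (∑ i, T i * G i) y
    rw [e2]
    rfl
  have hT : ∀ i, E B' (ofSmooth B (T i)) = 0 := fun i => by
    have e3 : ofSmooth B (T i) = (model p).res (hBV.trans V.2) (ofSmooth U (Smooth.coord U i)) -
        algebraMap ℝ _ ((x : Base p) i) := by
      rw [model_res_ofSmooth, ← ofSmooth_algebraMap]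
      exact map_sub (algebraMap (Smooth p B) (Series p (Smooth p B))) _ _
    rw [e3, map_sub, (hE.1 B').map_algebraMap, ← hE.2 ⟨U, le_rfl⟩ B' (hBV.trans V.2), hx]
    exact (congrArg (· - 0) (map_zero ((model p).res (hBV.trans V.2)))).trans (sub_zero _)
  -- the Leibniz rule, with `E (T i) = 0`
  have e4 : E B' (ofSmooth B (Smooth.res hBV h)) =
      ∑ i, ofSmooth B (T i) * E B' (ofSmooth B (G i)) := by
    rw [e1, ofSmooth_add, ofSmooth_algebraMap, map_add, (hE.1 B').map_algebraMap, zero_add,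
      ofSmooth_sum, map_sum]
    refine Finset.sum_congr rfl fun i _ => ?_
    rw [ofSmooth_mul, (hE.1 B').leibniz_zero (ofSmooth_mem _), hT, zero_mul, zero_add]
  have e5 : modelCoeff B m (E B' (ofSmooth B (Smooth.res hBV h))) ⟨x, hxB⟩ = 0 := by
    rw [e4, map_sum]
    refine (map_sum (ContMDiffMap.evalRingHom (I := 𝓘(ℝ, Base p)) (n := ∞) (R := ℝ)
      (⟨x, hxB⟩ : B)) _ _).trans (Finset.sum_eq_zero fun i _ => ?_)
    rw [modelCoeff_ofSmooth_mul]
    have hTx : T i ⟨x, hxB⟩ = 0 := sub_self _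
    exact (congrArg (· * _) hTx).trans (zero_mul _)
  rw [← model_res_ofSmooth] at e5
  rw [← hE.2 V B' hBV] at e5
  exact e5

/-- A homogeneous vector field on a graded domain that kills the coordinates is zero: after
`apply_ofSmooth_eq_zero` it kills constants in the sense of series, and by the Leibniz rule it
commutes up to sign with multiplication by generators. -/
theorem eq_zero_of_apply_coord {k : ℤ} {E : (model p).Family U} (hE : E ∈ (model p).vecDeg U k)
    (hx : ∀ i, E ⟨U, le_rfl⟩ (ofSmooth U (Smooth.coord U i)) = 0)
    (hw : ∀ a, E ⟨U, le_rfl⟩ (modelGen U a) = 0) : E = 0 := by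
  funext V
  have hgen : ∀ a, E V (modelGen V.1 a) = 0 := fun a => by
    rw [← model_res_gen V.2, ← hE.2 ⟨U, le_rfl⟩ V V.2, hw]
    exact map_zero ((model p).res V.2)
  let L : Series p (Smooth p V.1) →+ Series p (Smooth p V.1) := (E V).toAddMonoidHom
  have hL : L = 0 := by
    refine Series.eq_zero_of_gen_mul L (fun r => apply_ofSmooth_eq_zero hE hx V r)
      (fun a => (k * a.deg).negOnePow) fun a f => ?_
    refine ((hE.1 V).leibniz (modelGen_mem a) f).trans ?_
    rw [hgen]
    exact (congrArg (· + _) (zero_mul (M₀ := (model p).obj V.1) f)).trans (zero_add _)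
  exact LinearMap.ext fun f => DFunLike.congr_fun hL f

/-- The vector field on the graded domain that differentiates the coefficients in the direction of
`v`. -/
noncomputable def dirFamily (U : Opens (Base p)) (v : Base p) : (model p).Family U :=
  fun V => (Series.mapDerivation (Smooth.dir V.1 v) :
    Series p (Smooth p V.1) →ₗ[ℝ] Series p (Smooth p V.1))

theorem dirFamily_mem (U : Opens (Base p)) (v : Base p) :
    dirFamily U v ∈ (model p).vecDeg U 0 := by
  refine ⟨fun V => ⟨fun {m f} hf => ?_, fun {m f} hf g => ?_⟩, fun V V' h f => ?_⟩
  · rw [add_zero]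
    exact Series.mapDerivation_mem_homogeneous _ hf
  · rw [zero_mul, Int.negOnePow_zero, one_smul]
    exact Series.mapDerivation_mul (p := p) (Smooth.dir V.1 v) f g
  · exact Series.ext (R := Smooth p V'.1) fun m => Smooth.res_dir h v _

/-- The vector field `∂/∂w_a` on the graded domain. -/
noncomputable def genFamily (U : Opens (Base p)) (a : Gen p) : (model p).Family U :=
  fun V => (Series.pderiv a : Series p (Smooth p V.1) →ₗ[ℝ] Series p (Smooth p V.1))

theorem genFamily_mem (U : Opens (Base p)) (a : Gen p) :
    genFamily U a ∈ (model p).vecDeg U (-a.deg) := by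
  refine ⟨fun V => ⟨fun {m f} hf => ?_, fun {m f} hf g => ?_⟩, fun V V' h f => ?_⟩
  · exact Series.pderiv_mem_homogeneous a hf
  · refine (Series.pderiv_mul (k := ℝ) (R := Smooth p V.1) a f g).trans ?_
    rw [Series.twist_of_mem (R := Smooth p V.1) hf, neg_mul, Int.negOnePow_neg]
    exact congrArg (_ + ·) (smul_mul_assoc _ _ _)
  · exact Series.map_pderiv _ _ _

end Model

/-! ### The sheaf of vector fields -/

section VecSheaf

namespace GradedPresheaf

universe u v
variable {X : Type v} [TopologicalSpace X] {O : GradedPresheaf.{u} X}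

theorem exists_components {V : Opens X} (f : O.obj V) :
    ∃ c : ℤ →₀ O.obj V, (∀ d, c d ∈ O.deg V d) ∧ ∑ d ∈ c.support, c d = f := by
  refine (Submodule.mem_iSup_iff_exists_finsupp _ _).1 ?_
  rw [(O.isInternal V).submodule_iSup_eq_top]
  trivial

/-- Independence of the homogeneous components, for degrees shifted by `m`. -/
theorem eq_zero_of_sum_eq_zero {V : Opens X} {s : Finset ℤ} {c : ℤ → O.obj V} (m : ℤ)
    (hc : ∀ d ∈ s, c d ∈ O.deg V (m + d)) (h : ∑ d ∈ s, c d = 0) : ∀ d ∈ s, c d = 0 := by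
  have hi : iSupIndep fun d => O.deg V (m + d) :=
    (O.isInternal V).submodule_iSupIndep.comp (add_right_injective m)
  exact (iSupIndep_iff_finsetSum_eq_zero_imp_eq_zero _).1 hi s c hc h

/-- An additive map on sections is determined by its values on homogeneous sections. -/
theorem endHom_ext {V : Opens X} {D D' : Module.End ℝ (O.obj V)}
    (h : ∀ (m : ℤ) (f : O.obj V), f ∈ O.deg V m → D f = D' f) : D = D' := by
  refine LinearMap.ext fun f => ?_
  obtain ⟨c, hc, rfl⟩ := exists_components f
  rw [map_sum, map_sum]
  exact Finset.sum_congr rfl fun d _ => h d _ (hc d)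

theorem family_sum_apply {V : Opens X} {ι : Type*} (s : Finset ι) (D : ι → O.Family V)
    (V' : {V' : Opens X // V' ≤ V}) (f : O.obj V'.1) :
    (∑ i ∈ s, D i) V' f = ∑ i ∈ s, D i V' f := by
  have h1 : (∑ i ∈ s, D i) V' = ∑ i ∈ s, D i V' :=
    Finset.sum_apply (M := fun V' : {V' : Opens X // V' ≤ V} => Module.End ℝ (O.obj V'.1)) V' s D
  rw [h1, LinearMap.sum_apply]

/-- The homogeneous components of a vector field vanish where the vector field does. -/
theorem apply_eq_zero_of_sum {V : Opens X} {s : Finset ℤ} {D : ℤ → O.Family V}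
    (hD : ∀ k ∈ s, D k ∈ O.vecDeg V k) {V' : {V' : Opens X // V' ≤ V}} {m : ℤ} {f : O.obj V'.1}
    (hf : f ∈ O.deg V'.1 m) (h : (∑ k ∈ s, D k) V' f = 0) : ∀ k ∈ s, D k V' f = 0 :=
  eq_zero_of_sum_eq_zero m (fun k hk => ((hD k hk).1 V').map_deg hf)
    (by rw [← family_sum_apply, h])

theorem vecDeg_indep (V : Opens X) : iSupIndep (O.vecDeg V) := by
  refine (iSupIndep_iff_finsetSum_eq_zero_imp_eq_zero _).2 fun s D hD h k hk => ?_
  funext V'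
  refine endHom_ext fun m f hf => ?_
  exact apply_eq_zero_of_sum hD hf (by rw [h]; rfl) k hk

theorem exists_vec_components {V : Opens X} (D : O.Vec V) :
    ∃ c : ℤ →₀ O.Family V, (∀ k, c k ∈ O.vecDeg V k) ∧ ∑ k ∈ c.support, c k = D.1 :=
  (Submodule.mem_iSup_iff_exists_finsupp _ _).1 D.2

theorem eq_iSup_inf {ι : Type*} {V : ι → Opens X} {W : Opens X} (h : W ≤ ⨆ i, V i) :
    W = ⨆ i, W ⊓ V i := by
  rw [← inf_iSup_eq, inf_eq_left.2 h]

namespace IsSheaf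

variable {ι : Type v} {V : ι → Opens X} {W : Opens X}

/-- The sheaf property in degree `d` for a cover of `W` by the sets `W ⊓ V i`. -/
theorem existsUnique_glue (hO : O.IsSheaf) (hW : W ≤ ⨆ i, V i) {d : ℤ}
    (f : ∀ i, O.obj (W ⊓ V i)) (hf : ∀ i, f i ∈ O.deg _ d)
    (h : ∀ i j, O.res (inf_le_left : (W ⊓ V i) ⊓ (W ⊓ V j) ≤ W ⊓ V i) (f i) =
      O.res (inf_le_right : (W ⊓ V i) ⊓ (W ⊓ V j) ≤ W ⊓ V j) (f j)) :
    ∃! s : O.obj W, s ∈ O.deg W d ∧ ∀ i, O.res (inf_le_left : W ⊓ V i ≤ W) s = f i := by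
  have key : ∀ (W' : Opens X) (hW' : ∀ i, W ⊓ V i ≤ W'), W' = ⨆ i, W ⊓ V i →
      ∃! s : O.obj W', s ∈ O.deg W' d ∧ ∀ i, O.res (hW' i) s = f i := by
    rintro W' hW' rfl
    exact hO ι (fun i => W ⊓ V i) d f hf h
  exact key W (fun _ => inf_le_left) (eq_iSup_inf hW)

theorem eq_of_res (hO : O.IsSheaf) (hW : W ≤ ⨆ i, V i) {s t : O.obj W}
    (h : ∀ i, O.res (inf_le_left : W ⊓ V i ≤ W) s = O.res inf_le_left t) : s = t := by
  rw [← sub_eq_zero]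
  obtain ⟨c, hc, hsum⟩ := exists_components (s - t)
  rw [← hsum]
  refine Finset.sum_eq_zero fun d hd => ?_
  have h0 : ∀ i, O.res (inf_le_left : W ⊓ V i ≤ W) (c d) = 0 := fun i => by
    refine eq_zero_of_sum_eq_zero (s := c.support)
      (c := fun d => O.res (inf_le_left : W ⊓ V i ≤ W) (c d)) 0
      (fun d _ => by rw [zero_add]; exact O.res_mem _ (hc d)) ?_ d hd
    rw [← map_sum, hsum, map_sub, h, sub_self]
  exact (hO.existsUnique_glue hW (d := d) (fun _ => 0) (fun _ => Submodule.zero_mem _)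
    fun i j => by rw [map_zero, map_zero]).unique ⟨hc d, h0⟩
    ⟨Submodule.zero_mem _, fun i => map_zero _⟩

end IsSheaf

/-- Compatible homogeneous vector fields glue: the value on a section is glued from its values on
the members of the cover. -/
theorem exists_vec_glue (hO : O.IsSheaf) {ι : Type v} {V : ι → Opens X} {k : ℤ}
    {D : ∀ i, O.Family (V i)} (hD : ∀ i, D i ∈ O.vecDeg (V i) k)
    (h : ∀ i j (W : Opens X) (hi : W ≤ V i) (hj : W ≤ V j), D i ⟨W, hi⟩ = D j ⟨W, hj⟩) :
    ∃ S ∈ O.vecDeg (⨆ i, V i) k, ∀ i, Family.res (le_iSup V i) S = D i := by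
  -- homogeneous sections come first, because the sheaf property holds in each degree separately
  have hom : ∀ (W : Opens X) (hW : W ≤ ⨆ i, V i) (m : ℤ) (f : O.obj W), f ∈ O.deg W m →
      ∃ s ∈ O.deg W (m + k), ∀ i, O.res (inf_le_left : W ⊓ V i ≤ W) s =
        D i ⟨W ⊓ V i, inf_le_right⟩ (O.res inf_le_left f) := by
    intro W hW m f hf
    obtain ⟨s, ⟨hs, hs'⟩, -⟩ := hO.existsUnique_glue hW (d := m + k)
      (fun i => D i ⟨W ⊓ V i, inf_le_right⟩ (O.res inf_le_left f))
      (fun i => ((hD i).1 ⟨W ⊓ V i, inf_le_right⟩).map_deg (O.res_mem _ hf)) fun i j => by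
        have hi : (W ⊓ V i) ⊓ (W ⊓ V j) ≤ V i := inf_le_left.trans inf_le_right
        have hj : (W ⊓ V i) ⊓ (W ⊓ V j) ≤ V j := inf_le_right.trans inf_le_right
        rw [(hD i).2 ⟨W ⊓ V i, inf_le_right⟩ ⟨_, hi⟩ inf_le_left,
          (hD j).2 ⟨W ⊓ V j, inf_le_right⟩ ⟨_, hj⟩ inf_le_right, O.res_res, O.res_res,
          h i j _ hi hj]
    exact ⟨s, hs, hs'⟩
  have ex : ∀ (W : {W : Opens X // W ≤ ⨆ i, V i}) (f : O.obj W.1), ∃ s : O.obj W.1, ∀ i,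
      O.res (inf_le_left : W.1 ⊓ V i ≤ W.1) s =
        D i ⟨W.1 ⊓ V i, inf_le_right⟩ (O.res inf_le_left f) := by
    intro W f
    obtain ⟨c, hc, rfl⟩ := exists_components f
    choose s _ hs using fun d => hom W.1 W.2 d (c d) (hc d)
    refine ⟨∑ d ∈ c.support, s d, fun i => ?_⟩
    rw [map_sum, map_sum, map_sum]
    exact Finset.sum_congr rfl fun d _ => hs d i
  choose S hS using ex
  have uniq : ∀ (W : {W : Opens X // W ≤ ⨆ i, V i}) (f s : O.obj W.1),
      (∀ i, O.res (inf_le_left : W.1 ⊓ V i ≤ W.1) s =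
        D i ⟨W.1 ⊓ V i, inf_le_right⟩ (O.res inf_le_left f)) → S W f = s := fun W f s hs =>
    hO.eq_of_res W.2 fun i => by rw [hS, hs]
  let T : O.Family (⨆ i, V i) := fun W =>
    { toFun := S W
      map_add' := fun f g => uniq W _ _ fun i => by rw [map_add, map_add, map_add, hS, hS]
      map_smul' := fun c f => uniq W _ _ fun i => by
        rw [map_smul, map_smul, map_smul, hS, RingHom.id_apply] }
  refine ⟨T, ⟨fun W => ⟨fun {m f} hf => ?_, fun {m f} hf g => ?_⟩, fun W W' hW f => ?_⟩,
    fun i => ?_⟩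
  · obtain ⟨s, hs, hs'⟩ := hom W.1 W.2 m f hf
    change S W f ∈ _
    rw [uniq W f s hs']
    exact hs
  · refine uniq W _ _ fun i => ?_
    rw [map_add, map_mul, map_mul, ((hD i).1 _).leibniz (O.res_mem _ hf), Units.smul_def,
      Units.smul_def, map_zsmul, map_mul]
    rw [← hS W f i, ← hS W g i]
    rfl
  · refine (uniq W' _ _ fun i => ?_).symm
    change O.res _ (O.res hW (S W f)) = _
    have hWi : W'.1 ⊓ V i ≤ W.1 ⊓ V i := inf_le_inf_right _ hW
    rw [O.res_res, ← O.res_res hWi inf_le_left, hS,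
      (hD i).2 ⟨W.1 ⊓ V i, inf_le_right⟩ ⟨W'.1 ⊓ V i, inf_le_right⟩ hWi, O.res_res, O.res_res]
  · funext W
    refine LinearMap.ext fun f => ?_
    refine uniq ⟨W.1, W.2.trans (le_iSup V i)⟩ f _ fun j => ?_
    rw [(hD i).2 W ⟨W.1 ⊓ V j, inf_le_left.trans W.2⟩ inf_le_left,
      h i j _ (inf_le_left.trans W.2) inf_le_right]

theorem IsSheaf.vecIsSheaf (hO : O.IsSheaf) : O.VecIsSheaf where
  indep := vecDeg_indep
  smul_graded hf hD := O.smul_mem_vecDeg hf hD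
  res_smul h f D := Subtype.ext <| funext fun V' =>
    congrArg (· • D.1 ⟨V'.1, V'.2.trans h⟩) (O.res_res V'.2 h f).symm
  glue ι V k D hD hcomp := by
    have hW : ∀ i j (W : Opens X) (hi : W ≤ V i) (hj : W ≤ V j),
        (D i).1 ⟨W, hi⟩ = (D j).1 ⟨W, hj⟩ := fun i j W hi hj =>
      congrArg (fun T : O.Vec (V i ⊓ V j) => T.1 ⟨W, le_inf hi hj⟩) (hcomp i j)
    obtain ⟨S, hS, hSD⟩ := exists_vec_glue hO hD hW
    refine ⟨⟨S, Submodule.mem_iSup_of_mem k hS⟩, ⟨hS, fun i => Subtype.ext (hSD i)⟩, ?_⟩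
    rintro S' ⟨hS', hSD'⟩
    refine Subtype.ext (funext fun W => LinearMap.ext fun f => hO.eq_of_res W.2 fun i => ?_)
    have hle : W.1 ⊓ V i ≤ ⨆ i, V i := inf_le_left.trans W.2
    rw [hS'.2 W ⟨_, hle⟩ inf_le_left, hS.2 W ⟨_, hle⟩ inf_le_left]
    have e1 := congrArg (fun T : O.Vec (V i) => T.1 ⟨W.1 ⊓ V i, inf_le_right⟩) (hSD' i)
    have e2 := congrArg (fun T : O.Family (V i) => T ⟨W.1 ⊓ V i, inf_le_right⟩) (hSD i)
    exact DFunLike.congr_fun (e1.trans e2.symm) _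

end GradedPresheaf
end VecSheaf

/-! ### Transport along a trivialisation -/

section Transport

universe u v

namespace GradedPresheaf

variable {X : Type v} [TopologicalSpace X] {O : GradedPresheaf.{u} X}

theorem res_bijective_of_eq {V U : Opens X} (h : V ≤ U) (e : V = U) :
    Function.Bijective (O.res h) := by
  subst e
  exact ⟨fun f g hfg => by rwa [O.res_self, O.res_self] at hfg, fun f => ⟨f, O.res_self f⟩⟩

/-- An injective degree-preserving map reflects degrees. -/
theorem mem_deg_of_map_mem {Y : Type*} [TopologicalSpace Y] {O' : GradedPresheaf Y} {V : Opens X}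
    {V' : Opens Y} (σ : O.obj V →ₐ[ℝ] O'.obj V') (hσ : Function.Injective σ)
    (hdeg : ∀ {d f}, f ∈ O.deg V d → σ f ∈ O'.deg V' d) {d : ℤ} {f : O.obj V}
    (hf : σ f ∈ O'.deg V' d) : f ∈ O.deg V d := by
  classical
  obtain ⟨c, hc, hsum⟩ := exists_components f
  have hsum' : ∑ j ∈ insert d c.support, c j = f := by
    rw [← hsum]
    refine (Finset.sum_subset (Finset.subset_insert _ _) fun j _ hj => ?_).symm
    exact Finsupp.notMem_support_iff.1 hj
  have h0 := eq_zero_of_sum_eq_zero (O := O') (s := insert d c.support)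
    (c := fun j => σ (c j) - if j = d then σ f else 0) 0 (fun j _ => by
      rw [zero_add]
      refine Submodule.sub_mem _ (hdeg (hc j)) ?_
      split_ifs with hj
      · exact hj ▸ hf
      · exact Submodule.zero_mem _) (by
      rw [Finset.sum_sub_distrib, ← map_sum, hsum', Finset.sum_ite_eq',
        if_pos (Finset.mem_insert_self _ _), sub_self])
  have hd := h0 d (Finset.mem_insert_self _ _)
  rw [if_pos rfl, sub_eq_zero] at hd
  exact hσ hd ▸ hc d

/-- Conjugation of an operator on sections by an isomorphism of algebras of sections. -/
noncomputable def conj {Y : Type*} [TopologicalSpace Y] {O' : GradedPresheaf Y} {V : Opens X}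
    {V' : Opens Y} (σ : O.obj V ≃ₐ[ℝ] O'.obj V') (D : Module.End ℝ (O.obj V)) :
    Module.End ℝ (O'.obj V') :=
  σ.toLinearMap ∘ₗ D ∘ₗ σ.symm.toLinearMap

section conj

variable {Y : Type*} [TopologicalSpace Y] {O' : GradedPresheaf Y} {V U : Opens X} {V' U' : Opens Y}
  (σ : O.obj V ≃ₐ[ℝ] O'.obj V') (τ : O.obj U ≃ₐ[ℝ] O'.obj U')

theorem conj_apply (D : Module.End ℝ (O.obj V)) (f : O'.obj V') :
    conj σ D f = σ (D (σ.symm f)) := rfl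

theorem conj_apply_map (D : Module.End ℝ (O.obj V)) (f : O.obj V) :
    conj σ D (σ f) = σ (D f) := by
  rw [conj_apply, AlgEquiv.symm_apply_apply]

theorem IsDerivation.conj (hσ : ∀ {d f}, f ∈ O.deg V d → σ f ∈ O'.deg V' d) {k : ℤ}
    {D : Module.End ℝ (O.obj V)} (hD : O.IsDerivation k D) :
    O'.IsDerivation k (conj σ D) := by
  have hσ' : ∀ {d f}, f ∈ O'.deg V' d → σ.symm f ∈ O.deg V d := fun {d f} hf =>
    mem_deg_of_map_mem σ.toAlgHom σ.injective hσ (by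
      change σ (σ.symm f) ∈ _
      rwa [AlgEquiv.apply_symm_apply])
  refine ⟨fun {m f} hf => hσ (hD.map_deg (hσ' hf)), fun {m f} hf g => ?_⟩
  rw [conj_apply, conj_apply, conj_apply, map_mul, hD.leibniz (hσ' hf), map_add, map_mul,
    Units.smul_def, Units.smul_def, map_zsmul, map_mul, AlgEquiv.apply_symm_apply,
    AlgEquiv.apply_symm_apply]

theorem res_conj (h : V ≤ U) (h' : V' ≤ U')
    (hστ : ∀ f, O'.res h' (τ f) = σ (O.res h f)) {D : Module.End ℝ (O.obj U)}
    {D' : Module.End ℝ (O.obj V)} (hD : ∀ f, O.res h (D f) = D' (O.res h f)) (f : O'.obj U') :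
    O'.res h' (conj τ D f) = conj σ D' (O'.res h' f) := by
  obtain ⟨g, rfl⟩ := τ.surjective f
  rw [conj_apply_map, hστ, hστ, conj_apply_map, hD]

theorem eq_zero_of_conj_eq_zero {D : Module.End ℝ (O.obj V)} (h : conj σ D = 0) : D = 0 := by
  refine LinearMap.ext fun f => σ.injective ?_
  rw [← conj_apply_map, h]
  exact (map_zero σ).symm

end conj

end GradedPresheaf

namespace Trivialization

open GradedPresheaf

variable {p : ℤ →₀ ℕ} {X : Type v} [TopologicalSpace X] {O : GradedPresheaf.{u} X}
  (φ : Trivialization p O)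

/-- The open subset of `Ṽ` that corresponds to the part of `W` in the trivialising open set. -/
def chartImage (W : Opens X) : Opens (Base p) :=
  ⟨φ.e.target ∩ φ.e.symm ⁻¹' W, φ.e.symm.isOpen_inter_preimage W.2⟩

theorem chartImage_le (W : Opens X) : φ.chartImage W ≤ image φ.e := fun _ hx => hx.1

theorem chartImage_mono {W W' : Opens X} (h : W ≤ W') : φ.chartImage W ≤ φ.chartImage W' :=
  fun _ hx => ⟨hx.1, h hx.2⟩

theorem mem_source_of_le {W : Opens X} (hW : W ≤ φ.domain) {x : X} (hx : x ∈ W) :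
    x ∈ φ.e.source := (hW hx).1

theorem le_preimage_chartImage {W : Opens X} (hW : W ≤ φ.domain) :
    W ≤ preimage φ.e (φ.chartImage W) := fun x hx =>
  have hs := φ.mem_source_of_le hW hx
  ⟨hs, φ.e.map_source hs, by
    change φ.e.symm (φ.e x) ∈ W
    rwa [φ.e.left_inv hs]⟩

theorem preimage_chartImage_le (W : Opens X) : preimage φ.e (φ.chartImage W) ≤ W :=
  fun x hx => by
    have h : φ.e.symm (φ.e x) ∈ W := hx.2.2
    rwa [φ.e.left_inv hx.1] at h

theorem eq_preimage_chartImage {W : Opens X} (hW : W ≤ φ.domain) :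
    W = preimage φ.e (φ.chartImage W) :=
  le_antisymm (φ.le_preimage_chartImage hW) (φ.preimage_chartImage_le W)

theorem chartImage_preimage_le (V : Opens (Base p)) : φ.chartImage (preimage φ.e V) ≤ V :=
  fun y hy => by
    have h : φ.e (φ.e.symm y) ∈ V := hy.2.2
    rwa [φ.e.right_inv hy.1] at h

theorem preimage_le_domain (V : φ.Target) : preimage φ.e V.1 ≤ φ.domain :=
  preimage_mono φ.e V.2

theorem preimage_le_of_le_chartImage {W : Opens X} {V : Opens (Base p)} (h : V ≤ φ.chartImage W) :
    preimage φ.e V ≤ W :=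
  (preimage_mono φ.e h).trans (φ.preimage_chartImage_le W)

/-- The sections over an open subset `W` of the trivialising open set, as formal power series over
the corresponding open subset of `ℝ^{p_0}`. -/
noncomputable def chartEquiv {W : Opens X} (hW : W ≤ φ.domain) :
    (model p).obj (φ.chartImage W) ≃ₐ[ℝ] O.obj W :=
  AlgEquiv.ofBijective
    ((O.res (φ.le_preimage_chartImage hW)).comp
      (φ.pullback ⟨φ.chartImage W, φ.chartImage_le W⟩))
    ((res_bijective_of_eq _ (φ.eq_preimage_chartImage hW)).comp (φ.bijective _))

theorem chartEquiv_apply {W : Opens X} (hW : W ≤ φ.domain) (f : (model p).obj (φ.chartImage W)) :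
    φ.chartEquiv hW f = O.res (φ.le_preimage_chartImage hW)
      (φ.pullback ⟨φ.chartImage W, φ.chartImage_le W⟩ f) := rfl

theorem chartEquiv_mem {W : Opens X} (hW : W ≤ φ.domain) {d : ℤ}
    {f : (model p).obj (φ.chartImage W)} (hf : f ∈ (model p).deg (φ.chartImage W) d) :
    φ.chartEquiv hW f ∈ O.deg W d :=
  O.res_mem (φ.le_preimage_chartImage hW) (φ.map_deg ⟨φ.chartImage W, φ.chartImage_le W⟩ hf)

theorem res_chartEquiv {W W' : Opens X} (hW : W ≤ φ.domain) (hW' : W' ≤ φ.domain) (h : W ≤ W')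
    (f : (model p).obj (φ.chartImage W')) :
    O.res h (φ.chartEquiv hW' f) =
      φ.chartEquiv hW ((model p).res (φ.chartImage_mono h) f) := by
  rw [chartEquiv_apply, chartEquiv_apply,
    ← φ.res_pullback ⟨_, φ.chartImage_le W⟩ ⟨_, φ.chartImage_le W'⟩, O.res_res, O.res_res]

theorem pullback_eq_chartEquiv (V : φ.Target) (f : (model p).obj V.1) :
    φ.pullback V f = φ.chartEquiv (φ.preimage_le_domain V)
      ((model p).res (φ.chartImage_preimage_le V.1) f) := by
  rw [chartEquiv_apply, ← φ.res_pullback ⟨_, φ.chartImage_le _⟩ V (φ.chartImage_preimage_le V.1),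
    O.res_res, O.res_self]

/-- The vector field on the trivialising open set that corresponds to one on `Ṽ`. -/
noncomputable def ofModel (E : (model p).Family (image φ.e)) : O.Family φ.domain := fun W =>
  conj (φ.chartEquiv W.2) (E ⟨φ.chartImage W.1, φ.chartImage_le W.1⟩)

theorem ofModel_mem {E : (model p).Family (image φ.e)} {k : ℤ}
    (hE : E ∈ (model p).vecDeg (image φ.e) k) : φ.ofModel E ∈ O.vecDeg φ.domain k :=
  ⟨fun W => (hE.1 ⟨φ.chartImage W.1, φ.chartImage_le W.1⟩).conj _ (φ.chartEquiv_mem W.2),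
    fun W W' h f => res_conj _ _ (φ.chartImage_mono h) h (φ.res_chartEquiv W'.2 W.2 h)
      (hE.2 ⟨φ.chartImage W.1, φ.chartImage_le W.1⟩ ⟨φ.chartImage W'.1, φ.chartImage_le W'.1⟩
        (φ.chartImage_mono h)) f⟩

theorem ofModel_pullback {E : (model p).Family (image φ.e)} {k : ℤ}
    (hE : E ∈ (model p).vecDeg (image φ.e) k) (V : φ.Target) (f : (model p).obj V.1) :
    φ.ofModel E ⟨preimage φ.e V.1, φ.preimage_le_domain V⟩ (φ.pullback V f) =
      φ.pullback V (E V f) := by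
  have h := hE.2 V ⟨φ.chartImage (preimage φ.e V.1), φ.chartImage_le _⟩
    (φ.chartImage_preimage_le V.1) f
  rw [pullback_eq_chartEquiv, pullback_eq_chartEquiv, h]
  exact conj_apply_map _ _ _

/-- The pullback over an open subset of `Ṽ` as an isomorphism of algebras. -/
noncomputable def pullbackEquiv (V : φ.Target) :
    (model p).obj V.1 ≃ₐ[ℝ] O.obj (preimage φ.e V.1) :=
  AlgEquiv.ofBijective (φ.pullback V) (φ.bijective V)

theorem pullbackEquiv_symm_mem (V : φ.Target) {d : ℤ} {f : O.obj (preimage φ.e V.1)}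
    (hf : f ∈ O.deg (preimage φ.e V.1) d) : (φ.pullbackEquiv V).symm f ∈ (model p).deg V.1 d :=
  mem_deg_of_map_mem (O' := O) (φ.pullback V) (φ.bijective V).1 (φ.map_deg V) (by
    change φ.pullbackEquiv V ((φ.pullbackEquiv V).symm f) ∈ _
    rwa [AlgEquiv.apply_symm_apply])

theorem res_pullbackEquiv_symm {V U : φ.Target} (h : V.1 ≤ U.1)
    (f : O.obj (preimage φ.e U.1)) :
    (model p).res h ((φ.pullbackEquiv U).symm f) =
      (φ.pullbackEquiv V).symm (O.res (preimage_mono φ.e h) f) := by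
  rw [AlgEquiv.eq_symm_apply]
  refine (φ.res_pullback V U h _).symm.trans ?_
  exact congrArg _ ((φ.pullbackEquiv U).apply_symm_apply f)

/-- The vector field on an open subset of `Ṽ` that corresponds to one on an open subset of the
trivialising open set. -/
noncomputable def toModel {W : Opens X} (D : O.Family W) : (model p).Family (φ.chartImage W) :=
  fun V => conj (φ.pullbackEquiv ⟨V.1, V.2.trans (φ.chartImage_le W)⟩).symm
    (D ⟨preimage φ.e V.1, φ.preimage_le_of_le_chartImage V.2⟩)

theorem toModel_mem {W : Opens X} {D : O.Family W} {k : ℤ} (hD : D ∈ O.vecDeg W k) :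
    φ.toModel D ∈ (model p).vecDeg (φ.chartImage W) k :=
  ⟨fun V => (hD.1 ⟨preimage φ.e V.1, φ.preimage_le_of_le_chartImage V.2⟩).conj _
      (φ.pullbackEquiv_symm_mem ⟨V.1, V.2.trans (φ.chartImage_le W)⟩),
    fun V V' h f => res_conj _ _ (preimage_mono φ.e h) h
      (φ.res_pullbackEquiv_symm (V := ⟨V'.1, V'.2.trans (φ.chartImage_le W)⟩)
        (U := ⟨V.1, V.2.trans (φ.chartImage_le W)⟩) h)
      (hD.2 ⟨preimage φ.e V.1, φ.preimage_le_of_le_chartImage V.2⟩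
        ⟨preimage φ.e V'.1, φ.preimage_le_of_le_chartImage V'.2⟩ (preimage_mono φ.e h)) f⟩

theorem eq_zero_of_toModel_eq_zero {W : Opens X} (hW : W ≤ φ.domain) {D : O.Family W}
    (h : φ.toModel D = 0) : D = 0 := by
  funext W'
  have h1 : D ⟨preimage φ.e (φ.chartImage W'.1),
      (φ.preimage_chartImage_le W'.1).trans W'.2⟩ = 0 :=
    eq_zero_of_conj_eq_zero _ (congrFun h ⟨φ.chartImage W'.1, φ.chartImage_mono W'.2⟩)
  have key : ∀ (W'' : Opens X) (h'' : W'' ≤ W), W'' = preimage φ.e (φ.chartImage W'.1) →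
      D ⟨W'', h''⟩ = 0 := by
    rintro _ h'' rfl
    exact h1
  exact key W'.1 W'.2 (φ.eq_preimage_chartImage (W'.2.trans hW))

/-- A vector field that kills the coordinates `x_i` and `w_a` is zero. Each homogeneous component
kills them too, because they are homogeneous, and `eq_zero_of_apply_coord` applies to its transport
to the domain. -/
theorem vec_eq_zero {W : Opens X} (hW : W ≤ φ.domain) {D : O.Vec W}
    (hx : ∀ i, app D (O.res hW (φ.smooth φ.top (Smooth.coord _ i))) = 0)
    (hw : ∀ a, app D (O.res hW (φ.pullback φ.top (modelGen _ a))) = 0) : D = 0 := by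
  obtain ⟨c, hc, hsum⟩ := exists_vec_components D
  refine Subtype.ext ?_
  rw [← hsum]
  refine Finset.sum_eq_zero fun k hk => φ.eq_zero_of_toModel_eq_zero hW ?_
  have hker : ∀ (m : ℤ) (f : (model p).obj φ.top.1), f ∈ (model p).deg _ m →
      app D (O.res hW (φ.pullback φ.top f)) = 0 →
      φ.toModel (c k) ⟨φ.chartImage W, le_rfl⟩ ((model p).res (φ.chartImage_le W) f) = 0 := by
    intro m f hf h0
    have h1 : c k ⟨W, le_rfl⟩ (O.res hW (φ.pullback φ.top f)) = 0 :=
      apply_eq_zero_of_sum (fun k _ => hc k) (O.res_mem _ (φ.map_deg _ hf))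
        (by rw [hsum]; exact h0) k hk
    have h2 : φ.pullbackEquiv ⟨φ.chartImage W, φ.chartImage_le W⟩
        ((model p).res (φ.chartImage_le W) f) =
        O.res (φ.preimage_chartImage_le W) (O.res hW (φ.pullback φ.top f)) :=
      (φ.res_pullback ⟨φ.chartImage W, φ.chartImage_le W⟩ φ.top (φ.chartImage_le W) f).symm.trans
        (O.res_res _ hW _).symm
    have h3 : (φ.pullbackEquiv ⟨φ.chartImage W, φ.chartImage_le W⟩).symm
        (O.res (φ.preimage_chartImage_le W) (O.res hW (φ.pullback φ.top f))) =
        (model p).res (φ.chartImage_le W) f := (AlgEquiv.symm_apply_eq _).2 h2.symm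
    have h4 : c k ⟨preimage φ.e (φ.chartImage W), φ.preimage_chartImage_le W⟩
        (O.res (φ.preimage_chartImage_le W) (O.res hW (φ.pullback φ.top f))) = 0 := by
      rw [← (hc k).2 ⟨W, le_rfl⟩, h1, map_zero]
    rw [← h3]
    refine (conj_apply_map _ _ _).trans ((congrArg _ h4).trans ?_)
    exact map_zero (φ.pullbackEquiv ⟨φ.chartImage W, φ.chartImage_le W⟩).symm
  refine eq_zero_of_apply_coord (φ.toModel_mem (hc k)) (fun i => ?_) fun a => ?_
  · exact (congrArg _ (model_res_ofSmooth (φ.chartImage_le W) _).symm).trans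
      (hker 0 _ (ofSmooth_mem _) (hx i))
  · exact (congrArg _ (model_res_gen (φ.chartImage_le W) a).symm).trans
      (hker _ _ (modelGen_mem _) (hw a))

end Trivialization
end Transport

/-! ### Dual frames -/

section Frames

universe u v

namespace GradedPresheaf

variable {X : Type v} [TopologicalSpace X] {O : GradedPresheaf.{u} X}

theorem app_sub {V : Opens X} (D D' : O.Vec V) (f : O.obj V) :
    app (D - D') f = app D f - app D' f := rfl

theorem app_add {V : Opens X} (D D' : O.Vec V) (f : O.obj V) :
    app (D + D') f = app D f + app D' f := rfl

theorem app_smul {V : Opens X} (g : O.obj V) (D : O.Vec V) (f : O.obj V) :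
    app (g • D) f = g * app D f :=
  congrArg (· * app D f) (O.res_self g)

theorem app_sum {V : Opens X} {ι : Type*} (s : Finset ι) (D : ι → O.Vec V) (f : O.obj V) :
    app (∑ i ∈ s, D i) f = ∑ i ∈ s, app (D i) f := by
  rw [app, Submodule.coe_sum, family_sum_apply]
  rfl

theorem app_map_sum {V : Opens X} {ι : Type*} (s : Finset ι) (D : O.Vec V) (f : ι → O.obj V) :
    app D (∑ i ∈ s, f i) = ∑ i ∈ s, app D (f i) :=
  map_sum (D.1 ⟨V, le_rfl⟩) _ _

theorem app_map_smul {V : Opens X} (D : O.Vec V) (c : ℝ) (f : O.obj V) :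
    app D (c • f) = c • app D f :=
  map_smul (D.1 ⟨V, le_rfl⟩) _ _

theorem app_res {V U : Opens X} (h : V ≤ U) (D : O.Vec U) (f : O.obj U) :
    app (vecRes h D) (O.res h f) = O.res h (app D f) := by
  have : D.1 ∈ ⨆ k, O.vecDeg U k := D.2
  change D.1 ⟨V, h⟩ (O.res h f) = O.res h (D.1 ⟨U, le_rfl⟩ f)
  refine Submodule.iSup_induction (motive := fun T : O.Family U =>
    T ⟨V, h⟩ (O.res h f) = O.res h (T ⟨U, le_rfl⟩ f)) _ this
    (fun k T hT => ?_) ?_ fun T T' hT hT' => ?_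
  · exact (hT.2 ⟨U, le_rfl⟩ ⟨V, h⟩ h f).symm
  · exact (map_zero (O.res h)).symm
  · exact (congrArg₂ (· + ·) hT hT').trans (map_add (O.res h) _ _).symm

theorem vecRes_smul {V U : Opens X} (h : V ≤ U) (f : O.obj U) (D : O.Vec U) :
    vecRes h (f • D) = O.res h f • vecRes h D :=
  Subtype.ext <| funext fun V' =>
    congrArg (· • D.1 ⟨V'.1, V'.2.trans h⟩) (O.res_res V'.2 h f).symm

theorem vecRes_add {V U : Opens X} (h : V ≤ U) (D D' : O.Vec U) :
    vecRes h (D + D') = vecRes h D + vecRes h D' := rfl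

theorem vecRes_sum {V U : Opens X} (h : V ≤ U) {ι : Type*} (s : Finset ι) (D : ι → O.Vec U) :
    vecRes h (∑ i ∈ s, D i) = ∑ i ∈ s, vecRes h (D i) :=
  map_sum (AddMonoidHom.mk' (vecRes h) (vecRes_add h)) D s

theorem vecRes_vecRes {W V U : Opens X} (h : W ≤ V) (h' : V ≤ U) (D : O.Vec U) :
    vecRes h (vecRes h' D) = vecRes (h.trans h') D := rfl

theorem IsGraded.vecRes {V U : Opens X} (h : V ≤ U) {D : O.Vec U} {k : ℤ} (hD : IsGraded D k) :
    IsGraded (vecRes h D) k :=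
  Family.res_mem_vecDeg h hD

theorem IsGraded.smul {V : Opens X} {D : O.Vec V} {d k : ℤ} {f : O.obj V} (hf : f ∈ O.deg V d)
    (hD : IsGraded D k) : IsGraded (f • D) (d + k) :=
  O.smul_mem_vecDeg hf hD

theorem IsGraded.sum {V : Opens X} {ι : Type*} {s : Finset ι} {D : ι → O.Vec V} {k : ℤ}
    (hD : ∀ i ∈ s, IsGraded (D i) k) : IsGraded (∑ i ∈ s, D i) k := by
  rw [IsGraded, Submodule.coe_sum]
  exact Submodule.sum_mem _ hD

/-- Vector fields `F a` dual to sections `z a`, provided that a vector field that kills all `z a`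
over some open subset is zero there. -/
structure IsDualFrame {V : Opens X} {γ : Type*} [DecidableEq γ] (z : γ → O.obj V)
    (F : γ → O.Vec V) : Prop where
  graded : ∀ a, ∃ k, IsGraded (F a) k
  app_eq : ∀ a b, app (F a) (z b) = if a = b then 1 else 0
  separating : ∀ (V' : Opens X) (h : V' ≤ V) (D : O.Vec V'),
    (∀ a, app D (O.res h (z a)) = 0) → D = 0

namespace IsDualFrame

variable {V : Opens X} {γ : Type*} [DecidableEq γ] {z : γ → O.obj V} {F : γ → O.Vec V}

theorem app_sum_smul [Fintype γ] (hF : IsDualFrame z F) {V' : Opens X} (h : V' ≤ V)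
    (f : γ → O.obj V') (b : γ) :
    app (∑ a, f a • vecRes h (F a)) (O.res h (z b)) = f b := by
  rw [app_sum]
  have e : ∀ a, app (f a • vecRes h (F a)) (O.res h (z b)) = if a = b then f a else 0 := fun a => by
    rw [app_smul, app_res, hF.app_eq]
    split_ifs <;> simp
  rw [Finset.sum_congr rfl fun a _ => e a, Finset.sum_ite_eq', if_pos (Finset.mem_univ b)]

theorem ext (hF : IsDualFrame z F) {V' : Opens X} (h : V' ≤ V) {D D' : O.Vec V'}
    (hD : ∀ a, app D (O.res h (z a)) = app D' (O.res h (z a))) : D = D' := by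
  rw [← sub_eq_zero]
  refine hF.separating V' h _ fun a => ?_
  rw [app_sub, hD, sub_self]

/-- The coefficients of a vector field in a dual frame are its values on the coordinates. -/
theorem eq_sum_iff [Fintype γ] (hF : IsDualFrame z F) {V' : Opens X} (h : V' ≤ V) (D : O.Vec V')
    (f : γ → O.obj V') :
    D = ∑ a, f a • vecRes h (F a) ↔ ∀ a, f a = app D (O.res h (z a)) := by
  refine ⟨?_, fun hf => hF.ext h fun a => ?_⟩
  · rintro rfl a
    rw [hF.app_sum_smul]
  · rw [hF.app_sum_smul, hf]

theorem eq_sum [Fintype γ] (hF : IsDualFrame z F) {V' : Opens X} (h : V' ≤ V) (D : O.Vec V') :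
    D = ∑ a, app D (O.res h (z a)) • vecRes h (F a) :=
  (hF.eq_sum_iff h D _).2 fun _ => rfl

theorem isFrame [Fintype γ] (hF : IsDualFrame z F) : IsFrame F where
  graded := hF.graded
  linearIndependent V' h := by
    rw [Fintype.linearIndependent_iff]
    intro f hf a
    rw [((hF.eq_sum_iff h 0 f).1 hf.symm) a]
    rfl
  span_eq_top V' h := by
    rw [eq_top_iff]
    rintro D -
    rw [hF.eq_sum h D]
    exact Submodule.sum_mem _ fun a _ => Submodule.smul_mem _ _ (Submodule.subset_span ⟨a, rfl⟩)

end IsDualFrame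

theorem IsFrame.vecIsFreeOn {V : Opens X} {γ : Type*} [Fintype γ] {F : γ → O.Vec V}
    (hF : IsFrame F) : O.VecIsFreeOn V := by
  refine ⟨Fintype.card γ, F ∘ (Fintype.equivFin γ).symm, fun a => hF.graded _, fun V' h => ?_,
    fun V' h => ?_⟩
  · exact (hF.linearIndependent V' h).comp _ (Fintype.equivFin γ).symm.injective
  · have e : (Set.range fun a => vecRes h ((F ∘ (Fintype.equivFin γ).symm) a)) =
        Set.range fun a => vecRes h (F a) :=
      (Fintype.equivFin γ).symm.surjective.range_comp fun a => vecRes h (F a)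
    rw [e, hF.span_eq_top V' h]

end GradedPresheaf

namespace Trivialization

open GradedPresheaf

variable {p : ℤ →₀ ℕ} {X : Type v} [TopologicalSpace X] {O : GradedPresheaf.{u} X}
  (φ : Trivialization p O)

/-- The vector field `∂/∂x_i` of the standard coordinates on the trivialising open set. -/
noncomputable def stdDir (i : Fin (p 0)) : O.Vec φ.domain :=
  ⟨φ.ofModel (dirFamily _ (EuclideanSpace.single i 1)),
    Submodule.mem_iSup_of_mem 0 (φ.ofModel_mem (dirFamily_mem _ _))⟩

/-- The vector field `∂/∂w_a` of the standard generators on the trivialising open set. -/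
noncomputable def stdGen (a : Gen p) : O.Vec φ.domain :=
  ⟨φ.ofModel (genFamily _ a),
    Submodule.mem_iSup_of_mem (-a.deg) (φ.ofModel_mem (genFamily_mem _ _))⟩

theorem isGraded_stdDir (i : Fin (p 0)) : IsGraded (φ.stdDir i) 0 :=
  φ.ofModel_mem (dirFamily_mem _ _)

theorem isGraded_stdGen (a : Gen p) : IsGraded (φ.stdGen a) (-a.deg) :=
  φ.ofModel_mem (genFamily_mem _ _)

theorem smooth_mem (V : φ.Target) (h : Smooth p V.1) :
    φ.smooth V h ∈ O.deg (preimage φ.e V.1) 0 :=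
  φ.map_deg V (ofSmooth_mem h)

theorem smooth_mul (V : φ.Target) (f g : Smooth p V.1) :
    φ.smooth V (f * g) = φ.smooth V f * φ.smooth V g := by
  rw [smooth, ofSmooth_mul, map_mul]
  rfl

theorem smooth_sum (V : φ.Target) {ι : Type*} (s : Finset ι) (f : ι → Smooth p V.1) :
    φ.smooth V (∑ i ∈ s, f i) = ∑ i ∈ s, φ.smooth V (f i) := by
  rw [smooth, ofSmooth_sum, map_sum]
  rfl

theorem smooth_one (V : φ.Target) : φ.smooth V 1 = 1 :=
  (congrArg (φ.pullback V) (map_one (algebraMap (Smooth p V.1) (Series p (Smooth p V.1))))).trans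
    (map_one (φ.pullback V))

theorem smooth_zero (V : φ.Target) : φ.smooth V 0 = 0 :=
  (congrArg (φ.pullback V) (map_zero (algebraMap (Smooth p V.1) (Series p (Smooth p V.1))))).trans
    (map_zero (φ.pullback V))

theorem res_smooth {V U : φ.Target} (h : V.1 ≤ U.1) (f : Smooth p U.1) :
    O.res (preimage_mono φ.e h) (φ.smooth U f) = φ.smooth V (Smooth.res h f) :=
  (φ.res_pullback V U h _).trans (congrArg _ (model_res_ofSmooth h f))

theorem gen_eq_sum (V : φ.Target) (v : GenSpace p) :
    φ.gen V v = ∑ a, v a • φ.pullback V (modelGen V.1 a) := by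
  rw [gen, ofGen_eq_sum, map_sum]
  exact Finset.sum_congr rfl fun a _ => map_smul (φ.pullback V) _ _

theorem stdDir_smooth (V : φ.Target) (i : Fin (p 0)) (h : Smooth p V.1) :
    app (vecRes (φ.preimage_le_domain V) (φ.stdDir i)) (φ.smooth V h) =
      φ.smooth V (Smooth.dir V.1 (EuclideanSpace.single i 1) h) :=
  (φ.ofModel_pullback (dirFamily_mem _ _) V _).trans
    (congrArg (φ.pullback V) (Series.mapDerivation_algebraMap _ _))

theorem stdDir_modelGen (V : φ.Target) (i : Fin (p 0)) (a : Gen p) :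
    app (vecRes (φ.preimage_le_domain V) (φ.stdDir i)) (φ.pullback V (modelGen V.1 a)) = 0 :=
  (φ.ofModel_pullback (dirFamily_mem _ _) V _).trans
    ((congrArg (φ.pullback V) (Series.mapDerivation_gen _ _)).trans (map_zero (φ.pullback V)))

theorem stdGen_smooth (V : φ.Target) (a : Gen p) (h : Smooth p V.1) :
    app (vecRes (φ.preimage_le_domain V) (φ.stdGen a)) (φ.smooth V h) = 0 :=
  (φ.ofModel_pullback (genFamily_mem _ _) V _).trans
    ((congrArg (φ.pullback V) (Series.pderiv_algebraMap (k := ℝ) a h)).trans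
      (map_zero (φ.pullback V)))

theorem stdGen_modelGen (V : φ.Target) (a b : Gen p) :
    app (vecRes (φ.preimage_le_domain V) (φ.stdGen a)) (φ.pullback V (modelGen V.1 b)) =
      if a = b then 1 else 0 := by
  refine (φ.ofModel_pullback (genFamily_mem _ _) V _).trans
    ((congrArg (φ.pullback V) (Series.pderiv_gen (k := ℝ) (R := Smooth p V.1) a b)).trans ?_)
  split_ifs
  · exact map_one (φ.pullback V)
  · exact map_zero (φ.pullback V)

theorem stdDir_gen (V : φ.Target) (i : Fin (p 0)) (v : GenSpace p) :
    app (vecRes (φ.preimage_le_domain V) (φ.stdDir i)) (φ.gen V v) = 0 := by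
  rw [gen_eq_sum, app_map_sum]
  refine Finset.sum_eq_zero fun a _ => ?_
  rw [app_map_smul, stdDir_modelGen, smul_zero]

theorem stdGen_gen (V : φ.Target) (a : Gen p) (v : GenSpace p) :
    app (vecRes (φ.preimage_le_domain V) (φ.stdGen a)) (φ.gen V v) =
      v a • (1 : O.obj (preimage φ.e V.1)) := by
  rw [gen_eq_sum, app_map_sum, Finset.sum_eq_single a]
  · rw [app_map_smul, stdGen_modelGen, if_pos rfl]
  · intro b _ hb
    rw [app_map_smul, stdGen_modelGen, if_neg (Ne.symm hb), smul_zero]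
  · simp

/-- The standard coordinates `x_i` and `w_a` on the trivialising open set. -/
noncomputable def stdCoord : Fin (p 0) ⊕ Gen p → O.obj φ.domain :=
  Sum.elim (fun i => φ.smooth φ.top (Smooth.coord _ i)) fun a => φ.pullback φ.top (modelGen _ a)

/-- The standard coordinate vector fields on the trivialising open set. -/
noncomputable def stdFrame : Fin (p 0) ⊕ Gen p → O.Vec φ.domain :=
  Sum.elim φ.stdDir φ.stdGen

theorem isDualFrame_std : IsDualFrame φ.stdCoord φ.stdFrame where
  graded a := by
    rcases a with i | a
    · exact ⟨0, φ.isGraded_stdDir i⟩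
    · exact ⟨-a.deg, φ.isGraded_stdGen a⟩
  app_eq a b := by
    rcases a with i | a <;> rcases b with j | b
    · refine (φ.stdDir_smooth φ.top i _).trans ?_
      rw [Smooth.dir_coord]
      by_cases h : i = j
      · rw [if_pos h, if_pos (congrArg _ h)]
        exact φ.smooth_one φ.top
      · rw [if_neg h, if_neg fun h' => h (Sum.inl_injective h')]
        exact φ.smooth_zero φ.top
    · exact (φ.stdDir_modelGen φ.top i b).trans (if_neg Sum.inl_ne_inr).symm
    · exact (φ.stdGen_smooth φ.top a _).trans (if_neg Sum.inr_ne_inl).symm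
    · refine (φ.stdGen_modelGen φ.top a b).trans ?_
      by_cases h : a = b
      · rw [if_pos h, if_pos (congrArg _ h)]
        rfl
      · rw [if_neg h, if_neg fun h' => h (Sum.inr_injective h')]
        rfl
  separating V' h D hD := φ.vec_eq_zero h (fun i => hD (Sum.inl i)) fun a => hD (Sum.inr a)

end Trivialization
end Frames

/-! ### General coordinate systems -/

section Coordinates

universe u v

variable {p : ℤ →₀ ℕ}

theorem contDiffOn_of_mem_contDiffGroupoid {E : Type*} [NormedAddCommGroup E] [NormedSpace ℝ E]
    {c : OpenPartialHomeomorph E E} (hc : c ∈ contDiffGroupoid ∞ 𝓘(ℝ, E)) :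
    ContDiffOn ℝ ∞ c c.source ∧ ContDiffOn ℝ ∞ c.symm c.target := by
  rw [contDiffGroupoid, mem_groupoid_of_pregroupoid] at hc
  simpa [contDiffPregroupoid] using hc

theorem euclidean_sum_single {n : ℕ} (v : EuclideanSpace ℝ (Fin n)) :
    v = ∑ l, v l • EuclideanSpace.single l (1 : ℝ) := by
  conv_lhs => rw [← (EuclideanSpace.basisFun (Fin n) ℝ).sum_repr v]
  simp

/-- The Jacobian matrix of a system of functions. The entry `(l, j)` is `∂t_j/∂x_l`, so that the
matrix acts from the left on columns of coordinate vector fields. -/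
noncomputable def jacobian {U : Opens (Base p)} (t : Fin (p 0) → Smooth p U) :
    Matrix (Fin (p 0)) (Fin (p 0)) (Smooth p U) :=
  Matrix.of fun l j => Smooth.dir U (EuclideanSpace.single l 1) (t j)

/-- The Jacobian matrix of a coordinate system is invertible; its inverse is the Jacobian matrix of
the inverse diffeomorphism. -/
theorem exists_mul_jacobian_eq_one {U : Opens (Base p)} {t : Fin (p 0) → Smooth p U}
    (ht : IsCoordinateSystem U t) :
    ∃ A : Matrix (Fin (p 0)) (Fin (p 0)) (Smooth p U), A * jacobian t = 1 := by
  obtain ⟨c, hc, hU, htc⟩ := ht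
  obtain ⟨h1, h2⟩ := contDiffOn_of_mem_contDiffGroupoid hc
  have hmem : ∀ x ∈ U, x ∈ c.source := fun x hx => by rw [hU]; exact hx
  have hc1 : ∀ x ∈ U, ContDiffAt ℝ ∞ c x := fun x hx =>
    h1.contDiffAt (c.open_source.mem_nhds (hmem x hx))
  have hc2 : ∀ x ∈ U, ContDiffAt ℝ ∞ c.symm (c x) := fun x hx =>
    h2.contDiffAt (c.open_target.mem_nhds (c.map_source (hmem x hx)))
  let A : Matrix (Fin (p 0)) (Fin (p 0)) (Smooth p U) := Matrix.of fun i l =>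
    Smooth.ofContDiffAt U (fun x => fderiv ℝ c.symm (c x) (EuclideanSpace.single i 1) l)
      fun x hx => ((EuclideanSpace.proj l : Base p →L[ℝ] ℝ).contDiff.contDiffAt).comp x
        ((((hc2 x hx).fderiv_right (m := ∞) le_rfl).comp x (hc1 x hx)).clm_apply contDiffAt_const)
  refine ⟨A, ?_⟩
  ext i j x
  have hsum : (A * jacobian t) i j x = ∑ l, A i l x * jacobian t l j x := by
    rw [Matrix.mul_apply]
    exact map_sum (ContMDiffMap.evalRingHom (I := 𝓘(ℝ, Base p)) (n := ∞) (R := ℝ) x) _ _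
  have hd1 : HasFDerivAt c (fderiv ℝ c x) x :=
    ((hc1 x x.2).differentiableAt (by simp)).hasFDerivAt
  have hd2 : HasFDerivAt c.symm (fderiv ℝ c.symm (c x)) (c x) :=
    ((hc2 x x.2).differentiableAt (by simp)).hasFDerivAt
  have hJ : ∀ l, jacobian t l j x = fderiv ℝ c x (EuclideanSpace.single l 1) j := fun l => by
    have e : zeroExt U (t j) =ᶠ[nhds (x : Base p)] fun y => c y j :=
      zeroExt_eventuallyEq U _ x.2 fun y => htc j y
    have hd : HasFDerivAt (fun y => c y j)
        ((EuclideanSpace.proj j : Base p →L[ℝ] ℝ).comp (fderiv ℝ c x)) (x : Base p) :=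
      (EuclideanSpace.proj j : Base p →L[ℝ] ℝ).hasFDerivAt.comp (x : Base p) hd1
    change fderiv ℝ (zeroExt U (t j)) x _ = _
    rw [e.fderiv_eq, hd.fderiv]
    rfl
  -- the derivative of `c ∘ c⁻¹ = id`
  have hcomp : ∀ v, fderiv ℝ c x (fderiv ℝ c.symm (c x) v) = v := fun v => by
    have hd1' : HasFDerivAt c (fderiv ℝ c x) (c.symm (c x)) := by
      rwa [c.left_inv (hmem x x.2)]
    have hid : HasFDerivAt (c ∘ c.symm) (ContinuousLinearMap.id ℝ (Base p)) (c x) :=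
      (hasFDerivAt_id _).congr_of_eventuallyEq
        (c.eventually_right_inverse (c.map_source (hmem x x.2)))
    exact DFunLike.congr_fun ((hd1'.comp (c x) hd2).unique hid) v
  have hfin : (∑ l, A i l x * jacobian t l j x) =
      fderiv ℝ c x (fderiv ℝ c.symm (c x) (EuclideanSpace.single i 1)) j := by
    conv_rhs => rw [euclidean_sum_single (fderiv ℝ c.symm (c x) (EuclideanSpace.single i 1))]
    rw [map_sum]
    have : ∀ s : Fin (p 0) → Base p, (∑ l, s l) j = ∑ l, s l j := fun s =>
      map_sum (EuclideanSpace.proj j : Base p →L[ℝ] ℝ) _ _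
    rw [this]
    refine Finset.sum_congr rfl fun l _ => ?_
    rw [hJ, map_smul]
    rfl
  rw [hsum, hfin, hcomp]
  by_cases h : i = j
  · subst h
    rw [Matrix.one_apply_eq]
    simp
  · rw [Matrix.one_apply_ne h]
    simp [Ne.symm h]

theorem single_mem_deg (a : Gen p) : (Pi.single a 1 : GenSpace p) ∈ GenSpace.deg p a.deg := by
  classical
  intro b hb
  by_cases h : b = a
  · rw [h]
  · exact absurd (Pi.single_eq_of_ne h _) hb

/-- A homogeneous vector is a combination of basis vectors of its own degree. -/
theorem IsGradedBasis.repr_eq_zero {κ : Type*} [Fintype κ] {w : Module.Basis κ ℝ (GenSpace p)}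
    {d : κ → ℤ} (hw : IsGradedBasis w d) {j : ℤ} {v : GenSpace p} (hv : v ∈ GenSpace.deg p j)
    {α : κ} (hα : d α ≠ j) : w.repr v α = 0 := by
  classical
  have h0 : ∑ β, (if d β ≠ j then w.repr v β else 0) • w β = 0 := by
    funext b
    refine (Finset.sum_apply b _ _).trans ?_
    by_cases hb : b.deg = j
    · refine Finset.sum_eq_zero fun β _ => ?_
      by_cases hβ : d β = j
      · simp [hβ]
      · have : w β b = 0 := by
          by_contra hne
          exact hβ ((hw β b hne).symm.trans hb)
        simp [this]
    · have hvb : v b = 0 := by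
        by_contra hne
        exact hb (hv b hne)
      have e := (Finset.sum_apply b Finset.univ fun β => w.repr v β • w β).symm.trans
        (congrFun (w.sum_repr v) b)
      refine Eq.trans ?_ (e.trans hvb)
      refine Finset.sum_congr rfl fun β _ => ?_
      by_cases hβ : d β = j
      · have : w β b = 0 := by
          by_contra hne
          exact hb ((hw β b hne).trans hβ)
        simp [this]
      · simp [hβ]
  have h1 := Fintype.linearIndependent_iff.1 w.linearIndependent _ h0 α
  rwa [if_pos hα] at h1

namespace Trivialization

open GradedPresheaf

variable {X : Type v} [TopologicalSpace X] {O : GradedPresheaf.{u} X} (φ : Trivialization p O)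

/-- A smooth function on `Ṽ` as a section over the trivialising open set. -/
noncomputable def topSmooth (h : Smooth p (image φ.e)) : O.obj φ.domain := φ.smooth φ.top h

/-- An element of `W` as a section over the trivialising open set. -/
noncomputable def topGen (v : GenSpace p) : O.obj φ.domain := φ.gen φ.top v

theorem topSmooth_mul (f g : Smooth p (image φ.e)) :
    φ.topSmooth (f * g) = φ.topSmooth f * φ.topSmooth g := φ.smooth_mul φ.top f g

theorem topSmooth_sum {ι : Type*} (s : Finset ι) (f : ι → Smooth p (image φ.e)) :
    φ.topSmooth (∑ i ∈ s, f i) = ∑ i ∈ s, φ.topSmooth (f i) := φ.smooth_sum φ.top s f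

theorem topSmooth_matrix_one {n : Type*} [DecidableEq n] (i j : n) :
    φ.topSmooth ((1 : Matrix n n (Smooth p (image φ.e))) i j) = if i = j then 1 else 0 := by
  by_cases h : i = j
  · subst h
    rw [Matrix.one_apply_eq, if_pos rfl]
    exact φ.smooth_one φ.top
  · rw [Matrix.one_apply_ne h, if_neg h]
    exact φ.smooth_zero φ.top

theorem gen_sum_smul (V : φ.Target) {ι : Type*} (s : Finset ι) (c : ι → ℝ) (v : ι → GenSpace p) :
    φ.gen V (∑ i ∈ s, c i • v i) = ∑ i ∈ s, c i • φ.gen V (v i) := by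
  simp only [gen_eq_sum, Finset.smul_sum, smul_smul]
  rw [Finset.sum_comm]
  refine Finset.sum_congr rfl fun a _ => ?_
  rw [← Finset.sum_smul, Finset.sum_apply]
  rfl

theorem gen_single (V : φ.Target) (a : Gen p) :
    φ.gen V (Pi.single a 1) = φ.pullback V (modelGen V.1 a) := by
  rw [gen_eq_sum, Finset.sum_eq_single a]
  · rw [Pi.single_eq_same, one_smul]
  · intro b _ hb
    rw [Pi.single_eq_of_ne hb, zero_smul]
  · simp

/-- The coordinates `(t_i, w_α)` on the trivialising open set. -/
noncomputable def coord {κ : Type*} (t : Fin (p 0) → Smooth p (image φ.e)) (w : κ → GenSpace p) :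
    Fin (p 0) ⊕ κ → O.obj φ.domain :=
  Sum.elim (fun i => φ.topSmooth (t i)) fun α => φ.topGen (w α)

/-- The coordinate vector fields of `(t_i, w_α)`: the standard ones, transformed by the inverse `A`
of the Jacobian matrix and by the inverse of the base change matrix of `w`. -/
noncomputable def coordFrame {κ : Type*} (A : Matrix (Fin (p 0)) (Fin (p 0)) (Smooth p (image φ.e)))
    (w : Module.Basis κ ℝ (GenSpace p)) : Fin (p 0) ⊕ κ → O.Vec φ.domain :=
  Sum.elim
    (fun i => ∑ l, φ.topSmooth (A i l) • φ.stdDir l)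
    fun α => ∑ a, algebraMap ℝ (O.obj φ.domain) (w.repr (Pi.single a 1) α) • φ.stdGen a

theorem topSmooth_mem (h : Smooth p (image φ.e)) : φ.topSmooth h ∈ O.deg φ.domain 0 :=
  φ.smooth_mem φ.top h

theorem coordFrame_inl {κ : Type*} (A : Matrix (Fin (p 0)) (Fin (p 0)) (Smooth p (image φ.e)))
    (w : Module.Basis κ ℝ (GenSpace p)) (i : Fin (p 0)) :
    φ.coordFrame A w (Sum.inl i) = ∑ l, φ.topSmooth (A i l) • φ.stdDir l := rfl

theorem coordFrame_inr {κ : Type*} (A : Matrix (Fin (p 0)) (Fin (p 0)) (Smooth p (image φ.e)))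
    (w : Module.Basis κ ℝ (GenSpace p)) (α : κ) :
    φ.coordFrame A w (Sum.inr α) =
      ∑ a, algebraMap ℝ (O.obj φ.domain) (w.repr (Pi.single a 1) α) • φ.stdGen a := rfl

theorem isGraded_coordFrame_inl {κ : Type*}
    (A : Matrix (Fin (p 0)) (Fin (p 0)) (Smooth p (image φ.e)))
    (w : Module.Basis κ ℝ (GenSpace p)) (i : Fin (p 0)) :
    IsGraded (φ.coordFrame A w (Sum.inl i)) 0 := by
  rw [coordFrame_inl]
  refine IsGraded.sum fun l _ => ?_
  have := IsGraded.smul (φ.topSmooth_mem (A i l)) (φ.isGraded_stdDir l)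
  rwa [zero_add] at this

theorem isGraded_coordFrame_inr {κ : Type*} [Fintype κ]
    (A : Matrix (Fin (p 0)) (Fin (p 0)) (Smooth p (image φ.e)))
    {w : Module.Basis κ ℝ (GenSpace p)} {d : κ → ℤ} (hw : IsGradedBasis w d) (α : κ) :
    IsGraded (φ.coordFrame A w (Sum.inr α)) (-d α) := by
  refine IsGraded.sum fun a _ => ?_
  by_cases h : d α = a.deg
  · have h1 : algebraMap ℝ (O.obj φ.domain) (w.repr (Pi.single a 1) α) ∈ O.deg φ.domain 0 := by
      rw [Algebra.algebraMap_eq_smul_one]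
      exact Submodule.smul_mem _ _ (O.gradedMonoid φ.domain).one_mem
    have := IsGraded.smul h1 (φ.isGraded_stdGen a)
    rwa [zero_add, ← h] at this
  · rw [hw.repr_eq_zero (single_mem_deg a) h, map_zero, zero_smul]
    exact Submodule.zero_mem _

theorem stdDir_smooth_top (i : Fin (p 0)) (h : Smooth p (image φ.e)) :
    app (φ.stdDir i) (φ.topSmooth h) =
      φ.topSmooth (Smooth.dir _ (EuclideanSpace.single i 1) h) :=
  φ.stdDir_smooth φ.top i h

theorem stdDir_gen_top (i : Fin (p 0)) (v : GenSpace p) :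
    app (φ.stdDir i) (φ.topGen v) = 0 :=
  φ.stdDir_gen φ.top i v

theorem stdGen_smooth_top (a : Gen p) (h : Smooth p (image φ.e)) :
    app (φ.stdGen a) (φ.topSmooth h) = 0 :=
  φ.stdGen_smooth φ.top a h

theorem stdGen_gen_top (a : Gen p) (v : GenSpace p) :
    app (φ.stdGen a) (φ.topGen v) = v a • (1 : O.obj φ.domain) :=
  φ.stdGen_gen φ.top a v

/-- The coordinate vector fields of `(t_i, w_α)` are dual to the coordinates. They separate: a field
that kills the `w_α` kills the `w_a` and is a combination of the `∂/∂x_l`, with coefficients `f_l`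
that satisfy `∑ f_l ∂t_j/∂x_l = 0` for all `j`; so `f = 0` as the Jacobian matrix is invertible. -/
theorem isDualFrame_coord {t : Fin (p 0) → Smooth p (image φ.e)}
    {A : Matrix (Fin (p 0)) (Fin (p 0)) (Smooth p (image φ.e))} (hA : A * jacobian t = 1)
    {κ : Type*} [Fintype κ] [DecidableEq κ] {w : Module.Basis κ ℝ (GenSpace p)} {d : κ → ℤ}
    (hw : IsGradedBasis w d) : IsDualFrame (φ.coord t w) (φ.coordFrame A w) where
  graded a := by
    rcases a with i | α
    · exact ⟨0, φ.isGraded_coordFrame_inl A w i⟩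
    · exact ⟨-d α, φ.isGraded_coordFrame_inr A hw α⟩
  app_eq a b := by
    rcases a with i | α <;> rcases b with j | β
    · have e : ∀ l, app (φ.topSmooth (A i l) • φ.stdDir l) (φ.topSmooth (t j)) =
          φ.topSmooth (A i l * jacobian t l j) := fun l => by
        rw [app_smul, stdDir_smooth_top, topSmooth_mul]
        rfl
      rw [coordFrame_inl, app_sum]
      simp only [Sum.inl.injEq]
      rw [← φ.topSmooth_matrix_one, ← hA, Matrix.mul_apply, topSmooth_sum]
      exact Finset.sum_congr rfl fun l _ => e l
    · rw [if_neg Sum.inl_ne_inr, coordFrame_inl, app_sum]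
      refine Finset.sum_eq_zero fun l _ => ?_
      rw [app_smul]
      exact (congrArg (_ * ·) (φ.stdDir_gen_top l (w β))).trans (mul_zero _)
    · rw [if_neg Sum.inr_ne_inl, coordFrame_inr, app_sum]
      refine Finset.sum_eq_zero fun l _ => ?_
      rw [app_smul]
      exact (congrArg (_ * ·) (φ.stdGen_smooth_top l (t j))).trans (mul_zero _)
    · rw [coordFrame_inr, app_sum]
      have e : ∀ a, app (algebraMap ℝ (O.obj φ.domain) (w.repr (Pi.single a 1) α) • φ.stdGen a)
          (φ.coord t w (Sum.inr β)) =
          algebraMap ℝ (O.obj φ.domain) (w β a * w.repr (Pi.single a 1) α) := fun a => by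
        rw [app_smul]
        refine (congrArg (_ * ·) (φ.stdGen_gen_top a (w β))).trans ?_
        rw [← Algebra.algebraMap_eq_smul_one, ← map_mul, mul_comm]
      have e2 : ∑ a, w β a * w.repr (Pi.single a 1) α = w.repr (w β) α := by
        conv_rhs => rw [← (Pi.basisFun ℝ (Gen p)).sum_repr (w β)]
        simp [Finsupp.finsetSum_apply]
      rw [Finset.sum_congr rfl fun a _ => e a, ← map_sum, e2, w.repr_self, Finsupp.single_apply]
      by_cases h : α = β
      · subst h; simp
      · simp [h, Ne.symm h]
  separating V' h D hD := by
    -- each `w_a` is a real combination of the `w_α`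
    have hgen : ∀ a, app D (O.res h (φ.stdCoord (Sum.inr a))) = 0 := by
      intro a
      have e : φ.stdCoord (Sum.inr a) =
          ∑ α, w.repr (Pi.single a 1) α • φ.coord t w (Sum.inr α) := by
        refine (φ.gen_single φ.top a).symm.trans ?_
        conv_lhs => rw [← w.sum_repr (Pi.single a 1)]
        exact φ.gen_sum_smul φ.top _ _ _
      rw [e, map_sum, app_map_sum]
      refine Finset.sum_eq_zero fun α _ => ?_
      rw [map_smul, app_map_smul, hD, smul_zero]
    have hexp := φ.isDualFrame_std.eq_sum h D
    rw [Fintype.sum_sum_type, Finset.sum_eq_zero (s := (Finset.univ : Finset (Gen p)))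
      fun a _ => by rw [hgen a, zero_smul], add_zero] at hexp
    let f : Fin (p 0) → O.obj V' := fun l => app D (O.res h (φ.stdCoord (Sum.inl l)))
    have hJ : ∀ j, ∑ l, f l * O.res h (φ.topSmooth (jacobian t l j)) = 0 := fun j => by
      have h1 := hD (Sum.inl j)
      rw [hexp, app_sum] at h1
      rw [← h1]
      refine Finset.sum_congr rfl fun l _ => ?_
      rw [app_smul, app_res]
      exact congrArg (fun g => f l * O.res h g) (φ.stdDir_smooth_top l (t j)).symm
    -- multiply by `A` from the right
    have hA' : jacobian t * A = 1 := mul_eq_one_comm.1 hA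
    have hf0 : ∀ m, f m = 0 := fun m => by
      have e1 : ∑ l, f l * O.res h (φ.topSmooth ((jacobian t * A) l m)) = f m := by
        rw [hA', Finset.sum_eq_single m]
        · rw [topSmooth_matrix_one, if_pos rfl, map_one, mul_one]
        · intro l _ hl
          rw [topSmooth_matrix_one, if_neg hl, map_zero, mul_zero]
        · simp
      rw [← e1]
      have e2 : ∀ l, f l * O.res h (φ.topSmooth ((jacobian t * A) l m)) =
          ∑ j, f l * O.res h (φ.topSmooth (jacobian t l j)) * O.res h (φ.topSmooth (A j m)) :=
        fun l => by
          rw [Matrix.mul_apply, topSmooth_sum, map_sum, Finset.mul_sum]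
          refine Finset.sum_congr rfl fun j _ => ?_
          rw [topSmooth_mul, map_mul, mul_assoc]
      rw [Finset.sum_congr rfl fun l _ => e2 l, Finset.sum_comm]
      refine Finset.sum_eq_zero fun j _ => ?_
      rw [← Finset.sum_mul, hJ, zero_mul]
    rw [hexp]
    exact Finset.sum_eq_zero fun l _ => (congrArg (· • _) (hf0 l)).trans (zero_smul _ _)

theorem hasCoordinateSplitting : φ.HasCoordinateSplitting := by
  intro t ht κ _ _ w d hw
  obtain ⟨A, hA⟩ := exists_mul_jacobian_eq_one ht
  have hF := φ.isDualFrame_coord hA hw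
  refine ⟨(fun i => φ.coordFrame A w (Sum.inl i), fun α => φ.coordFrame A w (Sum.inr α)),
    { graded_dt := φ.isGraded_coordFrame_inl A w
      graded_dw := φ.isGraded_coordFrame_inr A hw
      dt_t := fun i j => (hF.app_eq (Sum.inl i) (Sum.inl j)).trans (by simp only [Sum.inl.injEq])
      dt_w := fun i β => (hF.app_eq (Sum.inl i) (Sum.inr β)).trans (if_neg Sum.inl_ne_inr)
      dw_w := fun α β => (hF.app_eq (Sum.inr α) (Sum.inr β)).trans (by simp only [Sum.inr.injEq])
      dw_t := fun α j => (hF.app_eq (Sum.inr α) (Sum.inl j)).trans (if_neg Sum.inr_ne_inl)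
      isFrame := by
        have e : Sum.elim (fun i => φ.coordFrame A w (Sum.inl i))
            (fun α => φ.coordFrame A w (Sum.inr α)) = φ.coordFrame A w :=
          Sum.elim_comp_inl_inr _
        exact e ▸ hF.isFrame
      splitting := fun V h D f g => ?_ }, ?_⟩
  · have e := hF.eq_sum_iff h D (Sum.elim f g)
    rw [Fintype.sum_sum_type, Sum.forall] at e
    exact e
  · rintro ⟨dt, dw⟩ hD
    have hext : ∀ T T' : O.Vec φ.domain,
        (∀ j, app T (φ.topSmooth (t j)) = app T' (φ.topSmooth (t j))) →
        (∀ β, app T (φ.topGen (w β)) = app T' (φ.topGen (w β))) → T = T' := fun T T' h1 h2 =>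
      hF.ext le_rfl (Sum.forall.2 ⟨fun j => by rw [O.res_self]; exact h1 j,
        fun β => by rw [O.res_self]; exact h2 β⟩)
    refine Prod.ext (funext fun i => hext _ _ (fun j => ?_) fun β => ?_)
      (funext fun α => hext _ _ (fun j => ?_) fun β => ?_)
    · refine (hD.dt_t i j).trans (Eq.symm ?_)
      exact (hF.app_eq (Sum.inl i) (Sum.inl j)).trans (by simp only [Sum.inl.injEq])
    · exact (hD.dt_w i β).trans
        ((hF.app_eq (Sum.inl i) (Sum.inr β)).trans (if_neg Sum.inl_ne_inr)).symm
    · exact (hD.dw_t α j).trans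
        ((hF.app_eq (Sum.inr α) (Sum.inl j)).trans (if_neg Sum.inr_ne_inl)).symm
    · refine (hD.dw_w α β).trans (Eq.symm ?_)
      exact (hF.app_eq (Sum.inr α) (Sum.inr β)).trans (by simp only [Sum.inr.injEq])

end Trivialization
end Coordinates

/-! ### The splitting of the module of vector fields -/

section Splitting

universe u v

variable {p : ℤ →₀ ℕ}

namespace VField

/-- The constant vector field with value `v`. -/
noncomputable def const (V : Opens (Base p)) (v : Base p) : VField p V := ContMDiffMap.const v

/-- The `i`-th component of a vector field. -/
noncomputable def component {V : Opens (Base p)} (i : Fin (p 0)) (Y : VField p V) : Smooth p V :=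
  ⟨fun x => Y x i, ((EuclideanSpace.proj i : Base p →L[ℝ] ℝ).contMDiff).comp Y.2⟩

theorem component_apply {V : Opens (Base p)} (i : Fin (p 0)) (Y : VField p V) (x : V) :
    component i Y x = Y x i := rfl

theorem sum_apply {V : Opens (Base p)} {ι : Type*} (s : Finset ι) (Y : ι → VField p V) (x : V) :
    (∑ i ∈ s, Y i) x = ∑ i ∈ s, Y i x :=
  map_sum (AddMonoidHom.mk' (fun Y : VField p V => Y x) fun _ _ => rfl) Y s

/-- The constant coordinate vector fields are a basis of the module of vector fields on an open
subset of `ℝ^{p_0}`. -/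
noncomputable def basis (V : Opens (Base p)) : Module.Basis (Fin (p 0)) (Smooth p V) (VField p V) :=
  Module.Basis.ofEquivFun
    { toFun := fun Y i => component i Y
      map_add' := fun _ _ => rfl
      map_smul' := fun _ _ => rfl
      invFun := fun g => ∑ i, g i • const V (EuclideanSpace.single i 1)
      left_inv := fun Y => by
        ext1 x
        rw [sum_apply]
        exact (euclidean_sum_single (Y x)).symm
      right_inv := fun g => by
        funext j
        ext x
        rw [component_apply, sum_apply]
        refine (congrArg (fun v : Base p => v j)
          (Finset.sum_congr rfl fun i _ => rfl :
            _ = ∑ i, g i x • (EuclideanSpace.single i (1 : ℝ) : Base p))).trans ?_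
        simp [Pi.single_apply] }

end VField

/-- The derivative of a function along a vector field in coordinates. -/
theorem Smooth.eq_sum_dir {V : Opens (Base p)} {h h' : Smooth p V} {Y : VField p V}
    (H : ∀ x, h' x = mfderiv 𝓘(ℝ, Base p) 𝓘(ℝ, ℝ) h x (Y x)) :
    h' = ∑ i, VField.component i Y * Smooth.dir V (EuclideanSpace.single i 1) h := by
  ext x
  rw [H]
  refine (mfderiv_eq_fderiv_zeroExt V h.2 x (Y x)).trans ?_
  have e : (∑ i, VField.component i Y * Smooth.dir V (EuclideanSpace.single i 1) h) x =
      ∑ i, Y x i * fderiv ℝ (zeroExt V h) x (EuclideanSpace.single i 1) :=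
    map_sum (ContMDiffMap.evalRingHom (I := 𝓘(ℝ, Base p)) (n := ∞) (R := ℝ) x) _ _
  rw [e]
  conv_lhs => rw [euclidean_sum_single (Y x)]
  rw [map_sum]
  exact Finset.sum_congr rfl fun i _ => map_smul _ _ _

namespace Trivialization

open GradedPresheaf

variable {X : Type v} [TopologicalSpace X] {O : GradedPresheaf.{u} X} (φ : Trivialization p O)

/-- The basis of `(O ⊗ Vec_V) ⊕ (O ⊗ W^*)` formed by the constant coordinate vector fields and the
dual basis of the generators. -/
noncomputable def modelBasis (V : φ.Target) :
    Module.Basis (Fin (p 0) ⊕ Gen p) (φ.Sec V) (φ.VecModel V) :=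
  (Algebra.TensorProduct.basis (φ.Sec V) (VField.basis V.1)).prod
    (Algebra.TensorProduct.basis (φ.Sec V) (Pi.basisFun ℝ (Gen p)).dualBasis)

/-- The standard coordinate vector fields over an open subset of the trivialising open set. -/
noncomputable def frameBasis (V : φ.Target) :
    Module.Basis (Fin (p 0) ⊕ Gen p) (φ.Sec V) (O.Vec (preimage φ.e V.1)) :=
  Module.Basis.mk
    (φ.isDualFrame_std.isFrame.linearIndependent _ (φ.preimage_le_domain V))
    (φ.isDualFrame_std.isFrame.span_eq_top _ (φ.preimage_le_domain V)).ge

/-- The isomorphism that maps `f ⊗ Y + g ⊗ ξ` to `∑ f Y_i ∂/∂x_i + ∑ ξ(w_a) g ∂/∂w_a`. -/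
noncomputable def vecEquiv (V : φ.Target) :
    φ.VecModel V ≃ₗ[φ.Sec V] O.Vec (preimage φ.e V.1) :=
  (φ.modelBasis V).equivFun.trans (φ.frameBasis V).equivFun.symm

theorem vecEquiv_tmul (V : φ.Target) (f g : O.obj (preimage φ.e V.1)) (Y : VField p V.1)
    (ξ : Module.Dual ℝ (GenSpace p)) :
    φ.vecEquiv V ((show φ.Sec V from f) ⊗ₜ Y, (show φ.Sec V from g) ⊗ₜ ξ) =
      ∑ i, (f * φ.smooth V (VField.component i Y)) •
          vecRes (φ.preimage_le_domain V) (φ.stdDir i) +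
        ∑ a, (ξ (Pi.single a 1) • g) • vecRes (φ.preimage_le_domain V) (φ.stdGen a) := by
  rw [vecEquiv, LinearEquiv.trans_apply, Module.Basis.equivFun_symm_apply, Fintype.sum_sum_type]
  have hl : ∀ (f g : φ.Sec V) (i), (φ.modelBasis V).equivFun (f ⊗ₜ Y, g ⊗ₜ ξ) (Sum.inl i) =
      f * algebraMap (Smooth p V.1) (φ.Sec V) (VField.component i Y) := fun f g i => by
    rw [Module.Basis.equivFun_apply, modelBasis, Module.Basis.prod_repr_inl,
      Algebra.TensorProduct.basis_repr_tmul]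
    rfl
  have hr : ∀ (f g : φ.Sec V) (a), (φ.modelBasis V).equivFun (f ⊗ₜ Y, g ⊗ₜ ξ) (Sum.inr a) =
      ξ (Pi.single a 1) • g := fun f g a => by
    rw [Module.Basis.equivFun_apply, modelBasis, Module.Basis.prod_repr_inr,
      Algebra.TensorProduct.basis_repr_tmul, Finsupp.smul_apply, Finsupp.mapRange_apply,
      Module.Basis.dualBasis_repr, Pi.basisFun_apply, smul_eq_mul, ← Algebra.commutes,
      ← Algebra.smul_def]
  have fl : ∀ i, φ.frameBasis V (Sum.inl i) = vecRes (φ.preimage_le_domain V) (φ.stdDir i) :=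
    fun i => Module.Basis.mk_apply (R := φ.Sec V) _ _ _
  have fr : ∀ a, φ.frameBasis V (Sum.inr a) = vecRes (φ.preimage_le_domain V) (φ.stdGen a) :=
    fun a => Module.Basis.mk_apply (R := φ.Sec V) _ _ _
  refine congrArg₂ (· + ·) (Finset.sum_congr rfl fun i _ => ?_) (Finset.sum_congr rfl fun a _ => ?_)
  · rw [fl]
    exact congrArg (fun c : φ.Sec V => c • vecRes (φ.preimage_le_domain V) (φ.stdDir i)) (hl f g i)
  · rw [fr]
    exact congrArg (fun c : φ.Sec V => c • vecRes (φ.preimage_le_domain V) (φ.stdGen a)) (hr f g a)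

theorem vecEquiv_tmul_zero (V : φ.Target) (f : O.obj (preimage φ.e V.1)) (Y : VField p V.1) :
    φ.vecEquiv V ((show φ.Sec V from f) ⊗ₜ Y, 0) =
      ∑ i, (f * φ.smooth V (VField.component i Y)) •
        vecRes (φ.preimage_le_domain V) (φ.stdDir i) := by
  have h := φ.vecEquiv_tmul V f 0 Y 0
  rw [TensorProduct.tmul_zero] at h
  rw [h, add_eq_left]
  refine Finset.sum_eq_zero fun a _ => ?_
  rw [smul_zero, zero_smul]

theorem vecEquiv_zero_tmul (V : φ.Target) (g : O.obj (preimage φ.e V.1))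
    (ξ : Module.Dual ℝ (GenSpace p)) :
    φ.vecEquiv V (0, (show φ.Sec V from g) ⊗ₜ ξ) =
      ∑ a, (ξ (Pi.single a 1) • g) • vecRes (φ.preimage_le_domain V) (φ.stdGen a) := by
  have h := φ.vecEquiv_tmul V 0 g 0 ξ
  rw [TensorProduct.tmul_zero] at h
  rw [h, add_eq_right]
  refine Finset.sum_eq_zero fun i _ => ?_
  rw [zero_mul, zero_smul]

theorem vecRes_sum_std {V U : φ.Target} (h : V.1 ≤ U.1) (f g : O.obj (preimage φ.e U.1))
    (Y : VField p U.1) (ξ : Module.Dual ℝ (GenSpace p)) :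
    vecRes (preimage_mono φ.e h)
      (∑ i, (f * φ.smooth U (VField.component i Y)) •
          vecRes (φ.preimage_le_domain U) (φ.stdDir i) +
        ∑ a, (ξ (Pi.single a 1) • g) • vecRes (φ.preimage_le_domain U) (φ.stdGen a)) =
      ∑ i, (O.res (preimage_mono φ.e h) f * φ.smooth V (VField.component i (VField.res h Y))) •
          vecRes (φ.preimage_le_domain V) (φ.stdDir i) +
        ∑ a, (ξ (Pi.single a 1) • O.res (preimage_mono φ.e h) g) •
          vecRes (φ.preimage_le_domain V) (φ.stdGen a) := by
  rw [vecRes_add, vecRes_sum, vecRes_sum]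
  refine congrArg₂ (· + ·) (Finset.sum_congr rfl fun i _ => ?_)
    (Finset.sum_congr rfl fun a _ => ?_)
  · rw [vecRes_smul, vecRes_vecRes, map_mul, φ.res_smooth h]
    rfl
  · rw [vecRes_smul, vecRes_vecRes, map_smul]

/-- The values `ξ(w_a)` of a dual vector of degree `k` vanish unless `|w_a| = -k`. -/
theorem isGraded_smul_stdGen (V : φ.Target) {d k : ℤ} {g : O.obj (preimage φ.e V.1)}
    (hg : g ∈ O.deg (preimage φ.e V.1) d) {ξ : Module.Dual ℝ (GenSpace p)} (hξ : ξ ∈ dualDeg p k)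
    (a : Gen p) :
    IsGraded ((ξ (Pi.single a 1) • g) • vecRes (φ.preimage_le_domain V) (φ.stdGen a)) (d + k) := by
  by_cases ha : a.deg = -k
  · have h := IsGraded.smul (Submodule.smul_mem _ (ξ (Pi.single a 1)) hg)
      ((φ.isGraded_stdGen a).vecRes (φ.preimage_le_domain V))
    rwa [ha, neg_neg] at h
  · rw [hξ a.deg ha _ (single_mem_deg a), zero_smul, zero_smul]
    exact Submodule.zero_mem _

theorem isVecSplitting_vecEquiv : φ.IsVecSplitting φ.vecEquiv where
  natural V U h f g Y ξ := by
    exact (congrArg (vecRes (preimage_mono φ.e h)) (φ.vecEquiv_tmul U f g Y ξ)).trans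
      ((φ.vecRes_sum_std h f g Y ξ).trans (φ.vecEquiv_tmul V _ _ _ ξ).symm)
  graded_left V d f hf Y := by
    refine (φ.vecEquiv_tmul_zero V f Y).symm ▸ IsGraded.sum fun i _ => ?_
    have h1 := (O.gradedMonoid _).mul_mem hf (φ.smooth_mem V (VField.component i Y))
    have h2 := IsGraded.smul h1 ((φ.isGraded_stdDir i).vecRes (φ.preimage_le_domain V))
    rwa [add_zero, add_zero] at h2
  graded_right V d k g hg ξ hξ := by
    exact (φ.vecEquiv_zero_tmul V g ξ).symm ▸ IsGraded.sum fun a _ =>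
      φ.isGraded_smul_stdGen V hg hξ a
  apply_smooth V f g Y ξ h h' H := by
    rw [vecEquiv_tmul, app_add, app_sum, app_sum,
      Finset.sum_eq_zero (s := (Finset.univ : Finset (Gen p))) fun a _ => by
        rw [app_smul, stdGen_smooth, mul_zero],
      add_zero, Smooth.eq_sum_dir H, smooth_sum, Finset.mul_sum]
    refine Finset.sum_congr rfl fun i _ => ?_
    rw [app_smul, stdDir_smooth, smooth_mul, mul_assoc]
  apply_gen V f g Y ξ v := by
    rw [vecEquiv_tmul, app_add, app_sum, app_sum,
      Finset.sum_eq_zero (s := (Finset.univ : Finset (Fin (p 0)))) fun i _ => by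
        rw [app_smul, stdDir_gen, mul_zero],
      zero_add]
    have hv : ξ v = ∑ a, v a * ξ (Pi.single a 1) := by
      conv_lhs => rw [← (Pi.basisFun ℝ (Gen p)).sum_repr v, map_sum]
      exact Finset.sum_congr rfl fun a _ => by
        rw [map_smul, Pi.basisFun_apply, Pi.basisFun_repr, smul_eq_mul]
    rw [hv, Finset.sum_smul]
    refine Finset.sum_congr rfl fun a _ => ?_
    rw [app_smul, stdGen_gen, mul_smul_comm, mul_one, smul_smul]

theorem hasVecSplitting : φ.HasVecSplitting := ⟨φ.vecEquiv, φ.isVecSplitting_vecEquiv⟩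

theorem vecIsFreeOn_domain : O.VecIsFreeOn φ.domain := φ.isDualFrame_std.isFrame.vecIsFreeOn

theorem domain_ofOpen (U : Opens (Base p)) : (ofOpen p U).domain = U :=
  le_antisymm (fun _ hx => hx.1) fun _ hx => ⟨hx, hx⟩

end Trivialization
end Splitting

end GradedGeometry

theorem mainTheorem2 (p : ℤ →₀ ℕ) :
    (∀ U : Opens (Base p),
      (model p).VecIsSheaf ∧ (model p).VecIsFreeOn U ∧
      (Trivialization.ofOpen p U).HasVecSplitting ∧
      (Trivialization.ofOpen p U).HasCoordinateSplitting) ∧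
    ∀ (X : Type*) [TopologicalSpace X] (O : GradedPresheaf X), IsGradedManifold p O →
      O.VecIsSheaf ∧ O.VecIsLocallyFree ∧
      ∀ φ : Trivialization p O,
        O.VecIsFreeOn φ.domain ∧ φ.HasVecSplitting ∧ φ.HasCoordinateSplitting := by
  refine ⟨fun U => ⟨(model_isSheaf p).vecIsSheaf, ?_, (Trivialization.ofOpen p U).hasVecSplitting,
    (Trivialization.ofOpen p U).hasCoordinateSplitting⟩, fun X _ O hO =>
    ⟨hO.locallyRinged.isSheaf.vecIsSheaf, fun x => ?_, fun φ =>
      ⟨φ.vecIsFreeOn_domain, φ.hasVecSplitting, φ.hasCoordinateSplitting⟩⟩⟩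
  · have h := (Trivialization.ofOpen p U).vecIsFreeOn_domain
    rwa [Trivialization.domain_ofOpen] at h
  · obtain ⟨φ, hφ⟩ := hO.locallyTrivial x
    exact ⟨φ.domain, φ.coe_domain.symm.subset hφ, φ.vecIsFreeOn_domain⟩
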